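/- **Theorem.** A hypergraph $\mathcal H=(V,\mathcal E)$ consists of a finite set $V$ and a finite multiset $\mathcal E$ of subsets of $V$ (hyperedges). It is $(k,k)$-partition-connected if for every partition $\mathcal P$ of $V$ into at least two members, at least $k|\mathcal P|$ hyperedges intersect at least two members of $\mathcal P$. An orientation $\vec{\mathcal H}$ of $\mathcal H$ replaces every hyperedge $Z$ by a hyperarc $(Z-v,v)$ with head $v\in Z$ and tail vertices $Z-v$; reorienting the hyperarc $(Z-v,v)$ means replacing it by $(Z-u,u)$ for some $u\in Z-v$. The orientation is $k$-hyperarc-connected if for every $\emptyset\ne X\subsetneq V$ at least $k$ hyperarcs have their head outside $X$ and some tail vertex in $X$; its hyperarc-connectivity $\lambda(\vec{\mathcal H})$ is the maximum such integer $k$ (and $\infty$ if $|V|\le 1$). Let $k\ge 0$ be an integer, $\mathcal H$ a $(k+1,k+1)$-partition-connected hypergraph and $\vec{\mathcal H}$ a $k$-hyperarc-connected orientation of $\mathcal H$. Then there exists a sequence $\vec{\mathcal H}=\vec{\mathcal H}_0,\vec{\mathcal H}_1,\dots,\vec{\mathcal H}_\ell$ of orientations of $\mathcal H$ with $\ell\le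 |V|^3$ such that - for $1\le i\le \ell$, the orientation $\vec{\mathcal H}_i$ is obtained from $\vec{\mathcal H}_{i-1}$ by reorienting a single hyperarc, and $\lambda(\vec{\mathcal H}_{i-1})\le\lambda(\vec{\mathcal H}_i)$; - $\vec{\mathcal H}_\ell$ is $(k+1)$-hyperarc-connected, and moreover $\lambda(\vec{\mathcal H}_\ell)=k+1$ whenever $\lambda(\vec{\mathcal H})\le k+1$. Furthermore, there is an algorithm (a single random access machine program, with unit-cost addition, subtraction, comparison and indirect addressing, but no multiplication) that, given any such $\mathcal H$, $k$ and $\vec{\mathcal H}$, outputs such a sequence, of length $\ell\le|V|^3$, in time bounded by a fixed polynomial in the size $|V|+\sum_{Z\in\mathcal E}|Z|$ of $\mathcal H$. -/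

import Mathlib

/-! ## Hypergraphs and their orientations -/

/-- A finite hypergraph on the vertex set `V`: a multiset of subsets of `V`, given as a family
indexed by `E` (so that a subset may occur several times). -/
structure MultiHypergraph (V E : Type*) where
  /-- the vertex set of the hyperedge with index `e` -/
  edge : E → Finset V

namespace MultiHypergraph

variable {V E : Type*} [Fintype V] [DecidableEq V] [Fintype E] [DecidableEq E]

/-- The size of a hypergraph: `|V| + ∑ |Z|`, where `Z` runs over the hyperedges. -/
def size (H : MultiHypergraph V E) : ℕ :=
  Fintype.card V + ∑ e : E, (H.edge e).card

/-- The number of hyperedges that intersect at least two members of the partition `P`. -/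
def crossCount (H : MultiHypergraph V E) (P : Finpartition (Finset.univ : Finset V)) : ℕ :=
  (Finset.univ.filter fun e : E =>
    ∃ A ∈ P.parts, ∃ B ∈ P.parts, A ≠ B ∧ (H.edge e ∩ A).Nonempty ∧ (H.edge e ∩ B).Nonempty).card

/-- `(k,k)`-partition-connectivity: for every partition `P` of `V` into at least two members, at
least `k * |P|` hyperedges intersect two or more members of `P`. -/
def IsPartitionConnected (H : MultiHypergraph V E) (k : ℕ) : Prop :=
  ∀ P : Finpartition (Finset.univ : Finset V), 2 ≤ P.parts.card →
    k * P.parts.card ≤ H.crossCount P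

/-- An orientation chooses a head vertex in each hyperedge `Z`, which turns `Z` into the hyperarc
`(Z - v, v)` with head `v` and set of tail vertices `Z - v`. -/
@[ext]
structure Orientation (H : MultiHypergraph V E) where
  /-- the head vertex of each hyperarc -/
  head : E → V
  head_mem : ∀ e, head e ∈ H.edge e

namespace Orientation

variable {H : MultiHypergraph V E}

/-- The set of tail vertices of a hyperarc. -/
def tail (O : H.Orientation) (e : E) : Finset V :=
  (H.edge e).erase (O.head e)

/-- The out-degree of `X`: the number of hyperarcs with head outside `X` and some tail vertex
in `X`. -/
def outDegree (O : H.Orientation) (X : Finset V) : ℕ :=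
  (Finset.univ.filter fun e : E => O.head e ∉ X ∧ (X ∩ O.tail e).Nonempty).card

/-- Every non-empty proper subset of vertices has out-degree at least `k`. -/
def IsHyperarcConnected (O : H.Orientation) (k : ℕ) : Prop :=
  ∀ X : Finset V, X.Nonempty → X ≠ Finset.univ → k ≤ O.outDegree X

/-- The hyperarc-connectivity: the maximum `k` such that the orientation is
`k`-hyperarc-connected. It is `⊤` exactly when there is no such maximum, that is, when `V` has at
most one vertex. -/
noncomputable def hyperarcConnectivity (O : H.Orientation) : ℕ∞ :=
  ⨆ (k : ℕ) (_ : O.IsHyperarcConnected k), (k : ℕ∞)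

/-- `O'` is obtained from `O` by reorienting a single hyperarc `(Z - v, v)` towards one of its tail
vertices. -/
def IsReorientation (O O' : H.Orientation) : Prop :=
  ∃ e : E, ∃ u ∈ O.tail e, O'.head = Function.update O.head e u

/-- `seq 0, …, seq ℓ` starts at `O`, each member arises from the previous one by reorienting a
single hyperarc, hyperarc-connectivity never decreases, the last member is
`(k+1)`-hyperarc-connected, and its hyperarc-connectivity is exactly `k+1` unless that of `O` is
already larger. -/
structure IsAugmentingSequence (O : H.Orientation) (k ℓ : ℕ) (seq : ℕ → H.Orientation) :
    Prop where
  start : seq 0 = O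
  step : ∀ i < ℓ, (seq i).IsReorientation (seq (i + 1))
  monotone : ∀ i < ℓ, (seq i).hyperarcConnectivity ≤ (seq (i + 1)).hyperarcConnectivity
  connected : (seq ℓ).IsHyperarcConnected (k + 1)
  exact : O.hyperarcConnectivity ≤ ((k + 1 : ℕ) : ℕ∞) →
    (seq ℓ).hyperarcConnectivity = ((k + 1 : ℕ) : ℕ∞)

end Orientation

end MultiHypergraph

/-! ## Programs and their running time

A random access machine in structured form: while-programs over scalar variables and
two-dimensional arrays of natural numbers (a one-dimensional array is a row of such an array).
The primitive operations are addition, truncated subtraction, comparison, and indirect reading and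
writing of array cells, each at cost one. There is no multiplication, so `T` steps produce numbers
and cell indices of `O(T)` more bits than those at the start; polynomial time on this machine is
therefore polynomial time on Turing machines. -/

namespace RAM

/-- The contents of the memory: scalar variables, and arrays (first index: name of the array). -/
structure State where
  /-- scalar variables -/
  reg : ℕ → ℕ
  /-- arrays -/
  arr : ℕ → ℕ → ℕ → ℕ

/-- Arithmetic expressions. -/
inductive Expr where
  /-- constant -/
  | lit (c : ℕ)
  /-- scalar variable -/
  | var (x : ℕ)
  /-- array cell `a[i, j]` -/
  | get (a : ℕ) (i j : Expr)
  | add (e f : Expr)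
  /-- truncated subtraction -/
  | sub (e f : Expr)
  /-- `1` if `e < f`, else `0` -/
  | lt (e f : Expr)
  /-- `1` if `e = f`, else `0` -/
  | eq (e f : Expr)

/-- The value of an expression. -/
def Expr.eval (s : State) : Expr → ℕ
  | .lit c => c
  | .var x => s.reg x
  | .get a i j => s.arr a (i.eval s) (j.eval s)
  | .add e f => e.eval s + f.eval s
  | .sub e f => e.eval s - f.eval s
  | .lt e f => if e.eval s < f.eval s then 1 else 0
  | .eq e f => if e.eval s = f.eval s then 1 else 0

/-- The number of steps taken to evaluate an expression. -/
def Expr.cost : Expr → ℕ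
  | .lit _ => 1
  | .var _ => 1
  | .get _ i j => i.cost + j.cost + 1
  | .add e f => e.cost + f.cost + 1
  | .sub e f => e.cost + f.cost + 1
  | .lt e f => e.cost + f.cost + 1
  | .eq e f => e.cost + f.cost + 1

/-- Programs. -/
inductive Prog where
  | skip
  /-- `x := e` -/
  | assign (x : ℕ) (e : Expr)
  /-- `a[i, j] := e` -/
  | store (a : ℕ) (i j e : Expr)
  | seq (P Q : Prog)
  /-- if `c ≠ 0` then `P` else `Q` -/
  | ite (c : Expr) (P Q : Prog)
  /-- while `c ≠ 0` do `P` -/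
  | loop (c : Expr) (P : Prog)

/-- The state after `x := v`. -/
def State.setReg (s : State) (x v : ℕ) : State :=
  { s with reg := Function.update s.reg x v }

/-- The state after `a[i, j] := v`. -/
def State.setArr (s : State) (a i j v : ℕ) : State :=
  { s with arr := fun a' i' j' => if a' = a ∧ i' = i ∧ j' = j then v else s.arr a' i' j' }

/-- `Exec P s t s'`: started in state `s`, the program `P` halts after exactly `t` steps in
state `s'`. -/
inductive Exec : Prog → State → ℕ → State → Prop where
  | skip (s : State) : Exec .skip s 1 s
  | assign (s : State) (x : ℕ) (e : Expr) :
      Exec (.assign x e) s (e.cost + 1) (s.setReg x (e.eval s))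
  | store (s : State) (a : ℕ) (i j e : Expr) :
      Exec (.store a i j e) s (i.cost + j.cost + e.cost + 1)
        (s.setArr a (i.eval s) (j.eval s) (e.eval s))
  | seq {P Q : Prog} {s s' s'' : State} {t t' : ℕ} :
      Exec P s t s' → Exec Q s' t' s'' → Exec (.seq P Q) s (t + t') s''
  | ite_true {c : Expr} {P Q : Prog} {s s' : State} {t : ℕ} :
      c.eval s ≠ 0 → Exec P s t s' → Exec (.ite c P Q) s (c.cost + 1 + t) s'
  | ite_false {c : Expr} {P Q : Prog} {s s' : State} {t : ℕ} :
      c.eval s = 0 → Exec Q s t s' → Exec (.ite c P Q) s (c.cost + 1 + t) s'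
  | loop_true {c : Expr} {P : Prog} {s s' s'' : State} {t t' : ℕ} :
      c.eval s ≠ 0 → Exec P s t s' → Exec (.loop c P) s' t' s'' →
        Exec (.loop c P) s (c.cost + 1 + t + t') s''
  | loop_false {c : Expr} {P : Prog} {s : State} :
      c.eval s = 0 → Exec (.loop c P) s (c.cost + 1) s

/-- A run is determined by the program and the initial state. -/
theorem Exec.deterministic {P : Prog} {s s₁ s₂ : State} {t₁ t₂ : ℕ}
    (h₁ : Exec P s t₁ s₁) (h₂ : Exec P s t₂ s₂) : t₁ = t₂ ∧ s₁ = s₂ := by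
  induction h₁ generalizing t₂ s₂ with
  | skip s => cases h₂; exact ⟨rfl, rfl⟩
  | assign s x e => cases h₂; exact ⟨rfl, rfl⟩
  | store s a i j e => cases h₂; exact ⟨rfl, rfl⟩
  | seq _ _ ih ih' =>
    cases h₂ with
    | seq g g' =>
      obtain ⟨rfl, rfl⟩ := ih g
      obtain ⟨rfl, rfl⟩ := ih' g'
      exact ⟨rfl, rfl⟩
  | ite_true hc _ ih =>
    cases h₂ with
    | ite_true _ g => obtain ⟨rfl, rfl⟩ := ih g; exact ⟨rfl, rfl⟩
    | ite_false hc' _ => exact absurd hc' hc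
  | ite_false hc _ ih =>
    cases h₂ with
    | ite_true hc' _ => exact absurd hc hc'
    | ite_false _ g => obtain ⟨rfl, rfl⟩ := ih g; exact ⟨rfl, rfl⟩
  | loop_true hc _ _ ih ih' =>
    cases h₂ with
    | loop_true _ g g' =>
      obtain ⟨rfl, rfl⟩ := ih g
      obtain ⟨rfl, rfl⟩ := ih' g'
      exact ⟨rfl, rfl⟩
    | loop_false hc' => exact absurd hc' hc
  | loop_false hc =>
    cases h₂ with
    | loop_true hc' _ _ => exact absurd hc hc'
    | loop_false _ => exact ⟨rfl, rfl⟩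

/-- The initial memory for a hypergraph `H` with vertices `0, …, n-1` and hyperedges
`0, …, m-1`, a number `k` and an orientation `O` of `H`. The variables `0, 1, 2` hold `n, m, k`.
Array `0` is the incidence matrix of `H` (row `e`, column `v`). Row `0` of array `1` lists the
heads of `O`. All the rest is zero. -/
def inputState {n m : ℕ} (H : MultiHypergraph (Fin n) (Fin m)) (k : ℕ) (O : H.Orientation) :
    State where
  reg
    | 0 => n
    | 1 => m
    | 2 => k
    | _ => 0
  arr
    | 0, e, v =>
      if h : e < m ∧ v < n then
        if (⟨v, h.2⟩ : Fin n) ∈ H.edge ⟨e, h.1⟩ then 1 else 0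
      else 0
    | 1, 0, e => if h : e < m then (O.head ⟨e, h⟩ : ℕ) else 0
    | _, _, _ => 0

/-- The memory `s` holds the sequence `seq 0, …, seq ℓ` of orientations of `H` as output:
variable `0` holds `ℓ`, and for `i ≤ ℓ` row `i` of array `1` lists the heads of `seq i`. -/
def HoldsSequence {n m : ℕ} {H : MultiHypergraph (Fin n) (Fin m)} (s : State) (ℓ : ℕ)
    (seq : ℕ → H.Orientation) : Prop :=
  s.reg 0 = ℓ ∧ ∀ i ≤ ℓ, ∀ e : Fin m, s.arr 1 i e = ((seq i).head e : ℕ)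

end RAM

/-!
# Raising the hyperarc-connectivity of an orientation by single reorientations

For a `k`-hyperarc-connected orientation let `f X` be the in-degree of `X`. By submodularity and
partition-connectivity, `f` is an admissible cut function (`CutFunction.IsAdmissible`), and so is
its dual, which exchanges in- and out-degrees. A set of in-degree `k` is in-tight, its complement
is out-tight; the orientation is `(k+1)`-hyperarc-connected if and only if there is no tight set.

Turning the hyperarcs of a path from `x` to `w`, beginning at `w`, amounts to moving a single head
along the path, so that in the end `f X` has changed by `[x ∈ X] - [w ∈ X]`. All intermediate
orientations are `k`-hyperarc-connected if every in-tight set that contains `w` contains all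
vertices of the path: these vertices accompany `w`.

The pair `x`, `w` has to be such that the transfer makes progress. A minimal out-tight set `Y` has
a safe sink `w`: in-tight sets around `w` contain `Y`, and no set without tight subsets becomes
in-tight inside `Y`. If there were none, then obstructing sets of in-degree at most `k + 1` would
cover `Y`, and together with the complement of `Y` their maximal unions would be a partition of `V`
that contradicts partition-connectivity (`IsAdmissible.exists_isSafeSink`). Dually, a minimal
in-tight set has a safe source `x`. A path from a safe source to a safe sink along accompanying
vertices exists inside a minimal set that contains both an in-tight and an out-tight set
(`IsAdmissible.exists_source_sink`). The transfer then destroys a minimal tight set while each new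
tight set contains an old one (`IsAdmissible.tight_of_transfer`). Hence the potential, the sum of
`|V| - |M|` over the minimal tight sets `M`, drops. These sets are disjoint, so the potential is at
most `|V| (|V| - 1)`, and `|V|` reorientations suffice for each transfer. The resulting sequence is
cut off at its first `(k+1)`-hyperarc-connected member; up to there the hyperarc-connectivity is
exactly `k`, and a single reorientation raises it by at most one.

For the algorithm nothing has to be known about where safe vertices lie: all pairs `x`, `w` are
tried, and the first one for which the potential drops is taken. What has to be computed is the
relation of accompanying. A pair of vertices is separated by an in-tight set if and only if after
the transfer of `k` heads from one to the other there is no path left (`RAM.run_flowPair`). At most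
`m` transfers are made, although `k` is not bounded by the size of `H`: between distinct vertices
`k` is at most the number of hyperarcs. Minimal tight sets are hulls of single vertices, that is,
intersections of all tight sets of one kind around a vertex, so the potential can be computed from
the relation as well (`IsAdmissible.potential_eq_card`).

The algorithm is written in a small language of commands whose loops run over vertices or hyperedges
only. Commands have a meaning as functions on states (`RAM.Cmd.run`) and a static polynomial time
bound, and they are compiled into programs of the random access machine (`RAM.Cmd.exec_code`). Array
`0` holds the incidence matrix, array `1` the sequence of orientations found so far, array `2`
orientations needed only temporarily; row `0` of array `3` holds the levels assigned to vertices by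
a search, array `4` the table of separated pairs, and row `0` of array `5` the set of vertices that
a search may use.
-/

set_option linter.unusedSectionVars false
open Finset

/-! ### In-degrees -/

namespace MultiHypergraph
namespace Orientation

variable {V E : Type*} [Fintype V] [DecidableEq V] [Fintype E] {H : MultiHypergraph V E}

/-- The in-degree of `X`: the number of hyperarcs with head in `X` and some tail vertex outside
`X`. -/
def inDegree (O : H.Orientation) (X : Finset V) : ℕ :=
  (univ.filter fun e : E => O.head e ∈ X ∧ ¬ H.edge e ⊆ X).card

/-- Some hyperarc has tail vertex `a` and head `b`, or `a = b` is a head. -/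
def Arc (O : H.Orientation) (a b : V) : Prop := ∃ e, a ∈ H.edge e ∧ O.head e = b

theorem outDegree_eq_inDegree_compl (O : H.Orientation) (X : Finset V) :
    O.outDegree X = O.inDegree Xᶜ := by
  unfold outDegree inDegree tail
  congr 1
  ext e
  simp only [mem_filter, mem_univ, true_and, mem_compl, and_congr_right_iff]
  intro he
  simp only [Finset.Nonempty, mem_inter, mem_erase, not_subset, mem_compl, not_not]
  constructor
  · rintro ⟨v, hv, -, hv'⟩; exact ⟨v, hv', hv⟩
  · rintro ⟨v, hv, hv'⟩; exact ⟨v, hv', fun h => he (h ▸ hv'), hv⟩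

theorem isHyperarcConnected_iff (O : H.Orientation) (k : ℕ) :
    O.IsHyperarcConnected k ↔
      ∀ X : Finset V, X.Nonempty → X ≠ univ → k ≤ O.inDegree X := by
  constructor
  · intro h X h1 h2
    have := h Xᶜ (by rwa [← compl_ne_univ_iff_nonempty, compl_compl])
      (by rwa [compl_ne_univ_iff_nonempty])
    rwa [outDegree_eq_inDegree_compl, compl_compl] at this
  · intro h X h1 h2
    rw [outDegree_eq_inDegree_compl]
    exact h _ (by rwa [← compl_ne_univ_iff_nonempty, compl_compl])
      (by rwa [compl_ne_univ_iff_nonempty])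

theorem inDegree_inter_add_union (O : H.Orientation) (A B : Finset V) :
    O.inDegree (A ∩ B) + O.inDegree (A ∪ B) ≤ O.inDegree A + O.inDegree B := by
  unfold inDegree
  simp only [card_filter, ← sum_add_distrib]
  refine sum_le_sum fun e _ => ?_
  have h1 : H.edge e ⊆ A ∩ B ↔ H.edge e ⊆ A ∧ H.edge e ⊆ B := subset_inter_iff
  have h2 : H.edge e ⊆ A → H.edge e ⊆ A ∪ B := fun h => h.trans subset_union_left
  have h3 : H.edge e ⊆ B → H.edge e ⊆ A ∪ B := fun h => h.trans subset_union_right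
  have h4 : H.edge e ⊆ A → O.head e ∈ A := fun h => h (O.head_mem e)
  have h5 : H.edge e ⊆ B → O.head e ∈ B := fun h => h (O.head_mem e)
  simp only [h1, mem_inter, mem_union]
  by_cases hA : H.edge e ⊆ A <;> by_cases hB : H.edge e ⊆ B <;>
    by_cases hU : H.edge e ⊆ A ∪ B <;> by_cases hhA : O.head e ∈ A <;>
    by_cases hhB : O.head e ∈ B <;> simp_all

/-- If no hyperarc leads from `A` to `D \ A`, then every hyperarc that leaves `A` leaves `D`, and
every hyperarc that enters `D \ A` enters `D`. -/
theorem inDegree_le_of_no_arc (O : H.Orientation) {A D : Finset V} (hAD : A ⊆ D)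
    (h : ∀ a ∈ A, ∀ b ∈ D \ A, ¬ O.Arc a b) :
    O.inDegree Aᶜ ≤ O.inDegree Dᶜ ∧ O.inDegree (D \ A) ≤ O.inDegree D := by
  constructor
  · refine card_le_card fun e => ?_
    simp only [mem_filter, mem_univ, true_and, mem_compl, not_subset, not_not]
    rintro ⟨h1, v, hv, hvA⟩
    exact ⟨fun hD => h v hvA _ (mem_sdiff.2 ⟨hD, h1⟩) ⟨e, hv, rfl⟩, v, hv, hAD hvA⟩
  · refine card_le_card fun e => ?_
    simp only [mem_filter, mem_univ, true_and, mem_sdiff, not_subset, not_and, not_not]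
    rintro ⟨⟨h1, h2⟩, v, hv, hv'⟩
    exact ⟨h1, v, hv, fun hD => h v (hv' hD) _ (mem_sdiff.2 ⟨h1, h2⟩) ⟨e, hv, rfl⟩⟩

/-- Whether a hyperedge crosses a partition can be read off at the part that contains its head. -/
theorem crossCount_le_sum_inDegree (O : H.Orientation) (P : Finpartition (univ : Finset V)) :
    H.crossCount P ≤ ∑ A ∈ P.parts, O.inDegree A := by
  classical
  unfold crossCount inDegree
  refine le_trans (card_le_card fun e he => ?_) card_biUnion_le
  simp only [mem_filter, mem_univ, true_and, mem_biUnion] at he ⊢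
  obtain ⟨A, hA, B, hB, hAB, ⟨a, ha⟩, ⟨b, hb⟩⟩ := he
  rw [mem_inter] at ha hb
  obtain ⟨C, hC, heC⟩ := P.exists_mem (mem_univ (O.head e))
  refine ⟨C, hC, heC, fun hsub => hAB ?_⟩
  rw [P.eq_of_mem_parts hA hC ha.2 (hsub ha.1), P.eq_of_mem_parts hB hC hb.2 (hsub hb.1)]

theorem crossCount_le_sum_inDegree_compl (O : H.Orientation)
    (P : Finpartition (univ : Finset V)) :
    H.crossCount P ≤ ∑ A ∈ P.parts, O.inDegree Aᶜ := by
  classical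
  unfold crossCount inDegree
  refine le_trans (card_le_card fun e he => ?_) card_biUnion_le
  simp only [mem_filter, mem_univ, true_and, mem_biUnion] at he ⊢
  obtain ⟨A, hA, B, hB, hAB, ⟨a, ha⟩, ⟨b, hb⟩⟩ := he
  rw [mem_inter] at ha hb
  by_cases hh : O.head e ∈ A
  · refine ⟨B, hB, mem_compl.2 fun h => hAB (P.eq_of_mem_parts hA hB hh h), fun hsub => ?_⟩
    exact mem_compl.1 (hsub hb.1) hb.2
  · exact ⟨A, hA, mem_compl.2 hh, fun hsub => mem_compl.1 (hsub ha.1) ha.2⟩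

/-- Moving the head of one hyperarc from `O.head e` to `a` changes in-degrees as if only the number
of heads at these two vertices mattered. -/
theorem inDegree_update [DecidableEq E] {O O' : H.Orientation} {e : E} {a : V} (ha : a ∈ H.edge e)
    (h : O'.head = Function.update O.head e a) (X : Finset V) :
    O'.inDegree X + (if O.head e ∈ X then 1 else 0) =
      O.inDegree X + (if a ∈ X then 1 else 0) := by
  unfold inDegree
  simp only [card_filter]
  rw [← add_sum_erase _ (fun i => if O'.head i ∈ X ∧ ¬ H.edge i ⊆ X then 1 else 0) (mem_univ e),
    ← add_sum_erase _ (fun i => if O.head i ∈ X ∧ ¬ H.edge i ⊆ X then 1 else 0) (mem_univ e)]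
  have h1 : ∑ x ∈ univ.erase e, (if O'.head x ∈ X ∧ ¬ H.edge x ⊆ X then 1 else 0) =
      ∑ x ∈ univ.erase e, (if O.head x ∈ X ∧ ¬ H.edge x ⊆ X then 1 else 0) := by
    refine sum_congr rfl fun x hx => ?_
    rw [h, Function.update_of_ne (ne_of_mem_erase hx)]
  have h2 : O'.head e = a := by rw [h, Function.update_self]
  rw [h1, h2]
  by_cases hX : H.edge e ⊆ X
  · simp [hX ha, hX (O.head_mem e)]
  · simp only [hX, not_false_eq_true, and_true]; split_ifs <;> omega

end Orientation
end MultiHypergraph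

/-! ### Tight sets and safe sinks -/

namespace CutFunction

variable {V : Type*} [Fintype V] [DecidableEq V] {f : Finset V → ℕ} {k : ℕ}

/-- A non-empty proper subset on which `f` takes the value `k`. -/
def InTight (f : Finset V → ℕ) (k : ℕ) (X : Finset V) : Prop :=
  X.Nonempty ∧ X ≠ univ ∧ f X = k

/-- A set whose complement is in-tight. -/
def OutTight (f : Finset V → ℕ) (k : ℕ) (X : Finset V) : Prop :=
  InTight f k Xᶜ

/-- A set that is in-tight or out-tight. -/
def Tight (f : Finset V → ℕ) (k : ℕ) (X : Finset V) : Prop :=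
  InTight f k X ∨ OutTight f k X

/-- The properties of the in-degree function of a `k`-hyperarc-connected orientation of a
`(k+1,k+1)`-partition-connected hypergraph on which the search for a good pair of vertices
rests. They are invariant under exchanging in- and out-degrees. -/
structure IsAdmissible (f : Finset V → ℕ) (k : ℕ) : Prop where
  le : ∀ X : Finset V, X.Nonempty → X ≠ univ → k ≤ f X
  submod : ∀ A B, f (A ∩ B) + f (A ∪ B) ≤ f A + f B
  part : ∀ P : Finpartition (univ : Finset V), 2 ≤ P.parts.card →
    (k + 1) * P.parts.card ≤ ∑ A ∈ P.parts, f A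
  copart : ∀ P : Finpartition (univ : Finset V), 2 ≤ P.parts.card →
    (k + 1) * P.parts.card ≤ ∑ A ∈ P.parts, f Aᶜ
  map_empty : f ∅ = 0
  map_univ : f univ = 0

/-- The out-degree function, if `f` is the in-degree function. -/
def dual (f : Finset V → ℕ) (X : Finset V) : ℕ := f Xᶜ

theorem compl_nonempty_of_ne_univ {X : Finset V} (h : X ≠ univ) : Xᶜ.Nonempty := by
  rwa [← compl_ne_univ_iff_nonempty, compl_compl]

theorem compl_ne_univ_of_nonempty {X : Finset V} (h : X.Nonempty) : Xᶜ ≠ univ := by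
  rwa [compl_ne_univ_iff_nonempty]

theorem outTight_iff {X : Finset V} :
    OutTight f k X ↔ X.Nonempty ∧ X ≠ univ ∧ f Xᶜ = k := by
  unfold OutTight InTight
  rw [compl_ne_univ_iff_nonempty, ← compl_ne_univ_iff_nonempty Xᶜ, compl_compl]
  tauto

theorem outTight_compl {X : Finset V} : OutTight f k Xᶜ ↔ InTight f k X := by
  unfold OutTight; rw [compl_compl]

theorem inTight_dual {X : Finset V} : InTight (dual f) k X ↔ OutTight f k X := by
  rw [outTight_iff]; rfl

theorem outTight_dual {X : Finset V} : OutTight (dual f) k X ↔ InTight f k X := by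
  rw [outTight_iff, dual, compl_compl]; rfl

theorem tight_dual {X : Finset V} : Tight (dual f) k X ↔ Tight f k X := by
  unfold Tight; rw [inTight_dual, outTight_dual, or_comm]

theorem IsAdmissible.dual (hf : IsAdmissible f k) : IsAdmissible (dual f) k where
  le X h1 h2 := hf.le _ (compl_nonempty_of_ne_univ h2) (compl_ne_univ_of_nonempty h1)
  submod A B := by
    have := hf.submod Aᶜ Bᶜ
    unfold CutFunction.dual
    rw [compl_inter, compl_union]
    omega
  part := hf.copart
  copart P h := by simpa [CutFunction.dual] using hf.part P h
  map_empty := by simpa [CutFunction.dual] using hf.map_univ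
  map_univ := by simpa [CutFunction.dual] using hf.map_empty

theorem OutTight.nonempty {X : Finset V} (h : OutTight f k X) : X.Nonempty :=
  (outTight_iff.1 h).1

theorem OutTight.ne_univ {X : Finset V} (h : OutTight f k X) : X ≠ univ :=
  (outTight_iff.1 h).2.1

theorem Tight.nonempty {X : Finset V} (h : Tight f k X) : X.Nonempty :=
  h.elim (fun h => h.1) (fun h => h.nonempty)

theorem Tight.ne_univ {X : Finset V} (h : Tight f k X) : X ≠ univ :=
  h.elim (fun h => h.2.1) (fun h => h.ne_univ)

namespace IsAdmissible

variable (hf : IsAdmissible f k)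
include hf

/-- Submodularity, applied to `A` and the complement of `B`. -/
theorem submod_sdiff (A B : Finset V) : f (A \ B) + f (B \ A)ᶜ ≤ f A + f Bᶜ := by
  have := hf.submod A Bᶜ
  rwa [← sdiff_eq_inter_compl, show A ∪ Bᶜ = (B \ A)ᶜ by
    rw [sdiff_eq_inter_compl, compl_inter, compl_compl, union_comm]] at this

theorem card_mul_le_sum (Q : Finset (Finset V)) (hne : ∀ A ∈ Q, A.Nonempty)
    (hd : (Q : Set (Finset V)).PairwiseDisjoint id) (hsup : Q.sup id = univ) (hc : 2 ≤ Q.card) :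
    (k + 1) * Q.card ≤ ∑ A ∈ Q, f A :=
  hf.part ⟨Q, supIndep_iff_pairwiseDisjoint.2 hd, hsup,
    fun h => not_nonempty_empty (hne _ h)⟩ hc

/-- A union-closed cover of `Y` by sets of value at most `k + 1` yields a partition of `V` into the
maximal members of the cover and the complement of `Y`, so `f Yᶜ` cannot be as small as `k`. -/
theorem not_cover {Y : Finset V} (hY : Y.Nonempty) (hYu : Y ≠ univ) (hYf : f Yᶜ = k)
    (F : Finset V → Prop) (hne : ∀ A, F A → A.Nonempty) (hsub : ∀ A, F A → A ⊆ Y)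
    (hval : ∀ A, F A → f A ≤ k + 1)
    (hun : ∀ A B, F A → F B → (A ∩ B).Nonempty → F (A ∪ B))
    (hcov : ∀ w ∈ Y, ∃ A, F A ∧ w ∈ A) : False := by
  classical
  let M : Finset (Finset V) := univ.filter (Maximal F)
  have hM : ∀ A, A ∈ M ↔ Maximal F A := fun A => by simp [M]
  have hcovM : ∀ w ∈ Y, ∃ A ∈ M, w ∈ A := by
    intro w hw
    obtain ⟨A, hA, hwA⟩ := hcov w hw
    obtain ⟨B, hAB, hB⟩ := (Set.toFinite {A | F A}).exists_le_maximal hA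
    exact ⟨B, (hM B).2 hB, hAB hwA⟩
  have hYM : Yᶜ ∉ M := by
    intro h
    obtain ⟨v, hv⟩ := compl_nonempty_of_ne_univ hYu
    exact mem_compl.1 hv (hsub _ ((hM _).1 h).prop hv)
  have hMne : 1 ≤ M.card := by
    obtain ⟨w, hw⟩ := hY
    obtain ⟨A, hA, -⟩ := hcovM w hw
    exact card_pos.2 ⟨A, hA⟩
  have hc : (insert Yᶜ M).card = M.card + 1 := card_insert_of_notMem hYM
  have key := hf.card_mul_le_sum (insert Yᶜ M) ?_ ?_ ?_ (by omega)
  · rw [sum_insert hYM, hYf, hc] at key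
    have := sum_le_card_nsmul M f (k + 1) fun A hA => hval A ((hM A).1 hA).prop
    rw [smul_eq_mul] at this
    nlinarith
  · intro A hA
    rcases mem_insert.1 hA with rfl | hA
    · exact compl_nonempty_of_ne_univ hYu
    · exact hne A ((hM A).1 hA).prop
  · have hdY : ∀ A ∈ M, Disjoint Yᶜ A := fun A hA =>
      disjoint_left.2 fun v hv hvA => mem_compl.1 hv (hsub A ((hM A).1 hA).prop hvA)
    intro A hA B hB hAB
    rw [mem_coe, mem_insert] at hA hB
    rcases hA with rfl | hA <;> rcases hB with rfl | hB
    · exact absurd rfl hAB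
    · exact hdY B hB
    · exact (hdY A hA).symm
    · by_contra hnd
      have hi : (A ∩ B).Nonempty := not_disjoint_iff_nonempty_inter.1 hnd
      have hA := (hM A).1 hA
      have hB := (hM B).1 hB
      have hU := hun A B hA.prop hB.prop hi
      exact hAB ((hA.eq_of_le hU subset_union_left).trans
        (hB.eq_of_le hU subset_union_right).symm)
  · refine eq_univ_iff_forall.2 fun v => ?_
    rw [mem_sup]
    by_cases hv : v ∈ Y
    · obtain ⟨A, hA, hvA⟩ := hcovM v hv
      exact ⟨A, mem_insert_of_mem hA, hvA⟩
    · exact ⟨Yᶜ, mem_insert_self _ _, mem_compl.2 hv⟩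

/-- The bound for the partition into `X` and its complement. -/
theorem two_mul_le_add_compl {X : Finset V} (h1 : X.Nonempty) (h2 : X ≠ univ) :
    2 * (k + 1) ≤ f X + f Xᶜ := by
  have hne : X ≠ Xᶜ := by
    intro h
    obtain ⟨v, hv⟩ := h1
    have hv' := hv
    rw [h, mem_compl] at hv'
    exact hv' hv
  have := hf.card_mul_le_sum {X, Xᶜ} ?_ ?_ ?_ (card_pair hne).ge
  · rw [card_pair hne, sum_pair hne] at this; omega
  · intro A hA
    rcases mem_insert.1 hA with rfl | hA
    · exact h1
    · rw [mem_singleton.1 hA]; exact compl_nonempty_of_ne_univ h2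
  · rw [coe_pair]
    exact (Set.pairwiseDisjoint_insert_of_notMem (by simpa using hne)).2
      ⟨Set.pairwiseDisjoint_singleton _ _, by simpa using disjoint_compl_right⟩
  · simp

theorem add_two_le_of_inTight {X : Finset V} (h : InTight f k X) : k + 2 ≤ f Xᶜ := by
  have := hf.two_mul_le_add_compl h.1 h.2.1
  have := h.2.2
  omega

theorem add_two_le_of_outTight {X : Finset V} (h : OutTight f k X) : k + 2 ≤ f X := by
  simpa using hf.add_two_le_of_inTight h

theorem not_outTight_of_inTight {X : Finset V} (h : InTight f k X) : ¬ OutTight f k X := by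
  intro h'
  have := hf.add_two_le_of_inTight h
  have := h'.2.2
  omega

theorem inTight_inter_union {A B : Finset V} (hA : InTight f k A) (hB : InTight f k B)
    (hi : (A ∩ B).Nonempty) (hu : A ∪ B ≠ univ) :
    InTight f k (A ∩ B) ∧ InTight f k (A ∪ B) := by
  have hi' : A ∩ B ≠ univ := fun h => hA.2.1 (univ_subset_iff.1 (h ▸ inter_subset_left))
  have hu' : (A ∪ B).Nonempty := hA.1.mono subset_union_left
  have h1 := hf.le _ hi hi'
  have h2 := hf.le _ hu' hu
  have h3 := hf.submod A B
  rw [hA.2.2, hB.2.2] at h3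
  exact ⟨⟨hi, hi', by omega⟩, ⟨hu', hu, by omega⟩⟩

theorem outTight_inter_union {A B : Finset V} (hA : OutTight f k A) (hB : OutTight f k B)
    (hi : (A ∩ B).Nonempty) (hu : A ∪ B ≠ univ) :
    OutTight f k (A ∩ B) ∧ OutTight f k (A ∪ B) := by
  have := hf.dual.inTight_inter_union (inTight_dual.2 hA) (inTight_dual.2 hB) hi hu
  exact ⟨inTight_dual.1 this.1, inTight_dual.1 this.2⟩

/-- A minimal out-tight set is not crossed by an in-tight set. -/
theorem subset_or_subset_of_inTight {Y T : Finset V} (hY : Minimal (OutTight f k) Y)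
    (hT : InTight f k T) (hi : (T ∩ Y).Nonempty) : T ⊆ Y ∨ Y ⊆ T := by
  by_contra! h
  have h1 : (T \ Y).Nonempty := sdiff_nonempty.2 h.1
  have h2 : (Y \ T).Nonempty := sdiff_nonempty.2 h.2
  have h3 : T \ Y ≠ univ := fun h => hT.2.1 (univ_subset_iff.1 (h ▸ sdiff_subset))
  have h4 : Y \ T ≠ univ := fun h => hY.prop.ne_univ (univ_subset_iff.1 (h ▸ sdiff_subset))
  have h5 := hf.le _ h1 h3
  have h6 := hf.le _ (compl_nonempty_of_ne_univ h4) (compl_ne_univ_of_nonempty h2)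
  have h7 := hf.submod_sdiff T Y
  rw [hT.2.2, hY.prop.2.2] at h7
  have h8 : OutTight f k (Y \ T) := outTight_iff.2 ⟨h2, h4, by omega⟩
  obtain ⟨v, hv⟩ := hi
  rw [mem_inter] at hv
  exact (mem_sdiff.1 (hY.le_of_le h8 sdiff_subset hv.2)).2 hv.1

end IsAdmissible

/-- A vertex `w` of `Y` that may lose a head: every in-tight set that contains `w` contains
`Y`, and a proper subset of `Y` that would become in-tight contains a tight set anyway. -/
structure IsSafeSink (f : Finset V → ℕ) (k : ℕ) (Y : Finset V) (w : V) : Prop where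
  mem : w ∈ Y
  subset : ∀ T, InTight f k T → w ∈ T → Y ⊆ T
  exists_tight : ∀ M, M ⊂ Y → w ∈ M → f M = k + 1 → ∃ S ⊆ M, Tight f k S

/-- A vertex of `Y` that is not a safe sink lies in an in-tight subset of `Y`, or in a subset of
value `k + 1` without tight subsets. If all vertices are of this kind, then these sets form a
union-closed cover of `Y`, which is impossible. -/
theorem IsAdmissible.exists_isSafeSink (hf : IsAdmissible f k) {Y : Finset V}
    (hY : Minimal (OutTight f k) Y) : ∃ w, IsSafeSink f k Y w := by
  by_contra! hno
  have hYf := hf.add_two_le_of_outTight hY.prop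
  have hYu := hY.prop.ne_univ
  -- the in-tight subsets of `Y`, and the subsets of value `k + 1` without tight subsets
  let F : Finset V → Prop := fun A => A.Nonempty ∧ A ⊆ Y ∧ (InTight f k A ∨
    (f A = k + 1 ∧ ∀ S ⊆ A, ¬ Tight f k S))
  have hFval : ∀ A, F A → f A ≤ k + 1 := by
    rintro A ⟨-, -, h | h⟩
    · have := h.2.2; omega
    · omega
  have hFu : ∀ A B, F A → F B → A ∪ B ≠ univ := fun A B hA hB h =>
    hYu (univ_subset_iff.1 (h ▸ union_subset hA.2.1 hB.2.1))
  -- a set of value `k + 1` that meets an in-tight set is absorbed by it, since the intersection is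
  -- not tight
  have mixed : ∀ A B, F A → F B → (A ∩ B).Nonempty → InTight f k A → InTight f k (A ∪ B) := by
    intro A B hA hB hi hAt
    rcases hB.2.2 with hB' | ⟨hB', hBp⟩
    · exact (hf.inTight_inter_union hAt hB' hi (hFu A B hA hB)).2
    · have hi' : A ∩ B ≠ univ := fun h => hAt.2.1 (univ_subset_iff.1 (h ▸ inter_subset_left))
      have hu : (A ∪ B).Nonempty := hA.1.mono subset_union_left
      have h1 := hf.le _ hi hi'
      have h2 := hf.le _ hu (hFu A B hA hB)
      have h3 : f (A ∩ B) ≠ k := fun h => hBp _ inter_subset_right (Or.inl ⟨hi, hi', h⟩)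
      have h4 := hf.submod A B
      rw [hAt.2.2, hB'] at h4
      exact ⟨hu, hFu A B hA hB, by omega⟩
  refine hf.not_cover hY.prop.nonempty hYu hY.prop.2.2 F (fun A h => h.1) (fun A h => h.2.1)
    hFval ?_ ?_
  · intro A B hA hB hi
    have hu : (A ∪ B).Nonempty := hA.1.mono subset_union_left
    have hsub : A ∪ B ⊆ Y := union_subset hA.2.1 hB.2.1
    refine ⟨hu, hsub, ?_⟩
    by_cases hAt : InTight f k A
    · exact Or.inl (mixed A B hA hB hi hAt)
    by_cases hBt : InTight f k B
    · rw [union_comm]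
      exact Or.inl (mixed B A hB hA (by rwa [inter_comm]) hBt)
    obtain ⟨hA1, hA2⟩ := hA.2.2.resolve_left hAt
    obtain ⟨hB1, hB2⟩ := hB.2.2.resolve_left hBt
    by_cases hT : ∃ T ⊆ A ∪ B, InTight f k T
    · -- an in-tight subset of the union absorbs the two sets one after the other
      left
      obtain ⟨T, hTs, hT⟩ := hT
      have hFT : F T := ⟨hT.1, hTs.trans hsub, Or.inl hT⟩
      have absorb : ∀ C D, F C → F D → (C ∩ D).Nonempty → T ⊆ C ∪ D → (T ∩ C).Nonempty →
          InTight f k (C ∪ D) := by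
        intro C D hC hD hCD hTCD hTC
        have h1 := mixed T C hFT hC hTC hT
        have h2 := mixed (T ∪ C) D ⟨h1.1, union_subset hFT.2.1 hC.2.1, Or.inl h1⟩ hD
          (hCD.mono (inter_subset_inter_right subset_union_right)) h1
        rwa [union_assoc, union_eq_right.2 hTCD] at h2
      obtain ⟨v, hv⟩ := hT.1
      rcases mem_union.1 (hTs hv) with hvA | hvB
      · exact absorb A B hA hB hi hTs ⟨v, mem_inter.2 ⟨hv, hvA⟩⟩
      · rw [union_comm]
        exact absorb B A hB hA (by rwa [inter_comm]) (by rwa [union_comm])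
          ⟨v, mem_inter.2 ⟨hv, hvB⟩⟩
    · right
      -- by minimality an out-tight subset would be `Y`, but `f Y` is at least `k + 2`
      have hout : ∀ S ⊆ A ∪ B, ¬ OutTight f k S := by
        intro S hS hSo
        have hSY := hY.eq_of_le hSo (hS.trans hsub)
        have hAB : A ∪ B = Y := subset_antisymm hsub (hSY ▸ hS)
        have h1 := hf.le (A ∩ B) hi
          (fun h => hFu A B hA hB (univ_subset_iff.1 (h ▸ inter_subset_union)))
        have h2 : f (A ∩ B) ≠ k := fun h => hA2 _ inter_subset_left (Or.inl ⟨hi,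
          (fun h => hFu A B hA hB (univ_subset_iff.1 (h ▸ inter_subset_union))), h⟩)
        have h3 := hf.submod A B
        rw [hAB] at h3
        omega
      have hi' : A ∩ B ≠ univ :=
        fun h => hFu A B hA hB (univ_subset_iff.1 (h ▸ inter_subset_union))
      have h1 := hf.le (A ∩ B) hi hi'
      have h2 : f (A ∩ B) ≠ k := fun h => hA2 _ inter_subset_left (Or.inl ⟨hi, hi', h⟩)
      have h3 := hf.submod A B
      have h4 := hf.le _ hu (hFu A B hA hB)
      have h5 : f (A ∪ B) ≠ k := fun h => hT ⟨_, subset_rfl, hu, hFu A B hA hB, h⟩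
      refine ⟨by omega, fun S hS hSt => hSt.elim (fun h => hT ⟨S, hS, h⟩) (hout S hS)⟩
  · intro w hw
    by_contra! hcon
    refine hno w ⟨hw, ?_, ?_⟩
    · intro T hT hwT
      rcases hf.subset_or_subset_of_inTight hY hT ⟨w, mem_inter.2 ⟨hwT, hw⟩⟩ with h | h
      · exact absurd hwT (hcon T ⟨hT.1, h, Or.inl hT⟩)
      · exact h
    · intro M hMY hwM hM
      by_contra! hS
      exact hcon M ⟨⟨w, hwM⟩, hMY.1, Or.inr ⟨hM, hS⟩⟩ hwM

end CutFunction

/-! ### Paths from a source to a sink -/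

namespace CutFunction

variable {V : Type*} [Fintype V] [DecidableEq V] {f : Finset V → ℕ} {k : ℕ}

/-- Every in-tight set that contains `w` contains `v`, so that a head may be moved from `w` to `v`
without losing `k`-connectivity. -/
def Accompanies (f : Finset V → ℕ) (k : ℕ) (w v : V) : Prop :=
  ∀ T, InTight f k T → w ∈ T → v ∈ T

/-- What connects a digraph with `f`: if no arc leads from `A` to `D \ A`, then whatever leaves `A`
leaves `D`, and whatever enters `D \ A` enters `D`. -/
def ArcCompatible (adj : V → V → Prop) (f : Finset V → ℕ) : Prop :=
  ∀ A D : Finset V, A ⊆ D → (∀ a ∈ A, ∀ b ∈ D \ A, ¬ adj a b) →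
    f Aᶜ ≤ f Dᶜ ∧ f (D \ A) ≤ f D

/-- Reachability along arcs whose ends satisfy `p`. -/
abbrev Reach (adj : V → V → Prop) (p : V → Prop) : V → V → Prop :=
  Relation.ReflTransGen fun a b => adj a b ∧ p b

variable {adj : V → V → Prop}

theorem Reach.mono {p q : V → Prop} (h : ∀ v, p v → q v) {a b : V} (hab : Reach adj p a b) :
    Reach adj q a b :=
  Relation.ReflTransGen.mono (fun _ _ h' => ⟨h'.1, h _ h'.2⟩) _ _ hab

/-- The set of vertices that are reached from `c` inside `B`. -/
theorem exists_reach_set (adj : V → V → Prop) {B : Finset V} {c : V} (hc : c ∈ B) :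
    ∃ A ⊆ B, c ∈ A ∧ (∀ a ∈ A, Reach adj (· ∈ B) c a) ∧
      ∀ a ∈ A, ∀ b ∈ B, adj a b → b ∈ A := by
  classical
  refine ⟨B.filter fun a => Reach adj (· ∈ B) c a, filter_subset _ _,
    mem_filter.2 ⟨hc, .refl⟩, fun a ha => (mem_filter.1 ha).2, fun a ha b hb hab =>
    mem_filter.2 ⟨hb, (mem_filter.1 ha).2.tail ⟨hab, hb⟩⟩⟩

theorem exists_minimal_subset {P : Finset V → Prop} {S : Finset V} (hS : P S) :
    ∃ M ⊆ S, Minimal P M := by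
  obtain ⟨M, h1, h2⟩ := (Set.toFinite {A | P A}).exists_le_minimal hS
  exact ⟨M, h1, h2⟩

/-- From every vertex `c` of an out-tight set without in-tight subsets there is a path to a safe
sink `w` all of whose vertices accompany `w`. The path runs through the intersection of the
out-tight sets around `c` until it reaches a vertex that lies in a smaller out-tight set. -/
theorem IsAdmissible.exists_reach_safeSink (hf : IsAdmissible f k) (hadj : ArcCompatible adj f)
    (C : Finset V) (hC : OutTight f k C) (hpure : ∀ S ⊆ C, ¬ InTight f k S) (c : V)
    (hc : c ∈ C) : ∃ Y w, Y ⊆ C ∧ Minimal (OutTight f k) Y ∧ IsSafeSink f k Y w ∧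
      Accompanies f k w c ∧ Reach adj (Accompanies f k w) c w := by
  classical
  induction hn : C.card using Nat.strong_induction_on generalizing C c with
  | _ n ih =>
  -- a vertex of a smaller out-tight set is covered by the induction hypothesis
  have shrink : ∀ b ∈ C, (∃ S, OutTight f k S ∧ b ∈ S ∧ ¬ C ⊆ S) →
      ∃ Y w, Y ⊆ C ∧ Minimal (OutTight f k) Y ∧ IsSafeSink f k Y w ∧
      Accompanies f k w b ∧ Reach adj (Accompanies f k w) b w := by
    rintro b hb ⟨S, hS, hbS, hCS⟩
    have hi : (S ∩ C).Nonempty := ⟨b, mem_inter.2 ⟨hbS, hb⟩⟩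
    have hu : S ∪ C ≠ univ := fun h => hpure Sᶜ
      (fun v hv => (mem_union.1 (h ▸ mem_univ v)).resolve_left (mem_compl.1 hv)) hS
    have hlt : (S ∩ C).card < n := hn ▸ card_lt_card
      ⟨inter_subset_right, fun h => hCS (h.trans inter_subset_left)⟩
    obtain ⟨Y, w, hY, h⟩ := ih _ hlt (S ∩ C) (hf.outTight_inter_union hS hC hi hu).1
      (fun R hR => hpure R (hR.trans inter_subset_right)) b (mem_inter.2 ⟨hbS, hb⟩) rfl
    exact ⟨Y, w, hY.trans inter_subset_right, h⟩
  by_cases htop : ∃ S, OutTight f k S ∧ c ∈ S ∧ ¬ C ⊆ S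
  · exact shrink c hc htop
  have hcB : c ∈ C.filter fun v => ∀ S, OutTight f k S → v ∈ S → C ⊆ S := by
    push Not at htop
    exact mem_filter.2 ⟨hc, htop⟩
  obtain ⟨A, hAB, hcA, hreach, hclosed⟩ := exists_reach_set adj hcB
  -- an in-tight set that separates `w` from `v` has a complement that contains all of `C`
  have hacc : ∀ Y w, Y ⊆ C → IsSafeSink f k Y w →
      ∀ v ∈ C.filter (fun v => ∀ S, OutTight f k S → v ∈ S → C ⊆ S), Accompanies f k w v := by
    intro Y w hY hw v hv T hT hwT
    by_contra hvT
    have := (mem_filter.1 hv).2 Tᶜ (outTight_compl.2 hT) (mem_compl.2 hvT) (hY hw.mem)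
    exact mem_compl.1 this hwT
  by_cases hex : ∃ a ∈ A, ∃ b ∈ C \ A, adj a b
  · obtain ⟨a, ha, b, hb, hab⟩ := hex
    rw [mem_sdiff] at hb
    have hbB : ∃ S, OutTight f k S ∧ b ∈ S ∧ ¬ C ⊆ S := by
      by_contra! h
      exact hb.2 (hclosed a ha b (mem_filter.2 ⟨hb.1, h⟩) hab)
    obtain ⟨Y, w, hY, hYm, hw, h1, h2⟩ := shrink b hb.1 hbB
    exact ⟨Y, w, hY, hYm, hw, hacc Y w hY hw c hcB,
      (((hreach a ha).mono (hacc Y w hY hw)).tail ⟨hab, h1⟩).trans h2⟩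
  · -- without an arc out of `A` the set `A` is out-tight itself, hence equal to `C`
    push Not at hex
    have hAC : A ⊆ C := hAB.trans (filter_subset _ _)
    have h1 := (hadj A C hAC hex).1
    have hA : A.Nonempty := ⟨c, hcA⟩
    have hAu : A ≠ univ := fun h => hC.ne_univ (univ_subset_iff.1 (h ▸ hAC))
    have h2 := hf.le _ (compl_nonempty_of_ne_univ hAu) (compl_ne_univ_of_nonempty hA)
    rw [hC.2.2] at h1
    have hAo : OutTight f k A := outTight_iff.2 ⟨hA, hAu, by omega⟩
    have hCA : C ⊆ A := (mem_filter.1 hcB).2 A hAo hcA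
    obtain ⟨Y, hY, hYm⟩ := exists_minimal_subset hC
    obtain ⟨w, hw⟩ := hf.exists_isSafeSink hYm
    exact ⟨Y, w, hY, hYm, hw, hacc Y w hY hw c hcB,
      (hreach w (hCA (hY hw.mem))).mono (hacc Y w hY hw)⟩

/-- If there is a tight set, then there are a safe source `x` and a safe sink `w` with a path from
`x` to `w` all of whose vertices accompany `w`. They are found inside a minimal set `Z`, among the
tight sets and the whole vertex set, that contains both an in-tight and an out-tight set. -/
theorem IsAdmissible.exists_source_sink (hf : IsAdmissible f k) (hadj : ArcCompatible adj f)
    (hT : ∃ T, InTight f k T) :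
    ∃ X Y x w, Minimal (InTight f k) X ∧ Minimal (OutTight f k) Y ∧
      IsSafeSink (CutFunction.dual f) k X x ∧ IsSafeSink f k Y w ∧
      ((∃ S ⊆ X, OutTight f k S) → Y ⊆ X) ∧
      Accompanies f k w x ∧ Reach adj (Accompanies f k w) x w := by
  classical
  let G : Finset V → Prop := fun Z => (Tight f k Z ∨ Z = univ) ∧
    (∃ S ⊆ Z, InTight f k S) ∧ ∃ S ⊆ Z, OutTight f k S
  have hG : G univ := by
    obtain ⟨T, hT⟩ := hT
    exact ⟨Or.inr rfl, ⟨T, subset_univ _, hT⟩, Tᶜ, subset_univ _, outTight_compl.2 hT⟩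
  obtain ⟨Z, -, hZ⟩ := exists_minimal_subset hG
  obtain ⟨hZt, ⟨S, hSZ, hS⟩, R, hRZ, hR⟩ := hZ.prop
  obtain ⟨X, hXS, hX⟩ := exists_minimal_subset (P := InTight f k) hS
  have hXZ := hXS.trans hSZ
  have hXd : Minimal (OutTight (CutFunction.dual f) k) X := by
    have : OutTight (CutFunction.dual f) k = InTight f k := by ext; exact outTight_dual
    rwa [this]
  obtain ⟨x, hx⟩ := hf.dual.exists_isSafeSink hXd
  have hxX : ∀ T, OutTight f k T → x ∈ T → X ⊆ T := fun T hT => hx.subset T (inTight_dual.2 hT)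
  have hxZ : x ∈ Z := hXZ hx.mem
  -- minimality of `Z`, for in-tight sets and for out-tight sets around `x`
  have hZin : ∀ T ⊆ Z, InTight f k T → (∃ S ⊆ T, OutTight f k S) → Z ⊆ T := fun T hTZ hT h =>
    hZ.le_of_le ⟨Or.inl (Or.inl hT), ⟨T, subset_rfl, hT⟩, h⟩ hTZ
  have hZout : ∀ T ⊆ Z, OutTight f k T → x ∈ T → Z ⊆ T := fun T hTZ hT h =>
    hZ.le_of_le ⟨Or.inl (Or.inr hT), ⟨X, hxX T hT h, hX.prop⟩, T, subset_rfl, hT⟩ hTZ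
  have hXY : ∀ Y ⊆ Z, (∃ S ⊆ X, OutTight f k S) → Y ⊆ X := fun Y hY h =>
    hY.trans (hZin X hXZ hX.prop h)
  -- the vertices that no out-tight subset of `Z` separates from `x`
  let B : Finset V := Z.filter fun v => ∀ S, OutTight f k S → S ⊆ Z → v ∈ S → x ∈ S
  have hxB : x ∈ B := mem_filter.2 ⟨hxZ, fun S _ _ h => h⟩
  -- uncrossing with `Z` turns an in-tight set that separates `w` from `v` into a subset of `Z`
  have hacc : ∀ Y w, Y ⊆ Z → Minimal (OutTight f k) Y → IsSafeSink f k Y w → ∀ v ∈ B,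
      Accompanies f k w v := by
    intro Y w hYZ hY hw v hv T hT hwT
    by_contra hvT
    obtain ⟨hvZ, hvB⟩ := mem_filter.1 hv
    have hYT := hw.subset T hT hwT
    have hwZ := hYZ hw.mem
    have hTc : OutTight f k Tᶜ := outTight_compl.2 hT
    have hTZ : ¬ T ⊆ Z := fun h => hvT (hZin T h hT ⟨Y, hYT, hY.prop⟩ hvZ)
    rcases hZt with (hZi | hZo) | rfl
    · by_cases hu : T ∪ Z = univ
      · have hs : Tᶜ ⊆ Z := fun v hv =>
          (mem_union.1 (hu ▸ mem_univ v)).resolve_left (mem_compl.1 hv)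
        exact mem_compl.1 (hZout Tᶜ hs hTc (hvB Tᶜ hTc hs (mem_compl.2 hvT)) hwZ) hwT
      · have hi := (hf.inTight_inter_union hT hZi ⟨w, mem_inter.2 ⟨hwT, hwZ⟩⟩ hu).1
        exact hvT (mem_inter.1 (hZin _ inter_subset_right hi
          ⟨Y, subset_inter hYT hYZ, hY.prop⟩ hvZ)).1
    · by_cases hu : Tᶜ ∪ Z = univ
      · exact hTZ fun v hv => (mem_union.1 (hu ▸ mem_univ v)).resolve_left
          fun h => mem_compl.1 h hv
      · have hvi : v ∈ Tᶜ ∩ Z := mem_inter.2 ⟨mem_compl.2 hvT, hvZ⟩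
        have hi := (hf.outTight_inter_union hTc hZo ⟨v, hvi⟩ hu).1
        have := hZout _ inter_subset_right hi (hvB _ hi inter_subset_right hvi) hwZ
        exact mem_compl.1 (mem_inter.1 this).1 hwT
    · exact hTZ (subset_univ _)
  obtain ⟨A, hAB, hxA, hreach, hclosed⟩ := exists_reach_set adj hxB
  by_cases hex : ∃ a ∈ A, ∃ b ∈ Z \ A, adj a b
  · -- the path leaves `B` and enters an out-tight set without in-tight subsets
    obtain ⟨a, ha, b, hb, hab⟩ := hex
    rw [mem_sdiff] at hb
    have hbB : ∃ S, OutTight f k S ∧ S ⊆ Z ∧ b ∈ S ∧ x ∉ S := by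
      by_contra! h
      exact hb.2 (hclosed a ha b (mem_filter.2 ⟨hb.1, h⟩) hab)
    obtain ⟨S, hS, hSZ, hbS, hxS⟩ := hbB
    have hpure : ∀ R ⊆ S, ¬ InTight f k R := fun R hR hRi => hxS
      (hZ.le_of_le ⟨Or.inl (Or.inr hS), ⟨R, hR, hRi⟩, S, subset_rfl, hS⟩ hSZ hxZ)
    obtain ⟨Y, w, hYS, hY, hw, h1, h2⟩ := hf.exists_reach_safeSink hadj S hS hpure b hbS
    have hacc := hacc Y w (hYS.trans hSZ) hY hw
    exact ⟨X, Y, x, w, hX, hY, hx, hw, hXY Y (hYS.trans hSZ), hacc x hxB,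
      (((hreach a ha).mono hacc).tail ⟨hab, h1⟩).trans h2⟩
  · -- without an arc out of `A` every safe sink in `Z` belongs to `A`
    push Not at hex
    have hAZ : A ⊆ Z := hAB.trans (filter_subset _ _)
    obtain ⟨h1, h2⟩ := hadj A Z hAZ hex
    obtain ⟨Y, hYR, hY⟩ := exists_minimal_subset (P := OutTight f k) hR
    have hYZ := hYR.trans hRZ
    obtain ⟨w, hw⟩ := hf.exists_isSafeSink hY
    have hwZ := hYZ hw.mem
    have hwA : w ∈ A := by
      by_contra hwA
      have hcase : f Z ≤ k ∨ OutTight f k Z := by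
        rcases hZt with (h | h) | rfl
        · exact Or.inl h.2.2.le
        · exact Or.inr h
        · exact Or.inl (by rw [hf.map_univ]; omega)
      rcases hcase with h | h
      · have hne : (Z \ A).Nonempty := ⟨w, mem_sdiff.2 ⟨hwZ, hwA⟩⟩
        have hnu : Z \ A ≠ univ := fun h => (mem_sdiff.1 (h ▸ mem_univ x)).2 hxA
        have h3 := hf.le _ hne hnu
        have hi : InTight f k (Z \ A) := ⟨hne, hnu, by omega⟩
        have h4 := hw.subset _ hi (mem_sdiff.2 ⟨hwZ, hwA⟩)
        exact (mem_sdiff.1 (hZin _ sdiff_subset hi ⟨Y, h4, hY.prop⟩ hxZ)).2 hxA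
      · have hAu : A ≠ univ := fun h => hwA (h ▸ mem_univ w)
        have hA : A.Nonempty := ⟨x, hxA⟩
        have h3 := hf.le _ (compl_nonempty_of_ne_univ hAu) (compl_ne_univ_of_nonempty hA)
        rw [h.2.2] at h1
        have hAo : OutTight f k A := outTight_iff.2 ⟨hA, hAu, by omega⟩
        exact hwA (hZout A hAZ hAo hxA hwZ)
    have hacc := hacc Y w hYZ hY hw
    exact ⟨X, Y, x, w, hX, hY, hx, hw, hXY Y hYZ, hacc x hxB, (hreach w hwA).mono hacc⟩

/-! ### Transfers and the potential -/

/-- `g` arises from `f` by moving one head from `w` to `v`. -/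
def IsTransfer (f g : Finset V → ℕ) (w v : V) : Prop :=
  ∀ T, g T + (if w ∈ T then 1 else 0) = f T + (if v ∈ T then 1 else 0)

theorem IsTransfer.dual {g : Finset V → ℕ} {w v : V} (h : IsTransfer f g w v) :
    IsTransfer (CutFunction.dual f) (CutFunction.dual g) v w := by
  intro T
  have := h Tᶜ
  unfold CutFunction.dual
  simp only [mem_compl] at this
  split_ifs at * <;> omega

/-- A transfer to a vertex that accompanies `w` keeps the lower bound `k`. -/
theorem IsTransfer.le {g : Finset V → ℕ} {w v : V} (h : IsTransfer f g w v)
    (hf : ∀ X : Finset V, X.Nonempty → X ≠ univ → k ≤ f X) (hv : Accompanies f k w v)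
    (X : Finset V) (h1 : X.Nonempty) (h2 : X ≠ univ) : k ≤ g X := by
  have h3 := h X
  have h4 := hf X h1 h2
  by_contra hlt
  split_ifs at h3 with hw hv' hv'
  · omega
  · exact hv' (hv X ⟨h1, h2, by omega⟩ hw)
  · omega
  · omega

/-- A transfer away from a safe sink creates no in-tight set without an old tight subset. -/
theorem IsAdmissible.exists_tight_of_inTight (hf : IsAdmissible f k) {g : Finset V → ℕ} {w x : V}
    (hg : IsTransfer f g w x) {Y : Finset V} (hY : Minimal (OutTight f k) Y)
    (hw : IsSafeSink f k Y w) {M : Finset V} (hM : InTight g k M) :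
    ∃ S ⊆ M, Tight f k S := by
  by_cases hMf : f M = k
  · exact ⟨M, subset_rfl, Or.inl ⟨hM.1, hM.2.1, hMf⟩⟩
  have h1 := hf.le M hM.1 hM.2.1
  have h2 := hg M
  rw [hM.2.2] at h2
  have hwM : w ∈ M := by by_contra h; simp only [h] at h2; split_ifs at h2 <;> omega
  have hMf' : f M = k + 1 := by split_ifs at h2 <;> omega
  by_cases hYM : Y ⊆ M
  · exact ⟨Y, hYM, Or.inr hY.prop⟩
  by_cases hMY : M ⊆ Y
  · exact hw.exists_tight M ⟨hMY, hYM⟩ hwM hMf'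
  have h3 := hf.submod_sdiff M Y
  have h4 : (M \ Y).Nonempty := sdiff_nonempty.2 hMY
  have h5 : (Y \ M).Nonempty := sdiff_nonempty.2 hYM
  have h6 : M \ Y ≠ univ := fun h => hM.2.1 (univ_subset_iff.1 (h ▸ sdiff_subset))
  have h7 : Y \ M ≠ univ := fun h => hY.prop.ne_univ (univ_subset_iff.1 (h ▸ sdiff_subset))
  have h8 := hf.le _ h4 h6
  have h9 := hf.le _ (compl_nonempty_of_ne_univ h7) (compl_ne_univ_of_nonempty h5)
  have h10 : f (Y \ M)ᶜ ≠ k := by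
    intro h
    have := hY.le_of_le (outTight_iff.2 ⟨h5, h7, h⟩) sdiff_subset hw.mem
    exact (mem_sdiff.1 this).2 hwM
  rw [hY.prop.2.2] at h3
  exact ⟨M \ Y, sdiff_subset, Or.inl ⟨h4, h6, by omega⟩⟩

/-- Moving a head from the safe sink `w` to the safe source `x` destroys a minimal tight set, and
each new tight set contains an old one. -/
theorem IsAdmissible.tight_of_transfer (hf : IsAdmissible f k) {g : Finset V → ℕ} {w x : V}
    (hg : IsTransfer f g w x) {X Y : Finset V} (hX : Minimal (InTight f k) X)
    (hY : Minimal (OutTight f k) Y) (hx : IsSafeSink (CutFunction.dual f) k X x)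
    (hw : IsSafeSink f k Y w)
    (hXY : (∃ S ⊆ X, OutTight f k S) → Y ⊆ X) :
    (∀ M, Tight g k M → ∃ S ⊆ M, Tight f k S) ∧
      ∃ D, Minimal (Tight f k) D ∧ ¬ Tight g k D := by
  constructor
  · rintro M (hM | hM)
    · exact hf.exists_tight_of_inTight hg hY hw hM
    · have hXd : Minimal (OutTight (CutFunction.dual f) k) X := by
        have : OutTight (CutFunction.dual f) k = InTight f k := by ext; exact outTight_dual
        rwa [this]
      obtain ⟨S, hS, hS'⟩ := hf.dual.exists_tight_of_inTight hg.dual hXd hx (inTight_dual.2 hM)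
      exact ⟨S, hS, tight_dual.1 hS'⟩
  · -- if `w` lies in `X`, then `Y` is a minimal tight set inside `X`, otherwise `X` is one
    have hwX : w ∈ X → Y ⊆ X := hw.subset X hX.prop
    have hxY : x ∈ Y → X ⊆ Y := hx.subset Y (inTight_dual.2 hY.prop)
    by_cases hwX' : w ∈ X
    · have hYX := hwX hwX'
      have hYneX : Y ≠ X := fun h => hf.not_outTight_of_inTight hX.prop (h ▸ hY.prop)
      have hxY' : x ∉ Y := fun h => hYneX (subset_antisymm hYX (hxY h))
      refine ⟨Y, ⟨Or.inr hY.prop, ?_⟩, ?_⟩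
      · rintro S (hS | hS) hSY
        · exact (hYneX (subset_antisymm hYX ((hX.le_of_le hS (hSY.trans hYX)).trans hSY))).elim
        · exact hY.le_of_le hS hSY
      · have h1 := hg Y
        have h2 := hg Yᶜ
        have h3 := hf.add_two_le_of_outTight hY.prop
        have h4 := hY.prop.2.2
        simp only [mem_compl, hxY', hw.mem, if_true, if_false, not_true_eq_false,
          not_false_eq_true] at h1 h2
        rintro (h | h) <;> have := h.2.2 <;> omega
    · refine ⟨X, ⟨Or.inl hX.prop, ?_⟩, ?_⟩
      · rintro S (hS | hS) hSX
        · exact hX.le_of_le hS hSX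
        · exact absurd (hXY ⟨S, hSX, hS⟩ hw.mem) hwX'
      · have h1 := hg X
        have h2 := hg Xᶜ
        have h3 := hf.add_two_le_of_inTight hX.prop
        have h4 := hX.prop.2.2
        have hxX : x ∈ X := hx.mem
        simp only [mem_compl, hxX, hwX', if_true, if_false, not_true_eq_false,
          not_false_eq_true] at h1 h2
        rintro (h | h) <;> have := h.2.2 <;> omega

/-- Distinct minimal tight sets are disjoint. -/
theorem IsAdmissible.eq_of_minimal_tight (hf : IsAdmissible f k) {M N : Finset V}
    (hM : Minimal (Tight f k) M) (hN : Minimal (Tight f k) N) (hi : (M ∩ N).Nonempty) :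
    M = N := by
  have mixed : ∀ {M N : Finset V}, Minimal (Tight f k) M → Minimal (Tight f k) N →
      (M ∩ N).Nonempty → InTight f k M → OutTight f k N → M = N := by
    intro M N hM hN hi h1 h2
    have hN' : Minimal (OutTight f k) N := ⟨h2, fun S hS => hN.le_of_le (Or.inr hS)⟩
    rcases hf.subset_or_subset_of_inTight hN' h1 hi with h | h
    · exact hN.eq_of_le hM.prop h
    · exact (hM.eq_of_le hN.prop h).symm
  have same : ∀ {f : Finset V → ℕ} {M N : Finset V}, IsAdmissible f k →
      Minimal (Tight f k) M → Minimal (Tight f k) N → (M ∩ N).Nonempty → InTight f k M →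
      InTight f k N → M = N := by
    intro f M N hf hM hN hi h1 h2
    by_cases hu : M ∪ N = univ
    · have hs : Nᶜ ⊆ M := fun v hv =>
        (mem_union.1 (hu ▸ mem_univ v)).resolve_right (mem_compl.1 hv)
      have := hM.eq_of_le (Or.inr (outTight_compl.2 h2)) hs
      obtain ⟨v, hv⟩ := hi
      rw [mem_inter, ← this, mem_compl] at hv
      exact absurd hv.2 hv.1
    · have h3 : Tight f k (M ∩ N) := Or.inl (hf.inTight_inter_union h1 h2 hi hu).1
      exact (hM.eq_of_le h3 inter_subset_left).symm.trans (hN.eq_of_le h3 inter_subset_right)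
  have hd : Tight (CutFunction.dual f) k = Tight f k := by ext; exact tight_dual
  rcases hM.prop with h1 | h1 <;> rcases hN.prop with h2 | h2
  · exact same hf hM hN hi h1 h2
  · exact mixed hM hN hi h1 h2
  · exact (mixed hN hM (by rwa [inter_comm]) h2 h1).symm
  · exact same hf.dual (hd ▸ hM) (hd ▸ hN) hi (inTight_dual.2 h1) (inTight_dual.2 h2)

open Classical in
/-- The minimal tight sets. -/
noncomputable def minTight (f : Finset V → ℕ) (k : ℕ) : Finset (Finset V) :=
  univ.filter (Minimal (Tight f k))

/-- The quantity that decreases with every transfer: the sum of `|V| - |M|` over the minimal tight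
sets `M`. -/
noncomputable def potential (f : Finset V → ℕ) (k : ℕ) : ℕ :=
  ∑ M ∈ minTight f k, (Fintype.card V - M.card)

theorem mem_minTight {M : Finset V} : M ∈ minTight f k ↔ Minimal (Tight f k) M := by
  simp [minTight]

theorem card_lt_of_tight {M : Finset V} (h : Tight f k M) : M.card < Fintype.card V :=
  have ⟨_, hv⟩ := compl_nonempty_of_ne_univ h.ne_univ
  card_lt_univ_of_notMem (mem_compl.1 hv)

theorem potential_eq_zero_iff : potential f k = 0 ↔ ∀ T, ¬ InTight f k T := by
  unfold potential
  rw [sum_eq_zero_iff]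
  constructor
  · intro h T hT
    obtain ⟨M, -, hM⟩ := exists_minimal_subset (P := Tight f k) (Or.inl hT)
    have h1 := h M (mem_minTight.2 hM)
    have h2 := card_lt_of_tight hM.prop
    omega
  · intro h M hM
    rcases (mem_minTight.1 hM).prop with h' | h'
    · exact absurd h' (h _)
    · exact absurd h' (h _)

/-- Minimal tight sets are disjoint, so there are at most `|V|` of them. -/
theorem IsAdmissible.potential_le (hf : IsAdmissible f k) :
    potential f k ≤ Fintype.card V * (Fintype.card V - 1) := by
  unfold potential
  have h1 : (minTight f k).card ≤ Fintype.card V := by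
    have hne : ∀ M : minTight f k, ∃ v, v ∈ M.1 := fun M => (mem_minTight.1 M.2).prop.nonempty
    choose φ hφ using hne
    have hinj : Function.Injective φ := by
      intro M N h
      refine Subtype.ext (hf.eq_of_minimal_tight (mem_minTight.1 M.2) (mem_minTight.1 N.2)
        ⟨φ M, mem_inter.2 ⟨hφ M, h ▸ hφ N⟩⟩)
    simpa using Fintype.card_le_of_injective φ hinj
  refine (sum_le_card_nsmul _ _ (Fintype.card V - 1) fun M hM => ?_).trans ?_
  · have := (mem_minTight.1 hM).prop.nonempty.card_pos
    omega
  · rw [smul_eq_mul]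
    exact Nat.mul_le_mul_right _ h1

/-- Each minimal tight set of `g` contains one of `f`, and these are different because minimal tight
sets of `g` are disjoint. The set `D` is missed, or it is a proper subset of the set that contains
it. -/
theorem potential_lt {g : Finset V → ℕ} (hg : IsAdmissible g k)
    (h : ∀ M, Tight g k M → ∃ S ⊆ M, Tight f k S)
    (hD : ∃ D, Minimal (Tight f k) D ∧ ¬ Tight g k D) : potential g k < potential f k := by
  classical
  have hex : ∀ M ∈ minTight g k, ∃ S ∈ minTight f k, S ⊆ M := by
    intro M hM
    obtain ⟨S, hSM, hS⟩ := h M (mem_minTight.1 hM).prop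
    obtain ⟨R, hRS, hR⟩ := exists_minimal_subset hS
    exact ⟨R, mem_minTight.2 hR, hRS.trans hSM⟩
  choose! φ hφ hφs using hex
  have hinj : Set.InjOn φ (minTight g k) := by
    intro M hM N hN hMN
    rw [mem_coe] at hM hN
    obtain ⟨v, hv⟩ := (mem_minTight.1 (hφ M hM)).prop.nonempty
    exact hg.eq_of_minimal_tight (mem_minTight.1 hM) (mem_minTight.1 hN)
      ⟨v, mem_inter.2 ⟨hφs M hM hv, hφs N hN (hMN ▸ hv)⟩⟩
  obtain ⟨D, hD, hDg⟩ := hD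
  have himg : (minTight g k).image φ ⊆ minTight f k := image_subset_iff.2 hφ
  have hle : ∀ M ∈ minTight g k, Fintype.card V - M.card ≤ Fintype.card V - (φ M).card :=
    fun M hM => Nat.sub_le_sub_left (card_le_card (hφs M hM)) _
  unfold potential
  by_cases hDi : D ∈ (minTight g k).image φ
  · obtain ⟨M, hM, rfl⟩ := mem_image.1 hDi
    have hMg := (mem_minTight.1 hM).prop
    have hss : φ M ⊂ M := (hφs M hM).ssubset_of_ne fun h => hDg (h.symm ▸ hMg)
    have hlt := card_lt_card hss
    have hlt' := card_lt_of_tight hMg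
    calc _ < ∑ M ∈ minTight g k, (Fintype.card V - (φ M).card) :=
          sum_lt_sum hle ⟨M, hM, by omega⟩
      _ = ∑ S ∈ (minTight g k).image φ, (Fintype.card V - S.card) := by rw [sum_image hinj]
      _ ≤ _ := sum_le_sum_of_subset himg
  · have hlt := card_lt_of_tight hD.prop
    calc _ ≤ ∑ M ∈ minTight g k, (Fintype.card V - (φ M).card) := sum_le_sum hle
      _ = ∑ S ∈ (minTight g k).image φ, (Fintype.card V - S.card) := by rw [sum_image hinj]
      _ < _ := sum_lt_sum_of_subset himg (mem_minTight.2 hD) hDi (by omega) (by simp)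

end CutFunction

/-! ### Sequences of reorientations -/

namespace MultiHypergraph
namespace Orientation

open CutFunction

variable {V E : Type*} [Fintype V] [DecidableEq V] [Fintype E] [DecidableEq E]
variable {H : MultiHypergraph V E} {k : ℕ}

theorem IsHyperarcConnected.isAdmissible {O : H.Orientation} (hO : O.IsHyperarcConnected k)
    (hH : H.IsPartitionConnected (k + 1)) : IsAdmissible O.inDegree k where
  le := (O.isHyperarcConnected_iff k).1 hO
  submod := O.inDegree_inter_add_union
  part P hP := (hH P hP).trans (O.crossCount_le_sum_inDegree P)
  copart P hP := (hH P hP).trans (O.crossCount_le_sum_inDegree_compl P)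
  map_empty := by simp [inDegree]
  map_univ := by simp [inDegree]

theorem IsHyperarcConnected.succ_iff {O : H.Orientation} (hO : O.IsHyperarcConnected k) :
    O.IsHyperarcConnected (k + 1) ↔ potential O.inDegree k = 0 := by
  rw [potential_eq_zero_iff, isHyperarcConnected_iff]
  rw [isHyperarcConnected_iff] at hO
  constructor
  · intro h T hT
    have := h T hT.1 hT.2.1
    have := hT.2.2
    omega
  · intro h X h1 h2
    have h3 := hO X h1 h2
    have h4 : O.inDegree X ≠ k := fun h' => h X ⟨h1, h2, h'⟩
    omega

/-- As long as `O` is not `(k+1)`-hyperarc-connected, there is a transfer that decreases the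
potential and can be realized along a path. -/
theorem IsHyperarcConnected.exists_transfer {O : H.Orientation} (hO : O.IsHyperarcConnected k)
    (hH : H.IsPartitionConnected (k + 1)) (hpot : potential O.inDegree k ≠ 0) :
    ∃ x w, Accompanies O.inDegree k w x ∧ Reach O.Arc (Accompanies O.inDegree k w) x w ∧
      ∀ O' : H.Orientation, IsTransfer O.inDegree O'.inDegree w x →
        potential O'.inDegree k < potential O.inDegree k := by
  have hf := hO.isAdmissible hH
  have hT : ∃ T, InTight O.inDegree k T := by
    by_contra! h
    exact hpot (potential_eq_zero_iff.2 h)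
  obtain ⟨X, Y, x, w, hX, hY, hx, hw, hXY, hacc, hreach⟩ :=
    hf.exists_source_sink (adj := O.Arc) (fun _ _ => O.inDegree_le_of_no_arc) hT
  refine ⟨x, w, hacc, hreach, fun O' hO' => ?_⟩
  have hconn : O'.IsHyperarcConnected k :=
    (O'.isHyperarcConnected_iff k).2 (hO'.le hf.le hacc)
  obtain ⟨h1, h2⟩ := hf.tight_of_transfer hO' hX hY hx hw hXY
  exact potential_lt (hconn.isAdmissible hH) h1 h2

/-- The outcome of a search from `x` along arcs whose heads satisfy `p`: the vertices reached
have positive level, and each of them except `x` was reached from a vertex of smaller level. -/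
structure IsLevel (O : H.Orientation) (p : V → Prop) (x : V) (lev : V → ℕ) : Prop where
  source : lev x = 1
  eq_source : ∀ v, lev v = 1 → v = x
  pred : ∀ v, 1 < lev v → p v ∧ ∃ e, O.head e = v ∧ ∃ a ∈ H.edge e, 0 < lev a ∧ lev a < lev v
  closed : ∀ e, ∀ a ∈ H.edge e, 0 < lev a → p (O.head e) → 0 < lev (O.head e)

theorem IsLevel.pos_of_reach {O : H.Orientation} {p : V → Prop} {x v : V} {lev : V → ℕ}
    (h : O.IsLevel p x lev) (hv : Reach O.Arc p x v) : 0 < lev v := by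
  induction hv with
  | refl => rw [h.source]; omega
  | tail _ hab ih =>
    obtain ⟨⟨e, ha, rfl⟩, hp⟩ := hab
    exact h.closed e _ ha ih hp

/-- The vertices that are reached after `n` arcs. -/
def ReachIn (O : H.Orientation) (p : V → Prop) (x : V) : ℕ → V → Prop
  | 0, v => v = x
  | n + 1, v => p v ∧ ∃ a, ReachIn O p x n a ∧ O.Arc a v

theorem exists_isLevel (O : H.Orientation) (p : V → Prop) (x : V) :
    ∃ lev, O.IsLevel p x lev := by
  classical
  let lev : V → ℕ := fun v => if h : ∃ n, O.ReachIn p x n v then Nat.find h + 1 else 0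
  have hle : ∀ n v, O.ReachIn p x n v → 0 < lev v ∧ lev v ≤ n + 1 := by
    intro n v h
    have h' : ∃ n, O.ReachIn p x n v := ⟨n, h⟩
    simp only [lev, h', dif_pos]
    exact ⟨by omega, Nat.succ_le_succ (Nat.find_min' h' h)⟩
  have hspec : ∀ n v, lev v = n + 1 → O.ReachIn p x n v := by
    intro n v h
    by_cases h' : ∃ n, O.ReachIn p x n v
    · simp only [lev, h', dif_pos] at h
      have := Nat.find_spec h'
      rwa [show Nat.find h' = n by omega] at this
    · simp [lev, h'] at h
  refine ⟨lev, ?_, fun v hv => hspec 0 v hv, ?_, ?_⟩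
  · have := hle 0 x rfl
    omega
  · intro v hv
    obtain ⟨n, hn⟩ : ∃ n, lev v = n + 1 + 1 := ⟨lev v - 2, by omega⟩
    obtain ⟨hp, a, ha, e, hae, he⟩ := hspec _ v hn
    have := hle n a ha
    exact ⟨hp, e, he, a, hae, this.1, by omega⟩
  · intro e a ha hlev hp
    obtain ⟨n, hn⟩ : ∃ n, lev a = n + 1 := ⟨lev a - 1, by omega⟩
    exact (hle (n + 1) _ ⟨hp, a, hspec n a hn, e, ha, rfl⟩).1

/-- The state of a walk that started at `w` and has come to `c`, having reoriented `O` to `O'` on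
the way: hyperarcs into vertices of level at most that of `c` have not been touched. -/
structure WalkInv (O : H.Orientation) (lev : V → ℕ) (w : V) (O' : H.Orientation) (c : V) :
    Prop where
  transfer : IsTransfer O.inDegree O'.inDegree w c
  pos : 0 < lev c
  keep : ∀ e, lev (O.head e) ≤ lev c → O'.head e = O.head e

theorem WalkInv.refl (O : H.Orientation) {lev : V → ℕ} {w : V} (hw : 0 < lev w) :
    WalkInv O lev w O w :=
  ⟨fun _ => rfl, hw, fun _ _ => rfl⟩

theorem WalkInv.exists_arc {O O' : H.Orientation} {p : V → Prop} {x w c : V} {lev : V → ℕ}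
    (hlev : O.IsLevel p x lev) (h : WalkInv O lev w O' c) (hc : 1 < lev c) :
    ∃ e, O'.head e = c ∧ ∃ a ∈ H.edge e, 0 < lev a ∧ lev a < lev c := by
  obtain ⟨-, e, he, ha⟩ := hlev.pred c hc
  exact ⟨e, by rw [h.keep e (by rw [he]), he], ha⟩

theorem WalkInv.step {O O' O'' : H.Orientation} {w c a : V} {lev : V → ℕ} {e : E}
    (h : WalkInv O lev w O' c) (he : O'.head e = c) (ha : a ∈ H.edge e) (ha0 : 0 < lev a)
    (hac : lev a < lev c) (hO'' : O''.head = Function.update O'.head e a) :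
    O'.IsReorientation O'' ∧ WalkInv O lev w O'' a := by
  refine ⟨⟨e, a, mem_erase.2 ⟨?_, ha⟩, hO''⟩, ?_, ha0, ?_⟩
  · rintro rfl
    rw [he] at hac
    exact lt_irrefl _ hac
  · intro T
    have h1 := h.transfer T
    have h2 := inDegree_update ha hO'' T
    rw [he] at h2
    omega
  · intro e' he'
    rw [hO'', Function.update_of_ne, h.keep e' (by omega)]
    rintro rfl
    rw [h.keep e' (by omega)] at he
    rw [he] at he'
    omega

/-- The walk has come to a vertex that accompanies `w`. -/
theorem WalkInv.isHyperarcConnected {O O' : H.Orientation} {x w c : V} {lev : V → ℕ}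
    (hO : O.IsHyperarcConnected k) (hx : Accompanies O.inDegree k w x)
    (hlev : O.IsLevel (Accompanies O.inDegree k w) x lev) (h : WalkInv O lev w O' c) :
    O'.IsHyperarcConnected k := by
  refine (O'.isHyperarcConnected_iff k).2
    (h.transfer.le ((O.isHyperarcConnected_iff k).1 hO) ?_)
  rcases (Nat.succ_le_of_lt h.pos).eq_or_lt with h1 | h1
  · rw [hlev.eq_source c h1.symm]
    exact hx
  · exact (hlev.pred c h1).1

/-- `Chain k O ℓ O'`: the orientation `O'` is reached from `O` by `ℓ` reorientations of single
hyperarcs through `k`-hyperarc-connected orientations. -/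
inductive Chain (k : ℕ) : H.Orientation → ℕ → H.Orientation → Prop
  | nil {O : H.Orientation} : O.IsHyperarcConnected k → Chain k O 0 O
  | cons {O O₁ O' : H.Orientation} {ℓ : ℕ} : O.IsHyperarcConnected k → O.IsReorientation O₁ →
      Chain k O₁ ℓ O' → Chain k O (ℓ + 1) O'

theorem Chain.trans {O O₁ O' : H.Orientation} {ℓ ℓ' : ℕ} (h : Chain k O ℓ O₁)
    (h' : Chain k O₁ ℓ' O') : Chain k O (ℓ + ℓ') O' := by
  induction h with
  | nil => simpa using h'
  | cons h1 h2 _ ih => rw [Nat.add_right_comm]; exact .cons h1 h2 (ih h')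

theorem Chain.exists_seq {O O' : H.Orientation} {ℓ : ℕ} (h : Chain k O ℓ O') :
    ∃ seq : ℕ → H.Orientation, seq 0 = O ∧ seq ℓ = O' ∧
      (∀ i < ℓ, (seq i).IsReorientation (seq (i + 1))) ∧
      ∀ i ≤ ℓ, (seq i).IsHyperarcConnected k := by
  induction h with
  | @nil O h => exact ⟨fun _ => O, rfl, rfl, fun i hi => absurd hi (Nat.not_lt_zero i),
      fun _ _ => h⟩
  | @cons O O₁ O' ℓ h1 h2 _ ih =>
    obtain ⟨seq, hs0, hsl, hstep, hconn⟩ := ih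
    refine ⟨fun i => Nat.casesOn i O seq, rfl, hsl, ?_, ?_⟩
    · rintro (_ | i) hi
      · simpa [hs0] using h2
      · exact hstep i (by omega)
    · rintro (_ | i) hi
      · exact h1
      · exact hconn i (by omega)

/-- A walk can be completed: its level decreases until it arrives at `x`. -/
theorem exists_chain_of_walkInv {O : H.Orientation} {x w : V} {lev : V → ℕ}
    (hO : O.IsHyperarcConnected k) (hx : Accompanies O.inDegree k w x)
    (hlev : O.IsLevel (Accompanies O.inDegree k w) x lev) (n : ℕ) (O' : H.Orientation) (c : V)
    (hn : (univ.filter fun v => lev v < lev c).card = n) (h : WalkInv O lev w O' c) :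
    ∃ ℓ ≤ n, ∃ O'', Chain k O' ℓ O'' ∧ IsTransfer O.inDegree O''.inDegree w x := by
  induction n using Nat.strong_induction_on generalizing O' c with
  | _ n ih =>
  have hO' := h.isHyperarcConnected hO hx hlev
  rcases (Nat.succ_le_of_lt h.pos).eq_or_lt with h1 | h1
  · exact ⟨0, Nat.zero_le _, O', .nil hO', hlev.eq_source c h1.symm ▸ h.transfer⟩
  · obtain ⟨e, he, a, ha, ha0, hac⟩ := h.exists_arc hlev h1
    let O'' : H.Orientation := ⟨Function.update O'.head e a, fun e' => by
      by_cases hee : e' = e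
      · subst hee; simpa using ha
      · simpa [hee] using O'.head_mem e'⟩
    obtain ⟨hr, hinv⟩ := h.step he ha ha0 hac (O'' := O'') rfl
    have hlt : (univ.filter fun v => lev v < lev a).card < n := by
      rw [← hn]
      refine card_lt_card ⟨fun v hv => ?_, fun hs => ?_⟩
      · simp only [mem_filter, mem_univ, true_and] at hv ⊢
        omega
      · have := hs (mem_filter.2 ⟨mem_univ a, hac⟩)
        simp at this
    obtain ⟨ℓ, hℓ, R, hR, hRt⟩ := ih _ hlt O'' a rfl hinv
    exact ⟨ℓ + 1, by omega, R, .cons hO' hr hR, hRt⟩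

/-- Transfers are carried out until the potential is zero. -/
theorem exists_chain (hH : H.IsPartitionConnected (k + 1)) (O : H.Orientation)
    (hO : O.IsHyperarcConnected k) : ∃ ℓ ≤ potential O.inDegree k * Fintype.card V, ∃ O',
      Chain k O ℓ O' ∧ O'.IsHyperarcConnected (k + 1) := by
  induction hp : potential O.inDegree k using Nat.strong_induction_on generalizing O with
  | _ q ih =>
  by_cases hq : q = 0
  · exact ⟨0, Nat.zero_le _, O, .nil hO, hO.succ_iff.2 (hp.trans hq)⟩
  · obtain ⟨x, w, hacc, hreach, hlt⟩ := hO.exists_transfer hH (hp ▸ hq)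
    obtain ⟨lev, hlev⟩ := exists_isLevel O (Accompanies O.inDegree k w) x
    obtain ⟨ℓ, hℓ, O₁, hch, htr⟩ := exists_chain_of_walkInv hO hacc hlev _ O w rfl
      (WalkInv.refl O (hlev.pos_of_reach hreach))
    have hO₁ : O₁.IsHyperarcConnected k :=
      (O₁.isHyperarcConnected_iff k).2 (htr.le ((O.isHyperarcConnected_iff k).1 hO) hacc)
    have hlt := hlt O₁ htr
    obtain ⟨ℓ', hℓ', O', hch', hO'⟩ := ih _ (hp ▸ hlt) O₁ hO₁ rfl
    refine ⟨ℓ + ℓ', ?_, O', hch.trans hch', hO'⟩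
    have h1 : ℓ ≤ Fintype.card V := hℓ.trans (card_le_univ _)
    have h2 := Nat.mul_le_mul_right (Fintype.card V) (show
      potential O₁.inDegree k + 1 ≤ q by omega)
    rw [Nat.succ_mul] at h2
    omega

theorem IsHyperarcConnected.mono {O : H.Orientation} {i j : ℕ} (h : O.IsHyperarcConnected j)
    (hij : i ≤ j) : O.IsHyperarcConnected i :=
  fun X h1 h2 => hij.trans (h X h1 h2)

theorem IsHyperarcConnected.le_hyperarcConnectivity {O : H.Orientation} {j : ℕ}
    (h : O.IsHyperarcConnected j) : (j : ℕ∞) ≤ O.hyperarcConnectivity :=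
  le_iSup₂ (f := fun (k : ℕ) (_ : O.IsHyperarcConnected k) => (k : ℕ∞)) j h

theorem hyperarcConnectivity_le {O : H.Orientation} {j : ℕ}
    (h : ¬ O.IsHyperarcConnected (j + 1)) : O.hyperarcConnectivity ≤ j := by
  refine iSup₂_le fun i hi => ?_
  by_contra hlt
  rw [not_le, Nat.cast_lt] at hlt
  exact h (hi.mono hlt)

/-- A single reorientation changes the hyperarc-connectivity by at most one. -/
theorem IsReorientation.isHyperarcConnected {O O' : H.Orientation} {j : ℕ}
    (h : O.IsReorientation O') (hO' : O'.IsHyperarcConnected (j + 1)) :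
    O.IsHyperarcConnected j := by
  obtain ⟨e, u, hu, h⟩ := h
  rw [isHyperarcConnected_iff] at hO' ⊢
  intro X h1 h2
  have h3 := hO' X h1 h2
  have h4 := inDegree_update (mem_of_mem_erase hu) h X
  split_ifs at h4 <;> omega

/-- A sequence of reorientations is cut off at its first `(k+1)`-hyperarc-connected member. -/
theorem isAugmentingSequence_of_first {O : H.Orientation} {ℓ : ℕ} {seq : ℕ → H.Orientation}
    (h0 : seq 0 = O) (hstep : ∀ i < ℓ, (seq i).IsReorientation (seq (i + 1)))
    (hconn : ∀ i ≤ ℓ, (seq i).IsHyperarcConnected k)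
    (hnot : ∀ i < ℓ, ¬ (seq i).IsHyperarcConnected (k + 1))
    (hlast : (seq ℓ).IsHyperarcConnected (k + 1)) : O.IsAugmentingSequence k ℓ seq where
  start := h0
  step := hstep
  monotone i hi := (hyperarcConnectivity_le (hnot i hi)).trans
    (hconn (i + 1) hi).le_hyperarcConnectivity
  connected := hlast
  exact hO := by
    refine le_antisymm ?_ hlast.le_hyperarcConnectivity
    rcases ℓ with _ | ℓ
    · rwa [h0]
    · refine hyperarcConnectivity_le fun h => ?_
      exact hnot ℓ ℓ.lt_succ_self ((hstep ℓ ℓ.lt_succ_self).isHyperarcConnected h)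

theorem exists_isAugmentingSequence (hH : H.IsPartitionConnected (k + 1)) (O : H.Orientation)
    (hO : O.IsHyperarcConnected k) :
    ∃ (ℓ : ℕ) (seq : ℕ → H.Orientation),
      ℓ ≤ Fintype.card V ^ 3 ∧ O.IsAugmentingSequence k ℓ seq := by
  classical
  obtain ⟨L, hL, O', hch, hO'⟩ := exists_chain hH O hO
  obtain ⟨seq, h0, hl, hstep, hconn⟩ := hch.exists_seq
  have hex : ∃ i, (seq i).IsHyperarcConnected (k + 1) := ⟨L, hl.symm ▸ hO'⟩
  have hle : Nat.find hex ≤ L := Nat.find_min' hex (hl.symm ▸ hO')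
  refine ⟨Nat.find hex, seq, ?_, isAugmentingSequence_of_first h0
    (fun i hi => hstep i (by omega)) (fun i hi => hconn i (by omega))
    (fun i hi => Nat.find_min hex hi) (Nat.find_spec hex)⟩
  have h1 := (hO.isAdmissible hH).potential_le
  calc Nat.find hex ≤ L := hle
    _ ≤ _ := hL
    _ ≤ Fintype.card V * (Fintype.card V - 1) * Fintype.card V := Nat.mul_le_mul_right _ h1
    _ ≤ Fintype.card V * Fintype.card V * Fintype.card V := by gcongr; omega
    _ = Fintype.card V ^ 3 := by ring

end Orientation
end MultiHypergraph

/-! ### A language of commands with counted loops -/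

namespace RAM

@[simp] theorem State.setReg_reg (s : State) (x v y : ℕ) :
    (s.setReg x v).reg y = if y = x then v else s.reg y := by
  simp [State.setReg, Function.update_apply]

@[simp] theorem State.setReg_arr (s : State) (x v : ℕ) : (s.setReg x v).arr = s.arr := rfl

@[simp] theorem State.setArr_reg (s : State) (a i j v : ℕ) : (s.setArr a i j v).reg = s.reg := rfl

theorem State.setArr_arr (s : State) (a i j v a' i' j' : ℕ) :
    (s.setArr a i j v).arr a' i' j' = if a' = a ∧ i' = i ∧ j' = j then v else s.arr a' i' j' := rfl

/-- Expressions with bounded sums. In `sum x b e` the variable `x` runs from `0` to the value of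
the variable `b` minus one. Bounded quantifiers and bounded search are special cases. -/
inductive SumExpr where
  | lit (c : ℕ)
  | var (x : ℕ)
  | get (a : ℕ) (i j : SumExpr)
  | add (e f : SumExpr)
  | sub (e f : SumExpr)
  | lt (e f : SumExpr)
  | eq (e f : SumExpr)
  | sum (x b : ℕ) (e : SumExpr)

namespace SumExpr

/-- The value of an expression. -/
def eval : SumExpr → State → ℕ
  | lit c, _ => c
  | var x, s => s.reg x
  | get a i j, s => s.arr a (i.eval s) (j.eval s)
  | add e f, s => e.eval s + f.eval s
  | sub e f, s => e.eval s - f.eval s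
  | lt e f, s => if e.eval s < f.eval s then 1 else 0
  | eq e f, s => if e.eval s = f.eval s then 1 else 0
  | sum x b e, s => ∑ i ∈ range (s.reg b), e.eval (s.setReg x i)

/-- The program that computes the value of an expression in the variable `r`. Its intermediate
results are kept in variables from `r` on. -/
def code : SumExpr → ℕ → Prog
  | lit c, r => .assign r (.lit c)
  | var x, r => .assign r (.var x)
  | get a i j, r => .seq (i.code r) (.seq (j.code (r + 1))
      (.assign r (.get a (.var r) (.var (r + 1)))))
  | add e f, r => .seq (e.code r) (.seq (f.code (r + 1))
      (.assign r (.add (.var r) (.var (r + 1)))))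
  | sub e f, r => .seq (e.code r) (.seq (f.code (r + 1))
      (.assign r (.sub (.var r) (.var (r + 1)))))
  | lt e f, r => .seq (e.code r) (.seq (f.code (r + 1))
      (.assign r (.lt (.var r) (.var (r + 1)))))
  | eq e f, r => .seq (e.code r) (.seq (f.code (r + 1))
      (.assign r (.eq (.var r) (.var (r + 1)))))
  | sum x b e, r => .seq (.assign r (.lit 0)) (.seq (.assign x (.lit 0))
      (.loop (.lt (.var x) (.var b)) (.seq (e.code (r + 1))
        (.seq (.assign r (.add (.var r) (.var (r + 1)))) (.assign x (.add (.var x) (.lit 1)))))))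

/-- A bound for the running time of `code`, as a polynomial in a bound for the variables `0`
and `1`. -/
noncomputable def time : SumExpr → Polynomial ℕ
  | lit _ => .C 2
  | var _ => .C 2
  | get _ i j => i.time + j.time + .C 4
  | add e f => e.time + f.time + .C 4
  | sub e f => e.time + f.time + .C 4
  | lt e f => e.time + f.time + .C 4
  | eq e f => e.time + f.time + .C 4
  | sum _ _ e => .X * (e.time + .C 12) + .C 8

/-- Well-formedness of an expression in the scope of the bound variables in `Γ`. Program variables
are below `50`, bound variables from `50` to `99`, and the variables from `100` on hold
intermediate results; sums are bounded by variable `0` or `1`. -/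
def wf : SumExpr → List ℕ → Bool
  | lit _, _ => true
  | var x, Γ => x < 50 || x ∈ Γ
  | get _ i j, Γ => i.wf Γ && j.wf Γ
  | add e f, Γ => e.wf Γ && f.wf Γ
  | sub e f, Γ => e.wf Γ && f.wf Γ
  | lt e f, Γ => e.wf Γ && f.wf Γ
  | eq e f, Γ => e.wf Γ && f.wf Γ
  | sum x b e, Γ => 50 ≤ x && x < 100 && x ∉ Γ && b < 2 && e.wf (x :: Γ)

end SumExpr

/-- Two states agree on the arrays, the program variables and the variables in `Γ`. -/
def Agree (Γ : List ℕ) (s u : State) : Prop :=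
  s.arr = u.arr ∧ ∀ y, y < 50 ∨ y ∈ Γ → s.reg y = u.reg y

theorem SumExpr.eval_congr {e : SumExpr} {Γ : List ℕ} (he : e.wf Γ) {s u : State}
    (h : Agree Γ s u) : e.eval s = e.eval u := by
  induction e generalizing Γ s u with
  | lit c => rfl
  | var x => exact h.2 x (by simpa [wf] using he)
  | get a i j hi hj =>
    simp only [wf, Bool.and_eq_true] at he
    simp only [eval, hi he.1 h, hj he.2 h, h.1]
  | add e f ihe ihf | sub e f ihe ihf | lt e f ihe ihf | eq e f ihe ihf =>
    simp only [wf, Bool.and_eq_true] at he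
    simp only [eval, ihe he.1 h, ihf he.2 h]
  | sum x b e ih =>
    simp only [wf, Bool.and_eq_true, decide_eq_true_eq] at he
    simp only [eval, h.2 b (Or.inl (by omega))]
    refine sum_congr rfl fun i _ => ih he.2 ⟨h.1, fun y hy => ?_⟩
    simp only [State.setReg_reg]
    split_ifs with hyx
    · rfl
    · exact h.2 y (by simpa [hyx] using hy)

/-- The rule for loops that count up to `N`. -/
theorem exec_loop {c : Expr} {P : Prog} {T N : ℕ} (I : ℕ → State → Prop)
    (hc : ∀ i s, I i s → i ≤ N → (c.eval s ≠ 0 ↔ i < N))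
    (hP : ∀ i < N, ∀ s, I i s → ∃ t s', Exec P s t s' ∧ t ≤ T ∧ I (i + 1) s') (j i : ℕ)
    (hij : i + j = N) (s : State) (hs : I i s) :
    ∃ t s', Exec (.loop c P) s t s' ∧ t ≤ j * (c.cost + 1 + T) + (c.cost + 1) ∧ I N s' := by
  induction j generalizing i s with
  | zero =>
    obtain rfl : i = N := by omega
    exact ⟨_, s, .loop_false (by simpa using (hc i s hs le_rfl)), by omega, hs⟩
  | succ j ih =>
    obtain ⟨t, s', h1, h2, h3⟩ := hP i (by omega) s hs
    obtain ⟨t', s'', h4, h5, h6⟩ := ih (i + 1) (by omega) s' h3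
    refine ⟨_, s'', .loop_true ((hc i s hs (by omega)).2 (by omega)) h1 h4, ?_, h6⟩
    rw [Nat.succ_mul]
    omega

/-- The code of `e`, in the scope of the bound variables in `Γ`, computes the value of `e` in the
given time and keeps everything but bound variables of its own and intermediate results. -/
def SumExpr.Computes (B : ℕ) (Γ : List ℕ) (e : SumExpr) (c : ℕ → Prog) (T : ℕ) : Prop :=
  ∀ r, 100 ≤ r → ∀ s : State, s.reg 0 ≤ B → s.reg 1 ≤ B →
    ∃ t s', Exec (c r) s t s' ∧ t ≤ T ∧ s'.arr = s.arr ∧ s'.reg r = e.eval s ∧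
      ∀ y, y < 50 ∨ y ∈ Γ ∨ (100 ≤ y ∧ y < r) → s'.reg y = s.reg y

theorem ne_of_scope {Γ : List ℕ} (hΓ : ∀ y ∈ Γ, y < 100) {r y : ℕ} (hr : 100 ≤ r)
    (h : y < 50 ∨ y ∈ Γ ∨ (100 ≤ y ∧ y < r)) : y ≠ r := by
  rcases h with h | h | h
  · omega
  · have := hΓ y h
    omega
  · omega

theorem SumExpr.Computes.binary {B : ℕ} {Γ : List ℕ} (hΓ : ∀ y ∈ Γ, y < 100) {e f g : SumExpr}
    {T T' : ℕ} (he : e.Computes B Γ e.code T) (hf : f.Computes B Γ f.code T') (hfw : f.wf Γ)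
    {h : ℕ → Expr} (hh : ∀ r, (h r).cost = 3)
    (hg : ∀ r, ∀ s s' : State, s'.arr = s.arr → s'.reg r = e.eval s →
      s'.reg (r + 1) = f.eval s → (h r).eval s' = g.eval s) :
    g.Computes B Γ (fun r => .seq (e.code r) (.seq (f.code (r + 1)) (.assign r (h r))))
      (T + T' + 4) := by
  intro r hr s h0 h1
  obtain ⟨t, s', a1, a2, a3, a4, a5⟩ := he r hr s h0 h1
  have b0 := a5 0 (by omega)
  have b1 := a5 1 (by omega)
  obtain ⟨t', s'', c1, c2, c3, c4, c5⟩ := hf (r + 1) (by omega) s' (by omega) (by omega)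
  refine ⟨_, _, .seq a1 (.seq c1 (.assign s'' r (h r))), by rw [hh]; omega, c3.trans a3, ?_, ?_⟩
  · rw [State.setReg_reg, if_pos rfl]
    refine hg r s s'' (c3.trans a3) ?_ ?_
    · rw [c5 r (by omega), a4]
    · rw [c4]
      exact eval_congr hfw ⟨a3, fun y hy => a5 y (by tauto)⟩
  · intro y hy
    rw [State.setReg_reg, if_neg (ne_of_scope hΓ hr hy), c5 y ?_, a5 y hy]
    rcases hy with h | h | h
    · exact Or.inl h
    · exact Or.inr (Or.inl h)
    · exact Or.inr (Or.inr (by omega))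

theorem SumExpr.Computes.sum {B : ℕ} {Γ : List ℕ} (hΓ : ∀ y ∈ Γ, y < 100) {e : SumExpr}
    {x b T : ℕ} (he : e.Computes B (x :: Γ) e.code T) (hew : e.wf (x :: Γ)) (hx : 50 ≤ x)
    (hx' : x < 100) (hxΓ : x ∉ Γ) (hb : b < 2) :
    (sum x b e).Computes B Γ (sum x b e).code (B * (T + 12) + 8) := by
  intro r hr s h0 h1
  have hN : s.reg b ≤ B := by
    interval_cases b
    · exact h0
    · exact h1
  have hne : ∀ y, (y < 50 ∨ y ∈ Γ ∨ (100 ≤ y ∧ y < r)) → y ≠ x ∧ y ≠ r := by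
    intro y hy
    refine ⟨?_, ne_of_scope hΓ hr hy⟩
    rintro rfl
    rcases hy with h | h | h
    · omega
    · exact hxΓ h
    · omega
  let I : ℕ → State → Prop := fun i t => t.arr = s.arr ∧ t.reg x = i ∧
    t.reg r = ∑ j ∈ range i, e.eval (s.setReg x j) ∧
    ∀ y, (y < 50 ∨ y ∈ Γ ∨ (100 ≤ y ∧ y < r)) → t.reg y = s.reg y
  obtain ⟨t, s', a1, a2, a3⟩ := exec_loop (c := .lt (.var x) (.var b))
    (P := .seq (e.code (r + 1)) (.seq (.assign r (.add (.var r) (.var (r + 1))))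
      (.assign x (.add (.var x) (.lit 1))))) (T := T + 8) (N := s.reg b) I
    (by
      rintro i t ⟨-, h2, -, h4⟩ -
      simp only [Expr.eval, h2, h4 b (by omega)]
      split_ifs <;> simp_all)
    (by
      rintro i hi t ⟨h2, h3, h4, h5⟩
      obtain ⟨t1, s1, c1, c2, c3, c4, c5⟩ := he (r + 1) (by omega) t
        (by rw [h5 0 (by omega)]; exact h0) (by rw [h5 1 (by omega)]; exact h1)
      refine ⟨_, _, .seq c1 (.seq (.assign s1 r _) (.assign _ x _)), ?_, c3.trans h2, ?_, ?_, ?_⟩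
      · simp only [Expr.cost]
        omega
      · have : x ≠ r := by omega
        simp [Expr.eval, this, c5 x, h3]
      · have h6 : r ≠ x := by omega
        have h7 : e.eval t = e.eval (s.setReg x i) := by
          refine eval_congr hew ⟨h2, fun y hy => ?_⟩
          rw [State.setReg_reg]
          split_ifs with hyx
          · rw [hyx, h3]
          · exact h5 y (by rcases hy with h | h <;> simp_all)
        have h8 := c5 r (by omega)
        simp [Expr.eval, h6, sum_range_succ, c4, h7, h8, h4]
      · intro y hy
        have h9 : s1.reg y = t.reg y := c5 y (by
          rcases hy with h | h | h
          · exact Or.inl h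
          · exact Or.inr (Or.inl (List.mem_cons_of_mem _ h))
          · exact Or.inr (Or.inr (by omega)))
        simp [(hne y hy).1, (hne y hy).2, h9, h5 y hy])
    (s.reg b) 0 (by omega) ((s.setReg r 0).setReg x 0)
    (by
      have : r ≠ x := by omega
      refine ⟨rfl, by simp, by simp [this], fun y hy => ?_⟩
      simp [(hne y hy).1, (hne y hy).2])
  refine ⟨_, s', .seq (.assign s r _) (.seq (.assign _ x _) a1), ?_, a3.1, ?_, a3.2.2.2⟩
  · simp only [Expr.cost] at a2 ⊢
    have := Nat.mul_le_mul_right (T + 12) hN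
    have h9 : s.reg b * (1 + 1 + 1 + 1 + (T + 8)) = s.reg b * (T + 12) := by ring
    omega
  · rw [a3.2.2.1, eval]

theorem SumExpr.computes_code {e : SumExpr} (B : ℕ) {Γ : List ℕ} (hΓ : ∀ y ∈ Γ, y < 100)
    (he : e.wf Γ) : e.Computes B Γ e.code (e.time.eval B) := by
  induction e generalizing Γ with
  | lit c =>
    exact fun r hr s _ _ => ⟨_, _, .assign s r (.lit c), by simp [time, Expr.cost], rfl,
      by simp [eval, Expr.eval], fun y hy => by simp [ne_of_scope hΓ hr hy]⟩
  | var x =>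
    exact fun r hr s _ _ => ⟨_, _, .assign s r (.var x), by simp [time, Expr.cost], rfl,
      by simp [eval, Expr.eval], fun y hy => by simp [ne_of_scope hΓ hr hy]⟩
  | get a e f ihe ihf =>
    simp only [wf, Bool.and_eq_true] at he
    simp only [time, Polynomial.eval_add, Polynomial.eval_C]
    exact (ihe hΓ he.1).binary hΓ (ihf hΓ he.2) he.2
      (h := fun r => .get a (.var r) (.var (r + 1))) (fun r => rfl)
      (fun r s s' h1 h2 h3 => by simp [eval, Expr.eval, h1, h2, h3])
  | add e f ihe ihf =>
    simp only [wf, Bool.and_eq_true] at he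
    simp only [time, Polynomial.eval_add, Polynomial.eval_C]
    exact (ihe hΓ he.1).binary hΓ (ihf hΓ he.2) he.2
      (h := fun r => .add (.var r) (.var (r + 1))) (fun r => rfl)
      (fun r s s' h1 h2 h3 => by simp [eval, Expr.eval, h2, h3])
  | sub e f ihe ihf =>
    simp only [wf, Bool.and_eq_true] at he
    simp only [time, Polynomial.eval_add, Polynomial.eval_C]
    exact (ihe hΓ he.1).binary hΓ (ihf hΓ he.2) he.2
      (h := fun r => .sub (.var r) (.var (r + 1))) (fun r => rfl)
      (fun r s s' h1 h2 h3 => by simp [eval, Expr.eval, h2, h3])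
  | lt e f ihe ihf =>
    simp only [wf, Bool.and_eq_true] at he
    simp only [time, Polynomial.eval_add, Polynomial.eval_C]
    exact (ihe hΓ he.1).binary hΓ (ihf hΓ he.2) he.2
      (h := fun r => .lt (.var r) (.var (r + 1))) (fun r => rfl)
      (fun r s s' h1 h2 h3 => by simp [eval, Expr.eval, h2, h3])
  | eq e f ihe ihf =>
    simp only [wf, Bool.and_eq_true] at he
    simp only [time, Polynomial.eval_add, Polynomial.eval_C]
    exact (ihe hΓ he.1).binary hΓ (ihf hΓ he.2) he.2
      (h := fun r => .eq (.var r) (.var (r + 1))) (fun r => rfl)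
      (fun r s s' h1 h2 h3 => by simp [eval, Expr.eval, h2, h3])
  | sum x b e ih =>
    simp only [wf, Bool.and_eq_true, decide_eq_true_eq] at he
    simp only [time, Polynomial.eval_add, Polynomial.eval_mul, Polynomial.eval_X,
      Polynomial.eval_C]
    refine Computes.sum hΓ (ih (fun y hy => ?_) he.2) he.2 he.1.1.1.1 he.1.1.1.2
      he.1.1.2 he.1.2
    rcases List.mem_cons.1 hy with rfl | h
    · exact he.1.1.1.2
    · exact hΓ y h

/-- Commands: programs whose only loops are counted. In `forLoop x b P` the variable `x` runs from
`0` to the value of the variable `b` minus one. -/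
inductive Cmd where
  | skip
  | assign (x : ℕ) (e : SumExpr)
  | store (a : ℕ) (i j e : SumExpr)
  | seq (P Q : Cmd)
  | ite (c : SumExpr) (P Q : Cmd)
  | forLoop (x b : ℕ) (P : Cmd)

/-- The state after `N` rounds of a loop with counter `x` and loop body `g`. -/
def iterate (g : State → State) (x : ℕ) (u : State) : ℕ → State
  | 0 => u
  | i + 1 => g ((iterate g x u i).setReg x i)

namespace Cmd

/-- The state in which a command ends. -/
def run : Cmd → State → State
  | skip, u => u
  | assign x e, u => u.setReg x (e.eval u)
  | store a i j e, u => u.setArr a (i.eval u) (j.eval u) (e.eval u)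
  | seq P Q, u => Q.run (P.run u)
  | ite c P Q, u => if c.eval u ≠ 0 then P.run u else Q.run u
  | forLoop x b P, u => (iterate P.run x u (u.reg b)).setReg x (u.reg b)

/-- The program that carries out a command. -/
def code : Cmd → Prog
  | skip => .skip
  | assign x e => .seq (e.code 100) (.assign x (.var 100))
  | store a i j e => .seq (i.code 100) (.seq (j.code 101) (.seq (e.code 102)
      (.store a (.var 100) (.var 101) (.var 102))))
  | seq P Q => .seq P.code Q.code
  | ite c P Q => .seq (c.code 100) (.ite (.var 100) P.code Q.code)
  | forLoop x b P => .seq (.assign x (.lit 0)) (.loop (.lt (.var x) (.var b))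
      (.seq P.code (.assign x (.add (.var x) (.lit 1)))))

/-- A bound for the running time of `code`, as a polynomial in a bound for the variables `0`
and `1`. -/
noncomputable def time : Cmd → Polynomial ℕ
  | skip => .C 1
  | assign _ e => e.time + .C 2
  | store _ i j e => i.time + j.time + e.time + .C 4
  | seq P Q => P.time + Q.time
  | ite c P Q => c.time + P.time + Q.time + .C 2
  | forLoop _ _ P => .X * (P.time + .C 8) + .C 6

/-- The variables that a command may change. -/
def writes : Cmd → List ℕ
  | skip => []
  | assign x _ => [x]
  | store _ _ _ _ => []
  | seq P Q => P.writes ++ Q.writes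
  | ite _ P Q => P.writes ++ Q.writes
  | forLoop x _ P => x :: P.writes

/-- The arrays that a command may change. -/
def arrays : Cmd → List ℕ
  | skip => []
  | assign _ _ => []
  | store a _ _ _ => [a]
  | seq P Q => P.arrays ++ Q.arrays
  | ite _ P Q => P.arrays ++ Q.arrays
  | forLoop _ _ P => P.arrays

/-- Well-formedness of a command: the variables `0`, `1`, `2` are never changed, loops are bounded
by variable `0` or `1`, and loop bodies leave the loop variable alone. -/
def wf : Cmd → Bool
  | skip => true
  | assign x e => 3 ≤ x && x < 50 && e.wf []
  | store _ i j e => i.wf [] && j.wf [] && e.wf []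
  | seq P Q => P.wf && Q.wf
  | ite c P Q => c.wf [] && P.wf && Q.wf
  | forLoop x b P => 3 ≤ x && x < 50 && b < 2 && x ∉ P.writes && P.wf

theorem run_reg {c : Cmd} {y : ℕ} (hy : y ∉ c.writes) (u : State) :
    (c.run u).reg y = u.reg y := by
  induction c generalizing u with
  | skip => rfl
  | assign x e => simp_all [writes, run]
  | store a i j e => rfl
  | seq P Q ihP ihQ =>
    simp only [writes, List.mem_append, not_or] at hy
    rw [run, ihQ hy.2, ihP hy.1]
  | ite c P Q ihP ihQ =>
    simp only [writes, List.mem_append, not_or] at hy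
    rw [run]
    split_ifs
    · exact ihP hy.1 u
    · exact ihQ hy.2 u
  | forLoop x b P ih =>
    simp only [writes, List.mem_cons, not_or] at hy
    have : ∀ i, (iterate P.run x u i).reg y = u.reg y := by
      intro i
      induction i with
      | zero => rfl
      | succ i ihi => rw [iterate, ih hy.2, State.setReg_reg, if_neg hy.1, ihi]
    rw [run, State.setReg_reg, if_neg hy.1, this]

theorem run_arr {c : Cmd} {a : ℕ} (ha : a ∉ c.arrays) (u : State) :
    (c.run u).arr a = u.arr a := by
  induction c generalizing u with
  | skip | assign => rfl
  | store a' i j e =>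
    simp only [arrays, List.mem_singleton] at ha
    funext i' j'
    simp [run, State.setArr_arr, ha]
  | seq P Q ihP ihQ =>
    simp only [arrays, List.mem_append, not_or] at ha
    rw [run, ihQ ha.2, ihP ha.1]
  | ite c P Q ihP ihQ =>
    simp only [arrays, List.mem_append, not_or] at ha
    rw [run]
    split_ifs
    · exact ihP ha.1 u
    · exact ihQ ha.2 u
  | forLoop x b P ih =>
    have : ∀ i, (iterate P.run x u i).arr a = u.arr a := by
      intro i
      induction i with
      | zero => rfl
      | succ i ihi => rw [iterate, ih ha, State.setReg_arr, ihi]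
    rw [run, State.setReg_arr, this]

/-- The invariant rule for counted loops. -/
theorem run_forLoop {x b : ℕ} {P : Cmd} {u : State} (I : ℕ → State → Prop) (h0 : I 0 u)
    (hI : ∀ i < u.reg b, ∀ t, I i t → (∀ y, y ≠ x → y ∉ P.writes → t.reg y = u.reg y) →
      (∀ a, a ∉ P.arrays → t.arr a = u.arr a) → I (i + 1) (P.run (t.setReg x i))) :
    ∃ t, I (u.reg b) t ∧ (forLoop x b P).run u = t.setReg x (u.reg b) := by
  refine ⟨iterate P.run x u (u.reg b), ?_, rfl⟩
  have key : ∀ i ≤ u.reg b, I i (iterate P.run x u i) ∧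
      (∀ y, y ≠ x → y ∉ P.writes → (iterate P.run x u i).reg y = u.reg y) ∧
      (∀ a, a ∉ P.arrays → (iterate P.run x u i).arr a = u.arr a) := by
    intro i
    induction i with
    | zero => exact fun _ => ⟨h0, fun _ _ _ => rfl, fun _ _ => rfl⟩
    | succ i ih =>
      intro hi
      obtain ⟨h1, h2, h3⟩ := ih (by omega)
      refine ⟨hI i (by omega) _ h1 h2 h3, fun y hy hy' => ?_, fun a ha => ?_⟩
      · rw [iterate, run_reg hy', State.setReg_reg, if_neg hy, h2 y hy hy']
      · rw [iterate, run_arr ha, State.setReg_arr, h3 a ha]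
  exact (key _ le_rfl).1

theorem three_le_of_mem_writes {c : Cmd} (hc : c.wf) {y : ℕ} (hy : y ∈ c.writes) : 3 ≤ y := by
  induction c with
  | skip => simp [writes] at hy
  | assign x e => simp_all [writes, wf]
  | store => simp [writes] at hy
  | seq P Q ihP ihQ =>
    simp only [writes, List.mem_append, wf, Bool.and_eq_true] at hy hc
    exact hy.elim (ihP hc.1) (ihQ hc.2)
  | ite c P Q ihP ihQ =>
    simp only [writes, List.mem_append, wf, Bool.and_eq_true] at hy hc
    exact hy.elim (ihP hc.1.2) (ihQ hc.2)
  | forLoop x b P ih =>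
    simp only [writes, List.mem_cons, wf, Bool.and_eq_true, decide_eq_true_eq] at hy hc
    rcases hy with rfl | h
    · exact hc.1.1.1.1
    · exact ih hc.2 h

/-- The code of a well-formed command ends in the state given by `run`, up to intermediate results,
within the time given by `time`. -/
theorem exec_code {c : Cmd} (hc : c.wf) {B : ℕ} {s u : State} (hs : Agree [] s u)
    (h0 : u.reg 0 ≤ B) (h1 : u.reg 1 ≤ B) :
    ∃ t s', Exec c.code s t s' ∧ t ≤ c.time.eval B ∧ Agree [] s' (c.run u) := by
  have hnil : ∀ y ∈ ([] : List ℕ), y < 100 := by simp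
  induction c generalizing s u with
  | skip => exact ⟨_, _, .skip s, by simp [time], hs⟩
  | assign x e =>
    simp only [wf, Bool.and_eq_true, decide_eq_true_eq] at hc
    obtain ⟨t, s', a1, a2, a3, a4, a5⟩ := SumExpr.computes_code B hnil hc.2 100 le_rfl s
      (by rwa [hs.2 0 (by omega)]) (by rwa [hs.2 1 (by omega)])
    refine ⟨_, _, .seq a1 (.assign s' x _), ?_, a3.trans hs.1, fun y hy => ?_⟩
    · simp only [time, Expr.cost, Polynomial.eval_add, Polynomial.eval_C]
      omega
    · simp only [run, State.setReg_reg, Expr.eval, a4, SumExpr.eval_congr hc.2 hs]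
      split_ifs
      · rfl
      · rw [a5 y (Or.inl (by simpa using hy)), hs.2 y hy]
  | store a i j e =>
    simp only [wf, Bool.and_eq_true] at hc
    have r0 : s.reg 0 ≤ B := by rwa [hs.2 0 (by omega)]
    have r1 : s.reg 1 ≤ B := by rwa [hs.2 1 (by omega)]
    obtain ⟨t, s1, a1, a2, a3, a4, a5⟩ := SumExpr.computes_code B hnil hc.1.1 100 le_rfl s r0 r1
    obtain ⟨t', s2, b1, b2, b3, b4, b5⟩ := SumExpr.computes_code B hnil hc.1.2 101 (by omega) s1
      (by rwa [a5 0 (by omega)]) (by rwa [a5 1 (by omega)])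
    obtain ⟨t'', s3, c1, c2, c3, c4, c5⟩ := SumExpr.computes_code B hnil hc.2 102 (by omega) s2
      (by rwa [b5 0 (by omega), a5 0 (by omega)]) (by rwa [b5 1 (by omega), a5 1 (by omega)])
    have hs1 : Agree [] s1 u := ⟨a3.trans hs.1, fun y hy => by
      rw [a5 y (Or.inl (by simpa using hy)), hs.2 y hy]⟩
    have hs2 : Agree [] s2 u := ⟨b3.trans hs1.1, fun y hy => by
      rw [b5 y (by have := hy; simp at this; omega), hs1.2 y hy]⟩
    have hs3 : Agree [] s3 u := ⟨c3.trans hs2.1, fun y hy => by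
      rw [c5 y (by have := hy; simp at this; omega), hs2.2 y hy]⟩
    refine ⟨_, _, .seq a1 (.seq b1 (.seq c1 (.store s3 a _ _ _))), ?_, ?_, hs3.2⟩
    · simp only [time, Expr.cost, Polynomial.eval_add, Polynomial.eval_C]
      omega
    · have e1 : s3.reg 100 = i.eval u := by
        rw [c5 100 (by omega), b5 100 (by omega), a4, SumExpr.eval_congr hc.1.1 hs]
      have e2 : s3.reg 101 = j.eval u := by
        rw [c5 101 (by omega), b4, SumExpr.eval_congr hc.1.2 hs1]
      have e3 : s3.reg 102 = e.eval u := by rw [c4, SumExpr.eval_congr hc.2 hs2]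
      simp only [run, State.setArr, Expr.eval, e1, e2, e3, hs3.1]
  | seq P Q ihP ihQ =>
    simp only [wf, Bool.and_eq_true] at hc
    obtain ⟨t, s', a1, a2, a3⟩ := ihP hc.1 hs h0 h1
    have w : ∀ y < 3, (P.run u).reg y = u.reg y := fun y hy => run_reg (fun h => by
      have := three_le_of_mem_writes hc.1 h
      omega) u
    obtain ⟨t', s'', b1, b2, b3⟩ := ihQ hc.2 a3 (by rwa [w 0 (by omega)])
      (by rwa [w 1 (by omega)])
    refine ⟨_, _, .seq a1 b1, ?_, b3⟩
    simp only [time, Polynomial.eval_add]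
    omega
  | ite c P Q ihP ihQ =>
    simp only [wf, Bool.and_eq_true] at hc
    obtain ⟨t, s', a1, a2, a3, a4, a5⟩ := SumExpr.computes_code B hnil hc.1.1 100 le_rfl s
      (by rwa [hs.2 0 (by omega)]) (by rwa [hs.2 1 (by omega)])
    rw [SumExpr.eval_congr hc.1.1 hs] at a4
    have hs' : Agree [] s' u := ⟨a3.trans hs.1, fun y hy => by
      rw [a5 y (Or.inl (by simpa using hy)), hs.2 y hy]⟩
    simp only [time, run, Polynomial.eval_add, Polynomial.eval_C]
    by_cases hcu : c.eval u = 0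
    · obtain ⟨t', s'', b1, b2, b3⟩ := ihQ hc.2 hs' h0 h1
      refine ⟨_, _, .seq a1 (.ite_false (by simp [Expr.eval, a4, hcu]) b1), ?_, ?_⟩
      · simp only [Expr.cost]
        omega
      · rwa [if_neg (by simpa using hcu)]
    · obtain ⟨t', s'', b1, b2, b3⟩ := ihP hc.1.2 hs' h0 h1
      refine ⟨_, _, .seq a1 (.ite_true (by simp [Expr.eval, a4, hcu]) b1), ?_, ?_⟩
      · simp only [Expr.cost]
        omega
      · rwa [if_pos hcu]
  | forLoop x b P ih =>
    simp only [wf, Bool.and_eq_true, decide_eq_true_eq] at hc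
    obtain ⟨⟨⟨⟨hx3, hx50⟩, hb⟩, hxP⟩, hP⟩ := hc
    have hN : u.reg b ≤ B := by
      interval_cases b
      · exact h0
      · exact h1
    have w : ∀ i, ∀ y < 3, (iterate P.run x u i).reg y = u.reg y := by
      intro i y hy
      induction i with
      | zero => rfl
      | succ i ihi =>
        rw [iterate, run_reg (fun h => by have := three_le_of_mem_writes hP h; omega),
          State.setReg_reg, if_neg (by omega), ihi]
    obtain ⟨t, s', a1, a2, a3⟩ := exec_loop (c := .lt (.var x) (.var b))
      (P := .seq P.code (.assign x (.add (.var x) (.lit 1)))) (T := P.time.eval B + 4)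
      (N := u.reg b) (fun i t => Agree [] t ((iterate P.run x u i).setReg x i))
      (by
        rintro i t ht -
        have e1 : t.reg x = i := by rw [ht.2 x (by omega)]; simp
        have e2 : t.reg b = u.reg b := by
          rw [ht.2 b (by omega), State.setReg_reg, if_neg (by omega), w i b (by omega)]
        simp only [Expr.eval, e1, e2]
        split_ifs <;> simp_all)
      (by
        intro i hi t ht
        obtain ⟨t', s', b1, b2, b3⟩ := ih hP ht
          (by rw [State.setReg_reg, if_neg (by omega), w i 0 (by omega)]; exact h0)
          (by rw [State.setReg_reg, if_neg (by omega), w i 1 (by omega)]; exact h1)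
        have hx : s'.reg x = i := by
          rw [b3.2 x (by omega), run_reg hxP]
          simp
        refine ⟨_, _, .seq b1 (.assign s' x _), ?_, b3.1, fun y hy => ?_⟩
        · simp only [Expr.cost]
          omega
        · simp only [State.setReg_reg, Expr.eval, hx]
          split_ifs
          · rfl
          · exact b3.2 y hy)
      (u.reg b) 0 (by omega) (s.setReg x 0)
      ⟨hs.1, fun y hy => by
        simp only [State.setReg_reg, iterate]
        split_ifs
        · rfl
        · exact hs.2 y hy⟩
    refine ⟨_, s', .seq (.assign s x _) a1, ?_, a3⟩
    simp only [time, Expr.cost, Polynomial.eval_add, Polynomial.eval_mul, Polynomial.eval_X,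
      Polynomial.eval_C] at a2 ⊢
    have := Nat.mul_le_mul_right (P.time.eval B + 8) hN
    have h9 : u.reg b * (1 + 1 + 1 + 1 + (P.time.eval B + 4)) =
      u.reg b * (P.time.eval B + 8) := by ring
    omega

end Cmd

end RAM

/-! ### Searching for a path -/

namespace RAM

namespace SumExpr

/-- The value of `e`, read as a truth value. -/
def Holds (e : SumExpr) (u : State) : Prop := e.eval u ≠ 0

/-- Negation. -/
def not (e : SumExpr) : SumExpr := .eq e (.lit 0)

/-- Conjunction, with value `0` or `1`. -/
def and (e f : SumExpr) : SumExpr := .eq (.add e.not f.not) (.lit 0)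

/-- Implication. -/
def imp (e f : SumExpr) : SumExpr := .add e.not f

/-- Bounded existential quantification. -/
def ex (x b : ℕ) (e : SumExpr) : SumExpr := .sum x b e

/-- Bounded universal quantification. -/
def all (x b : ℕ) (e : SumExpr) : SumExpr := (SumExpr.sum x b e.not).not

/-- Bounded search: the least `x` with property `c`, or else the value of the variable `b`. It is
the number of all `y` such that no `x ≤ y` has property `c`. -/
def mu (x y b : ℕ) (c : SumExpr) : SumExpr :=
  .sum y b (ex x b (and (not (.lt (.var y) (.var x))) c)).not

@[simp] theorem holds_not {e : SumExpr} {u : State} : e.not.Holds u ↔ ¬ e.Holds u := by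
  simp only [Holds, SumExpr.not, eval]
  split_ifs <;> simp_all

@[simp] theorem holds_and {e f : SumExpr} {u : State} :
    (e.and f).Holds u ↔ e.Holds u ∧ f.Holds u := by
  simp only [Holds, SumExpr.and, SumExpr.not, eval]
  by_cases h1 : e.eval u = 0 <;> by_cases h2 : f.eval u = 0 <;> simp [h1, h2]

@[simp] theorem holds_imp {e f : SumExpr} {u : State} :
    (e.imp f).Holds u ↔ (e.Holds u → f.Holds u) := by
  simp only [Holds, imp, SumExpr.not, eval]
  split_ifs with h <;> simp [h]

@[simp] theorem holds_lt {e f : SumExpr} {u : State} :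
    (SumExpr.lt e f).Holds u ↔ e.eval u < f.eval u := by
  simp [Holds, eval]

@[simp] theorem holds_eq {e f : SumExpr} {u : State} :
    (SumExpr.eq e f).Holds u ↔ e.eval u = f.eval u := by
  simp [Holds, eval]

@[simp] theorem holds_ex {x b : ℕ} {e : SumExpr} {u : State} :
    (ex x b e).Holds u ↔ ∃ i < u.reg b, e.Holds (u.setReg x i) := by
  simp [Holds, ex, eval, sum_eq_zero_iff]

@[simp] theorem holds_all {x b : ℕ} {e : SumExpr} {u : State} :
    (all x b e).Holds u ↔ ∀ i < u.reg b, e.Holds (u.setReg x i) := by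
  have h : (all x b e).Holds u ↔ ¬ (ex x b e.not).Holds u := holds_not
  rw [h, holds_ex]
  simp

@[simp] theorem holds_get {a : ℕ} {i j : SumExpr} {u : State} :
    (SumExpr.get a i j).Holds u ↔ u.arr a (i.eval u) (j.eval u) ≠ 0 := Iff.rfl

theorem eval_and (e f : SumExpr) (u : State) [Decidable (e.Holds u ∧ f.Holds u)] :
    (e.and f).eval u = if e.Holds u ∧ f.Holds u then 1 else 0 := by
  split_ifs with h
  · simp only [Holds] at h
    simp [SumExpr.and, SumExpr.not, eval, h.1, h.2]
  · by_contra h'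
    exact h (holds_and.1 h')

/-- The variable `y` counts; it must not occur in `c`. -/
theorem eval_mu {x y b : ℕ} {c : SumExpr} {u : State} (hc : c.wf [x]) (hy : 50 ≤ y)
    (hxy : y ≠ x) (hb : b < 50) :
    ((∃ i < u.reg b, c.Holds (u.setReg x i)) → (mu x y b c).eval u < u.reg b ∧
      c.Holds (u.setReg x ((mu x y b c).eval u))) ∧
    ((¬ ∃ i < u.reg b, c.Holds (u.setReg x i)) → (mu x y b c).eval u = u.reg b) := by
  classical
  have hterm : ∀ j, ((ex x b (and (not (.lt (.var y) (.var x))) c)).not).eval (u.setReg y j) =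
      if ∃ i < u.reg b, i ≤ j ∧ c.Holds (u.setReg x i) then 0 else 1 := by
    intro j
    have hcong : ∀ i, c.Holds ((u.setReg y j).setReg x i) ↔ c.Holds (u.setReg x i) := by
      intro i
      unfold Holds
      rw [eval_congr (Γ := [x]) hc (u := u.setReg x i)]
      refine ⟨rfl, fun z hz => ?_⟩
      simp only [State.setReg_reg]
      split_ifs with h1 h2
      · rfl
      · simp only [List.mem_singleton] at hz
        omega
      · rfl
    have hex : (ex x b (and (not (.lt (.var y) (.var x))) c)).Holds (u.setReg y j) ↔
        ∃ i < u.reg b, i ≤ j ∧ c.Holds (u.setReg x i) := by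
      have hby : b ≠ y := by omega
      simp [hcong, eval, hby, hxy]
    rw [SumExpr.not, eval, eval]
    by_cases h : ∃ i < u.reg b, i ≤ j ∧ c.Holds (u.setReg x i)
    · rw [if_neg (hex.2 h), if_pos h]
    · rw [if_pos (by_contra fun h' => h (hex.1 h')), if_neg h]
  have heval : (mu x y b c).eval u = ∑ j ∈ range (u.reg b),
      if ∃ i < u.reg b, i ≤ j ∧ c.Holds (u.setReg x i) then 0 else 1 := by
    rw [mu, eval]
    exact sum_congr rfl fun j _ => hterm j
  constructor
  · intro h
    obtain ⟨h1, h2⟩ := Nat.find_spec h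
    have : (mu x y b c).eval u = Nat.find h := by
      rw [heval]
      have h3 : ∀ j ∈ range (u.reg b), (if ∃ i < u.reg b, i ≤ j ∧ c.Holds (u.setReg x i)
          then 0 else 1) = if j < Nat.find h then 1 else 0 := by
        intro j _
        by_cases hj : j < Nat.find h
        · rw [if_pos hj, if_neg]
          rintro ⟨i, hi, hij, hci⟩
          exact Nat.find_min h (lt_of_le_of_lt hij hj) ⟨hi, hci⟩
        · rw [if_neg hj, if_pos ⟨_, h1, by omega, h2⟩]
      rw [sum_congr rfl h3, ← card_filter]
      have : (range (u.reg b)).filter (· < Nat.find h) = range (Nat.find h) := by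
        ext j
        simp only [mem_filter, mem_range]
        omega
      rw [this, card_range]
    rw [this]
    exact ⟨h1, h2⟩
  · intro h
    rw [heval, sum_congr rfl (g := fun _ => 1)]
    · simp
    · intro j _
      rw [if_neg]
      rintro ⟨i, hi, -, hci⟩
      exact h ⟨i, hi, hci⟩

end SumExpr

theorem Cmd.run_assign (x : ℕ) (e : SumExpr) (u : State) :
    (Cmd.assign x e).run u = u.setReg x (e.eval u) := rfl

theorem Cmd.run_store (a : ℕ) (i j e : SumExpr) (u : State) :
    (Cmd.store a i j e).run u = u.setArr a (i.eval u) (j.eval u) (e.eval u) := rfl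

theorem Cmd.run_seq (P Q : Cmd) (u : State) : (Cmd.seq P Q).run u = Q.run (P.run u) := rfl

theorem Cmd.run_ite_pos {c : SumExpr} {P Q : Cmd} {u : State} (h : c.Holds u) :
    (Cmd.ite c P Q).run u = P.run u := if_pos h

theorem Cmd.run_ite_neg {c : SumExpr} {P Q : Cmd} {u : State} (h : ¬ c.Holds u) :
    (Cmd.ite c P Q).run u = Q.run u := if_neg h

open MultiHypergraph Orientation CutFunction SumExpr

variable {n m : ℕ} {H : MultiHypergraph (Fin n) (Fin m)} {k : ℕ}

/-- The memory holds the sizes of `H`, the number `k` and the incidence matrix of `H`. -/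
structure Encodes (H : MultiHypergraph (Fin n) (Fin m)) (k : ℕ) (u : State) : Prop where
  reg_zero : u.reg 0 = n
  reg_one : u.reg 1 = m
  reg_two : u.reg 2 = k
  arr : ∀ (e : Fin m) (v : Fin n), u.arr 0 e v = if v ∈ H.edge e then 1 else 0

theorem Encodes.congr {u t : State} (h : Encodes H k u) (h0 : t.reg 0 = u.reg 0)
    (h1 : t.reg 1 = u.reg 1) (h2 : t.reg 2 = u.reg 2) (h3 : t.arr 0 = u.arr 0) :
    Encodes H k t :=
  ⟨h0.trans h.reg_zero, h1.trans h.reg_one, h2.trans h.reg_two, fun e v => by rw [h3, h.arr]⟩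

theorem Encodes.run {c : Cmd} {u : State} (h : Encodes H k u) (hc : c.wf) (ha : 0 ∉ c.arrays) :
    Encodes H k (c.run u) := by
  have hw : ∀ y < 3, y ∉ c.writes := fun y hy hy' => by
    have := Cmd.three_le_of_mem_writes hc hy'
    omega
  exact h.congr (Cmd.run_reg (hw 0 (by omega)) u) (Cmd.run_reg (hw 1 (by omega)) u)
    (Cmd.run_reg (hw 2 (by omega)) u) (Cmd.run_arr ha u)

theorem Encodes.setReg {u : State} (h : Encodes H k u) {x : ℕ} (hx : 3 ≤ x) (v : ℕ) :
    Encodes H k (u.setReg x v) :=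
  h.congr (by rw [State.setReg_reg, if_neg (by omega)])
    (by rw [State.setReg_reg, if_neg (by omega)]) (by rw [State.setReg_reg, if_neg (by omega)]) rfl

theorem Encodes.mem_iff {u : State} (h : Encodes H k u) (e : Fin m) (v : Fin n) :
    u.arr 0 e v ≠ 0 ↔ v ∈ H.edge e := by
  rw [h.arr]
  split_ifs <;> simp_all

/-- Row `r` of array `a` lists the heads of `O`. -/
def IsRow (u : State) (a r : ℕ) (O : H.Orientation) : Prop :=
  ∀ e : Fin m, u.arr a r e = (O.head e : ℕ)

@[simp] theorem isRow_setReg {u : State} {x v a r : ℕ} {O : H.Orientation} :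
    IsRow (u.setReg x v) a r O ↔ IsRow u a r O := Iff.rfl

/-- The command that sets all entries `v < n` of row `0` of array `a` to the value of `e`, which
may depend on the variable `21`. -/
def fillRow (a : ℕ) (e : SumExpr) : Cmd := .forLoop 21 0 (.store a (.lit 0) (.var 21) e)

/-- The value of `e` must not depend on the array that is being written, nor on the variable `21`
beyond its current value. -/
theorem run_fillRow {a : ℕ} {e : SumExpr} {u : State} (hu : Encodes H k u)
    (he : ∀ (t : State) (i : ℕ), (∀ y, y ≠ 21 → t.reg y = u.reg y) →
      (∀ b, b ≠ a → t.arr b = u.arr b) → t.reg 21 = i → e.eval t = e.eval (u.setReg 21 i))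
    (v : Fin n) : ((fillRow a e).run u).arr a 0 v = e.eval (u.setReg 21 v) := by
  obtain ⟨t, h1, h2⟩ := Cmd.run_forLoop (x := 21) (b := 0)
    (P := .store a (.lit 0) (.var 21) e) (u := u)
    (fun i t => ∀ j < i, t.arr a 0 j = e.eval (u.setReg 21 j)) (fun j hj => absurd hj j.not_lt_zero)
    (by
      intro i _ t ht hreg harr j hj
      simp only [Cmd.run, State.setArr_arr, SumExpr.eval, State.setReg_reg, if_true, true_and,
        State.setReg_arr]
      split_ifs with hji
      · rw [hji]
        refine he _ _ (fun y hy => ?_) (fun b hb => ?_) ?_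
        · rw [State.setReg_reg, if_neg hy, hreg y hy (by simp [Cmd.writes])]
        · exact harr b (by simpa [Cmd.arrays] using hb)
        · simp
      · exact ht j (by omega))
  rw [fillRow, h2, State.setReg_arr]
  exact h1 v (by rw [hu.reg_zero]; exact v.2)

/-- The hyperarc `50` of the orientation in row `8` of array `A` leads from a vertex that was
reached to a vertex that was not reached but may be. -/
def extendExpr (A : ℕ) : SumExpr :=
  and (not (.get 3 (.lit 0) (.get A (.var 8) (.var 50))))
    (and (.get 5 (.lit 0) (.get A (.var 8) (.var 50)))
      (ex 52 0 (and (.get 0 (.var 50) (.var 52)) (.get 3 (.lit 0) (.var 52)))))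

/-- One step of the search: some vertex is reached, if possible. -/
def searchStep (A : ℕ) : Cmd :=
  .seq (.assign 10 (mu 50 51 1 (extendExpr A)))
    (.ite (.lt (.var 10) (.var 1))
      (.store 3 (.lit 0) (.get A (.var 8) (.var 10)) (.add (.var 12) (.lit 2))) .skip)

/-- The search in the orientation in row `8` of array `A`, from the vertex `7` and along hyperarcs
with heads in row `0` of array `5`. The levels are written into row `0` of array `3`. -/
def search (A : ℕ) : Cmd :=
  .seq (fillRow 3 (.lit 0)) (.seq (.store 3 (.lit 0) (.var 7) (.lit 1))
    (.forLoop 12 0 (searchStep A)))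

theorem exists_lt_iff {N : ℕ} {q : ℕ → Prop} : (∃ i < N, q i) ↔ ∃ i : Fin N, q i :=
  ⟨fun ⟨i, hi, h⟩ => ⟨⟨i, hi⟩, h⟩, fun ⟨i, h⟩ => ⟨i, i.2, h⟩⟩

theorem holds_extendExpr {A : ℕ} {u : State} (hu : Encodes H k u) {O : H.Orientation}
    (hO : IsRow u A (u.reg 8) O) {p : Fin n → Prop} (hp : ∀ v : Fin n, u.arr 5 0 v ≠ 0 ↔ p v)
    (e : Fin m) : (extendExpr A).Holds (u.setReg 50 e) ↔
      u.arr 3 0 (O.head e) = 0 ∧ p (O.head e) ∧ ∃ a ∈ H.edge e, 0 < u.arr 3 0 a := by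
  simp only [extendExpr, holds_and, holds_not, holds_get, holds_ex, eval, State.setReg_reg,
    State.setReg_arr]
  simp only [reduceIte, Nat.reduceEqDiff, hO e, hp, hu.reg_zero, exists_lt_iff, hu.mem_iff,
    not_not, Nat.pos_iff_ne_zero]

/-- Either a new vertex is reached, or the search is complete. -/
theorem run_searchStep {A : ℕ} {u : State} (hu : Encodes H k u) {O : H.Orientation}
    (hO : IsRow u A (u.reg 8) O) {p : Fin n → Prop} (hp : ∀ v : Fin n, u.arr 5 0 v ≠ 0 ↔ p v) :
    (∃ e, u.arr 3 0 (O.head e) = 0 ∧ p (O.head e) ∧ (∃ a ∈ H.edge e, 0 < u.arr 3 0 a) ∧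
      ∀ v : Fin n, ((searchStep A).run u).arr 3 0 v =
        if v = O.head e then u.reg 12 + 2 else u.arr 3 0 v) ∨
    ((¬ ∃ e, u.arr 3 0 (O.head e) = 0 ∧ p (O.head e) ∧ ∃ a ∈ H.edge e, 0 < u.arr 3 0 a) ∧
      ∀ v : Fin n, ((searchStep A).run u).arr 3 0 v = u.arr 3 0 v) := by
  have hwf : (extendExpr A).wf [50] := by simp [extendExpr, SumExpr.and, SumExpr.not, ex, wf]
  obtain ⟨h1, h2⟩ := eval_mu (y := 51) (b := 1) (u := u) hwf (by omega) (by omega) (by omega)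
  simp only [hu.reg_one, exists_lt_iff, holds_extendExpr hu hO hp] at h1 h2
  by_cases hex : ∃ e, u.arr 3 0 (O.head e) = 0 ∧ p (O.head e) ∧ ∃ a ∈ H.edge e, 0 < u.arr 3 0 a
  · left
    obtain ⟨h3, h4⟩ := h1 hex
    obtain ⟨e, he⟩ : ∃ e : Fin m, (mu 50 51 1 (extendExpr A)).eval u = e := ⟨⟨_, h3⟩, rfl⟩
    rw [he] at h4
    rw [holds_extendExpr hu hO hp] at h4
    refine ⟨e, h4.1, h4.2.1, h4.2.2, fun v => ?_⟩
    simp only [searchStep, Cmd.run, eval, he, State.setReg_reg]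
    simp [hu.reg_one, State.setArr_arr, hO e, Fin.ext_iff]
  · right
    refine ⟨hex, fun v => ?_⟩
    simp only [searchStep, Cmd.run, eval, h2 hex, State.setReg_reg]
    simp [hu.reg_one]

/-- Each round reaches a new vertex unless the search is complete, so `n` rounds suffice. -/
theorem run_search {A : ℕ} (hA : A ≠ 3) {u : State} (hu : Encodes H k u) {O : H.Orientation}
    (hO : IsRow u A (u.reg 8) O) {p : Fin n → Prop} (hp : ∀ v : Fin n, u.arr 5 0 v ≠ 0 ↔ p v)
    {x : Fin n} (hx : u.reg 7 = x) :
    O.IsLevel p x (fun v => ((search A).run u).arr 3 0 v) ∧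
      ∀ v : Fin n, ((search A).run u).arr 3 0 v ≤ n + 1 := by
  set u1 := (fillRow 3 (.lit 0)).run u with hu1
  have hu1' : Encodes H k u1 := hu.run (by decide) (by decide)
  have hlev1 : ∀ v : Fin n, u1.arr 3 0 v = 0 := fun v => by
    rw [hu1, run_fillRow hu (fun _ _ _ _ _ => rfl)]
    rfl
  have hreg1 : ∀ y, y ≠ 21 → u1.reg y = u.reg y := fun y hy =>
    Cmd.run_reg (by simpa [fillRow, Cmd.writes] using hy) u
  have harr1 : ∀ a, a ≠ 3 → u1.arr a = u.arr a := fun a ha =>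
    Cmd.run_arr (by simpa [fillRow, Cmd.arrays] using ha) u
  set u2 := u1.setArr 3 0 (u.reg 7) 1 with hu2
  have hlev2 : ∀ v : Fin n, u2.arr 3 0 v = if v = x then 1 else 0 := fun v => by
    rw [hu2, State.setArr_arr, hlev1, hx]
    simp [Fin.ext_iff]
  have harr2 : ∀ a, a ≠ 3 → u2.arr a = u.arr a := fun a ha => by
    rw [← harr1 a ha]
    funext i j
    simp [hu2, State.setArr_arr, ha]
  have hreg2 : ∀ y, y ≠ 21 → u2.reg y = u.reg y := hreg1
  have hrun : (search A).run u = (Cmd.forLoop 12 0 (searchStep A)).run u2 := by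
    simp only [search, Cmd.run, ← hu1, eval, hreg1 7 (by omega)]
    rfl
  obtain ⟨t, ⟨h1, h2, h3, h4, h5⟩, ht⟩ := Cmd.run_forLoop (x := 12) (b := 0)
    (P := searchStep A) (u := u2) (fun i t => t.arr 3 0 x = 1 ∧
      (∀ v : Fin n, t.arr 3 0 v = 1 → v = x) ∧
      (∀ v : Fin n, 1 < t.arr 3 0 v → p v ∧ ∃ e, O.head e = v ∧ ∃ a ∈ H.edge e,
        0 < t.arr 3 0 a ∧ t.arr 3 0 a < t.arr 3 0 v) ∧
      (∀ v : Fin n, t.arr 3 0 v ≤ i + 1) ∧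
      ((¬ ∃ e, t.arr 3 0 (O.head e) = 0 ∧ p (O.head e) ∧ ∃ a ∈ H.edge e, 0 < t.arr 3 0 a) ∨
        i + 1 ≤ (univ.filter fun v : Fin n => 0 < t.arr 3 0 v).card))
    (by
      refine ⟨by simp [hlev2], ?_, ?_, ?_, Or.inr ?_⟩
      · intro v hv
        rw [hlev2] at hv
        by_contra h
        simp [h] at hv
      · intro v hv
        rw [hlev2] at hv
        split_ifs at hv <;> omega
      · intro v
        rw [hlev2]
        split_ifs <;> omega
      · exact card_pos.2 ⟨x, by simp [hlev2]⟩)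
    (by
      rintro i hi t ⟨g1, g2, g3, g4, g5⟩ hreg harr
      have hreg' : ∀ y, y ≠ 12 → y ≠ 10 → y ≠ 21 → t.reg y = u.reg y := fun y hy hy' hy'' =>
        (hreg y hy (by simp [searchStep, Cmd.writes, hy'])).trans (hreg2 y hy'')
      have harr' : ∀ a, a ≠ 3 → t.arr a = u.arr a := fun a ha =>
        (harr a (by simp [searchStep, Cmd.arrays, ha])).trans (harr2 a ha)
      have ht : Encodes H k (t.setReg 12 i) :=
        (hu.congr (hreg' 0 (by omega) (by omega) (by omega))
          (hreg' 1 (by omega) (by omega) (by omega)) (hreg' 2 (by omega) (by omega) (by omega))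
          (harr' 0 (by omega))).setReg (by omega) i
      have hOt : IsRow (t.setReg 12 i) A ((t.setReg 12 i).reg 8) O := by
        intro e
        rw [State.setReg_reg, if_neg (by omega), hreg' 8 (by omega) (by omega) (by omega),
          State.setReg_arr, harr' A hA, hO e]
      have hpt : ∀ v : Fin n, (t.setReg 12 i).arr 5 0 v ≠ 0 ↔ p v := by
        intro v
        rw [State.setReg_arr, harr' 5 (by omega), hp]
      rcases run_searchStep ht hOt hpt with ⟨e, q1, q2, ⟨a, ha, ha0⟩, q4⟩ | ⟨q1, q2⟩
      · simp only [State.setReg_arr, State.setReg_reg, if_true] at q1 ha0 q4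
        have hold : ∀ v : Fin n, 0 < t.arr 3 0 v →
            ((searchStep A).run (t.setReg 12 i)).arr 3 0 v = t.arr 3 0 v := by
          intro v hv
          rw [q4, if_neg]
          rintro rfl
          omega
        refine ⟨by rw [hold x (by omega), g1], ?_, ?_, ?_, Or.inr ?_⟩
        · intro v hv
          rw [q4] at hv
          split_ifs at hv
          · omega
          · exact g2 v hv
        · intro v hv
          rw [q4] at hv
          rw [q4 v]
          split_ifs at hv ⊢ with hve
          · refine ⟨hve ▸ q2, e, hve.symm, a, ha, ?_⟩
            rw [hold a ha0]
            have := g4 a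
            omega
          · obtain ⟨r1, e', r2, a', r3, r4, r5⟩ := g3 v hv
            exact ⟨r1, e', r2, a', r3, by rw [hold a' r4]; exact ⟨r4, r5⟩⟩
        · intro v
          rw [q4]
          have := g4 v
          split_ifs <;> omega
        · have g5 := g5.resolve_left fun h => h ⟨e, q1, q2, a, ha, ha0⟩
          have : insert (O.head e) (univ.filter fun v : Fin n => 0 < t.arr 3 0 v) ⊆
              univ.filter fun v : Fin n =>
                0 < ((searchStep A).run (t.setReg 12 i)).arr 3 0 v := by
            intro v hv
            rw [mem_insert, mem_filter] at hv
            rw [mem_filter]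
            refine ⟨mem_univ v, ?_⟩
            rcases hv with rfl | hv
            · rw [q4, if_pos rfl]
              omega
            · rw [hold v hv.2]
              exact hv.2
          have h6 := card_le_card this
          rw [card_insert_of_notMem (by simp [q1])] at h6
          omega
      · simp only [State.setReg_arr] at q1 q2
        simp only [q2]
        exact ⟨g1, g2, g3, fun v => (g4 v).trans (by omega), Or.inl q1⟩)
  have hn : u2.reg 0 = n := (hreg2 0 (by omega)).trans hu.reg_zero
  rw [hn] at h4 h5
  have h5 := h5.resolve_right fun h => by
    have := card_le_univ (univ.filter fun v : Fin n => 0 < t.arr 3 0 v)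
    rw [Fintype.card_fin] at this
    omega
  rw [hrun, ht]
  simp only [State.setReg_arr]
  refine ⟨⟨h1, h2, h3, fun e a ha ha0 hpe => ?_⟩, h4⟩
  by_contra h
  exact h5 ⟨e, by omega, hpe, a, ha, ha0⟩

end RAM

/-! ### Walking along a path -/

namespace RAM

open MultiHypergraph Orientation CutFunction SumExpr

variable {n m : ℕ} {H : MultiHypergraph (Fin n) (Fin m)} {k : ℕ}

/-- The vertex `a` lies in the hyperedge `e` and has positive level below that of the vertex `9`. -/
def lowerExpr (e a : SumExpr) : SumExpr :=
  and (.get 0 e a) (and (.get 3 (.lit 0) a)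
    (.lt (.get 3 (.lit 0) a) (.get 3 (.lit 0) (.var 9))))

/-- The hyperarc `50` has head `9` and a tail vertex of lower level. -/
def arcExpr (A : ℕ) : SumExpr :=
  and (.eq (.get A (.var 8) (.var 50)) (.var 9)) (ex 52 0 (lowerExpr (.var 50) (.var 52)))

/-- The command that copies row `8` of array `A` into the next row. -/
def copyRow (A : ℕ) : Cmd :=
  .forLoop 13 1 (.store A (.add (.var 8) (.lit 1)) (.var 13) (.get A (.var 8) (.var 13)))

/-- One step of the walk: the row is copied, a hyperarc into the vertex `9` is turned to a tail
vertex of lower level, and this vertex takes the place of the vertex `9`. -/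
def walkStep (A : ℕ) : Cmd :=
  .seq (.assign 10 (mu 50 51 1 (arcExpr A)))
    (.seq (.assign 11 (mu 50 51 0 (lowerExpr (.var 10) (.var 50))))
    (.seq (copyRow A)
    (.seq (.store A (.add (.var 8) (.lit 1)) (.var 10) (.var 11))
    (.seq (.assign 8 (.add (.var 8) (.lit 1))) (.assign 9 (.var 11))))))

/-- The walk from the vertex `9` down to level one. Each step adds a row to the array `A`. -/
def walk (A : ℕ) : Cmd :=
  .forLoop 12 0 (.ite (.lt (.lit 1) (.get 3 (.lit 0) (.var 9))) (walkStep A) .skip)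

theorem run_copyRow {A : ℕ} {u : State} (hu : Encodes H k u) (r j : ℕ) :
    ((copyRow A).run u).arr A r j =
      if r = u.reg 8 + 1 ∧ j < m then u.arr A (u.reg 8) j else u.arr A r j := by
  obtain ⟨t, h1, h2⟩ := Cmd.run_forLoop (x := 13) (b := 1)
    (P := .store A (.add (.var 8) (.lit 1)) (.var 13) (.get A (.var 8) (.var 13))) (u := u)
    (fun i t => ∀ r j, t.arr A r j =
      if r = u.reg 8 + 1 ∧ j < i then u.arr A (u.reg 8) j else u.arr A r j)
    (fun r j => by simp)
    (by
      intro i _ t ht hreg _ r j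
      have h8 : t.reg 8 = u.reg 8 := hreg 8 (by omega) (by simp [Cmd.writes])
      simp only [Cmd.run, State.setArr_arr, SumExpr.eval, State.setReg_reg, State.setReg_arr,
        h8, ht]
      simp only [reduceIte, Nat.reduceEqDiff, true_and]
      by_cases hr : r = u.reg 8 + 1
      · by_cases hj : j = i
        · simp [hr, hj]
        · simp only [hr, hj, true_and, and_false, if_false]
          refine if_congr ?_ rfl rfl
          omega
      · simp [hr])
  rw [copyRow, h2, State.setReg_arr, h1, hu.reg_one]

theorem holds_lowerExpr {u : State} (hu : Encodes H k u) {i j : SumExpr} {e : Fin m} {a c : Fin n}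
    (hi : i.eval u = e) (hj : j.eval u = a) (hc : u.reg 9 = c) : (lowerExpr i j).Holds u ↔
      a ∈ H.edge e ∧ 0 < u.arr 3 0 a ∧ u.arr 3 0 a < u.arr 3 0 c := by
  simp only [lowerExpr, holds_and, holds_get, holds_lt, eval, hi, hj, hc, hu.mem_iff,
    Nat.pos_iff_ne_zero]

/-- If the current vertex `c` has a hyperarc from a vertex of lower level, then one such hyperarc is
turned, and rows up to the old one are kept. -/
theorem run_walkStep {A : ℕ} {u : State} (hu : Encodes H k u)
    {O : H.Orientation} (hO : IsRow u A (u.reg 8) O) {c : Fin n} (hc : u.reg 9 = c)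
    (hex : ∃ e, O.head e = c ∧ ∃ a ∈ H.edge e, 0 < u.arr 3 0 a ∧ u.arr 3 0 a < u.arr 3 0 c) :
    ∃ (e : Fin m) (a : Fin n) (O' : H.Orientation), O.head e = c ∧ a ∈ H.edge e ∧
      0 < u.arr 3 0 a ∧ u.arr 3 0 a < u.arr 3 0 c ∧ O'.head = Function.update O.head e a ∧
      ((walkStep A).run u).reg 8 = u.reg 8 + 1 ∧ ((walkStep A).run u).reg 9 = a ∧
      IsRow ((walkStep A).run u) A (u.reg 8 + 1) O' ∧
      ∀ r ≤ u.reg 8, ((walkStep A).run u).arr A r = u.arr A r := by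
  have hwf : (arcExpr A).wf [50] := by
    simp [arcExpr, lowerExpr, SumExpr.and, SumExpr.not, ex, wf]
  have hwf' : (lowerExpr (.var 10) (.var 50)).wf [50] := by
    simp [lowerExpr, SumExpr.and, SumExpr.not, wf]
  obtain ⟨h1, -⟩ := eval_mu (y := 51) (b := 1) (u := u) hwf (by omega) (by omega) (by omega)
  have hholds : ∀ e : Fin m, (arcExpr A).Holds (u.setReg 50 e) ↔
      O.head e = c ∧ ∃ a ∈ H.edge e, 0 < u.arr 3 0 a ∧ u.arr 3 0 a < u.arr 3 0 c := by
    intro e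
    simp only [arcExpr, holds_and, holds_eq, holds_ex, eval, State.setReg_reg, State.setReg_arr]
    simp only [reduceIte, Nat.reduceEqDiff, hO e, hc, hu.reg_zero, exists_lt_iff, Fin.val_inj]
    refine and_congr_right fun _ => exists_congr fun a => ?_
    rw [holds_lowerExpr (((hu.setReg (by omega) _).setReg (by omega) _)) (e := e) (a := a)
      (c := c) (by simp [eval]) (by simp [eval]) (by simp [hc])]
    rfl
  simp only [hu.reg_one, exists_lt_iff, hholds] at h1
  obtain ⟨h3, h4⟩ := h1 hex
  obtain ⟨e, he⟩ : ∃ e : Fin m, (mu 50 51 1 (arcExpr A)).eval u = e := ⟨⟨_, h3⟩, rfl⟩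
  rw [he, hholds] at h4
  obtain ⟨h4, h5⟩ := h4
  set u1 := u.setReg 10 e with hu1
  have hu1' : Encodes H k u1 := hu.setReg (by omega) _
  obtain ⟨h6, -⟩ := eval_mu (y := 51) (b := 0) (u := u1) hwf' (by omega) (by omega) (by omega)
  have hholds' : ∀ a : Fin n, (lowerExpr (.var 10) (.var 50)).Holds (u1.setReg 50 a) ↔
      a ∈ H.edge e ∧ 0 < u.arr 3 0 a ∧ u.arr 3 0 a < u.arr 3 0 c := by
    intro a
    rw [holds_lowerExpr (hu1'.setReg (by omega) _) (e := e) (a := a) (c := c)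
      (by simp [eval, hu1]) (by simp [eval]) (by simp [hc, hu1])]
    rfl
  simp only [hu1'.reg_zero, exists_lt_iff, hholds'] at h6
  obtain ⟨h7, h8⟩ := h6 h5
  obtain ⟨a, ha⟩ : ∃ a : Fin n, (mu 50 51 0 (lowerExpr (.var 10) (.var 50))).eval u1 = a :=
    ⟨⟨_, h7⟩, rfl⟩
  rw [ha, hholds'] at h8
  obtain ⟨h8, h9, h10⟩ := h8
  set u2 := u1.setReg 11 a with hu2
  have hu2' : Encodes H k u2 := hu1'.setReg (by omega) _
  set u3 := (copyRow A).run u2 with hu3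
  have hreg3 : ∀ y, y ≠ 13 → u3.reg y = u2.reg y := fun y hy =>
    Cmd.run_reg (by simpa [copyRow, Cmd.writes] using hy) u2
  have harr3 : ∀ r j, u3.arr A r j =
      if r = u.reg 8 + 1 ∧ j < m then u.arr A (u.reg 8) j else u.arr A r j := fun r j => by
    rw [hu3, run_copyRow hu2']
    simp [hu2, hu1]
  have hrun : (walkStep A).run u = ((u3.setArr A (u.reg 8 + 1) e a).setReg 8
      (u.reg 8 + 1)).setReg 9 a := by
    simp only [walkStep, Cmd.run, he, ← hu1, ha, ← hu2, ← hu3, eval, State.setReg_reg,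
      State.setArr_reg, hreg3 8 (by omega), hreg3 10 (by omega), hreg3 11 (by omega)]
    simp [hu2, hu1]
  have hO'mem : ∀ e', Function.update O.head e a e' ∈ H.edge e' := by
    intro e'
    by_cases hee : e' = e
    · subst hee
      simpa using h8
    · simpa [hee] using O.head_mem e'
  refine ⟨e, a, ⟨_, hO'mem⟩, h4, h8, h9, h10, rfl, ?_, ?_, ?_, ?_⟩
  · rw [hrun]
    simp
  · rw [hrun]
    simp
  · intro e'
    rw [hrun]
    simp only [State.setReg_arr, State.setArr_arr, harr3, true_and, e'.2, and_true, if_true,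
      Fin.val_inj, Function.update_apply, hO e']
    split_ifs <;> rfl
  · intro r hr
    rw [hrun]
    funext j
    have : r ≠ u.reg 8 + 1 := by omega
    simp [State.setArr_arr, harr3, this]

/-- Rows `r, …, r + ℓ` of array `A` list a sequence of orientations, each of which arises from the
previous one by a single reorientation. -/
structure IsTrace (u : State) (A r ℓ : ℕ) (seq : ℕ → H.Orientation) : Prop where
  row : ∀ i ≤ ℓ, IsRow u A (r + i) (seq i)
  step : ∀ i < ℓ, (seq i).IsReorientation (seq (i + 1))

/-- Two traces such that the second starts where the first ends. -/
theorem IsTrace.append {u : State} {A r ℓ ℓ' : ℕ} {seq seq' : ℕ → H.Orientation}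
    (h : IsTrace u A r ℓ seq) (h' : IsTrace u A (r + ℓ) ℓ' seq') (h0 : seq' 0 = seq ℓ) :
    IsTrace u A r (ℓ + ℓ') (fun i => if i ≤ ℓ then seq i else seq' (i - ℓ)) where
  row i hi := by
    split_ifs with hiℓ
    · exact h.row i hiℓ
    · have := h'.row (i - ℓ) (by omega)
      rwa [show r + ℓ + (i - ℓ) = r + i by omega] at this
  step i hi := by
    rcases lt_trichotomy i ℓ with hiℓ | rfl | hiℓ
    · rw [if_pos (by omega), if_pos (by omega)]
      exact h.step i hiℓ
    · rw [if_pos le_rfl, if_neg (by omega), ← h0, show i + 1 - i = 0 + 1 by omega]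
      exact h'.step 0 (by omega)
    · rw [if_neg (by omega), if_neg (by omega), show i + 1 - ℓ = i - ℓ + 1 by omega]
      exact h'.step (i - ℓ) (by omega)

theorem IsTrace.congr {u t : State} {A r ℓ : ℕ} {seq : ℕ → H.Orientation}
    (h : IsTrace u A r ℓ seq) (hut : ∀ i ≤ r + ℓ, t.arr A i = u.arr A i) :
    IsTrace t A r ℓ seq where
  row i hi e := by rw [hut (r + i) (by omega)]; exact h.row i hi e
  step := h.step

/-- The level of the current vertex is at most `n + 1` and decreases in each round, so the walk
arrives at the source `x` within `n` rounds. -/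
theorem run_walk {A : ℕ} (hA : A ≠ 0) (hA' : A ≠ 3) {u : State} (hu : Encodes H k u)
    {O : H.Orientation} (hO : IsRow u A (u.reg 8) O) {p : Fin n → Prop} {x w : Fin n}
    {lev : Fin n → ℕ} (hlev : O.IsLevel p x lev) (hlevu : ∀ v : Fin n, u.arr 3 0 v = lev v)
    (hle : ∀ v, lev v ≤ n + 1) (hw : u.reg 9 = w) (hw0 : 0 < lev w) :
    ∃ ℓ ≤ n, ∃ seq : ℕ → H.Orientation, seq 0 = O ∧
      IsTrace ((walk A).run u) A (u.reg 8) ℓ seq ∧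
      (∀ i ≤ ℓ, ∃ c, WalkInv O lev w (seq i) c) ∧ WalkInv O lev w (seq ℓ) x ∧
      ((walk A).run u).reg 8 = u.reg 8 + ℓ ∧
      ∀ r ≤ u.reg 8, ((walk A).run u).arr A r = u.arr A r := by
  obtain ⟨t, ⟨ℓ, h1, seq, h2, h3, h4, ⟨c, h5, h6, h7⟩, h8, h9⟩, ht⟩ :=
    Cmd.run_forLoop (x := 12) (b := 0)
    (P := .ite (.lt (.lit 1) (.get 3 (.lit 0) (.var 9))) (walkStep A) .skip) (u := u)
    (fun i t => ∃ ℓ ≤ i, ∃ seq : ℕ → H.Orientation, seq 0 = O ∧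
      IsTrace t A (u.reg 8) ℓ seq ∧ (∀ i ≤ ℓ, ∃ c, WalkInv O lev w (seq i) c) ∧
      (∃ c : Fin n, t.reg 9 = c ∧ WalkInv O lev w (seq ℓ) c ∧ (lev c ≤ 1 ∨ lev c + i ≤ n + 1)) ∧
      t.reg 8 = u.reg 8 + ℓ ∧ ∀ r ≤ u.reg 8, t.arr A r = u.arr A r)
    ⟨0, le_rfl, fun _ => O, rfl, ⟨fun i hi => by simpa [Nat.le_zero.1 hi] using hO,
      fun i hi => absurd hi i.not_lt_zero⟩, fun _ _ => ⟨w, .refl O hw0⟩,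
      ⟨w, hw, .refl O hw0, Or.inr (hle w)⟩, rfl, fun _ _ => rfl⟩
    (by
      rintro i hi t ⟨ℓ, h1, seq, h2, h3, h4, ⟨c, h5, h6, h7⟩, h8, h9⟩ hreg harr
      have hwr : ∀ y, y ∉ [8, 9, 10, 11, 12, 13] → t.reg y = u.reg y := fun y hy => by
        simp only [List.mem_cons, List.not_mem_nil, or_false, not_or] at hy
        exact hreg y hy.2.2.2.2.1 (by simp [walkStep, copyRow, Cmd.writes, hy])
      have harr' : ∀ a, a ≠ A → t.arr a = u.arr a := fun a ha =>
        harr a (by simp [walkStep, copyRow, Cmd.arrays, ha])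
      have htE : Encodes H k (t.setReg 12 i) :=
        (hu.congr (hwr 0 (by simp)) (hwr 1 (by simp)) (hwr 2 (by simp))
          (harr' 0 hA.symm)).setReg (by omega) i
      have hlevt : ∀ v : Fin n, t.arr 3 0 v = lev v := fun v => by
        rw [harr' 3 hA'.symm, hlevu]
      have hcond : (SumExpr.lt (.lit 1) (.get 3 (.lit 0) (.var 9))).Holds (t.setReg 12 i) ↔
          1 < lev c := by
        simp [eval, h5, hlevt]
      by_cases hc : 1 < lev c
      · rw [Cmd.run_ite_pos (hcond.2 hc)]
        have hrow : IsRow (t.setReg 12 i) A ((t.setReg 12 i).reg 8) (seq ℓ) := by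
          rw [State.setReg_reg, if_neg (by omega), h8]
          exact h3.row ℓ le_rfl
        obtain ⟨e, a, O', g1, g2, g3, g4, g5, g6, g7, g8, g9⟩ := run_walkStep htE hrow
          (c := c) (by simpa using h5)
          (by simpa only [State.setReg_arr, hlevt] using h6.exists_arc hlev hc)
        simp only [State.setReg_arr, State.setReg_reg, hlevt] at g3 g4 g6 g8 g9
        rw [if_neg (by omega), h8] at g6 g8 g9
        obtain ⟨q1, q2⟩ := h6.step g1 g2 g3 g4 g5
        have hT := (h3.congr (t := (walkStep A).run (t.setReg 12 i)) g9).append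
          (ℓ' := 1) (seq' := fun i => if i = 0 then seq ℓ else O')
          ⟨fun i hi e => by
            rcases Nat.le_one_iff_eq_zero_or_eq_one.1 hi with rfl | rfl
            · rw [add_zero, g9 _ le_rfl]
              exact h3.row ℓ le_rfl e
            · exact g8 e,
          fun i hi => by
            obtain rfl : i = 0 := by omega
            simpa using q1⟩ (by simp)
        refine ⟨ℓ + 1, by omega, _, ?_, hT, ?_, ⟨a, g7, ?_, ?_⟩, by omega, ?_⟩
        · simpa using h2
        · intro j hj
          split_ifs with hjℓ hj0
          · exact h4 j hjℓ
          · omega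
          · exact ⟨a, q2⟩
        · simpa using q2
        · have : lev a < lev c := g4
          omega
        · intro r hr
          rw [g9 r (by omega), h9 r hr]
      · rw [Cmd.run_ite_neg (fun h => hc (hcond.1 h)), Cmd.run]
        exact ⟨ℓ, by omega, seq, h2, h3.congr fun _ _ => rfl, h4,
          ⟨c, by simpa using h5, h6, Or.inl (by omega)⟩, by simpa using h8, h9⟩)
  rw [hu.reg_zero] at h1 h7
  have hcx : c = x := hlev.eq_source c (by have := h6.pos; omega)
  subst hcx
  rw [walk, ht]
  refine ⟨ℓ, h1, seq, h2, h3.congr fun _ _ => rfl, h4, h6, by simpa using h8, h9⟩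

end RAM

/-! ### Pairs of vertices separated by an in-tight set -/

namespace MultiHypergraph
namespace Orientation

open CutFunction

variable {V E : Type*} [Fintype V] [DecidableEq V] [Fintype E] [DecidableEq E]
  {H : MultiHypergraph V E} {O : H.Orientation}

/-- No hyperarc enters the set of vertices that are not reached. -/
theorem IsLevel.inDegree_unreached {x : V} {lev : V → ℕ}
    (h : O.IsLevel (fun _ => True) x lev) :
    O.inDegree (univ.filter fun v => lev v = 0) = 0 := by
  unfold inDegree
  rw [card_eq_zero, filter_eq_empty_iff]
  rintro e - ⟨h1, h2⟩
  obtain ⟨a, ha, ha'⟩ := not_subset.1 h2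
  simp only [mem_filter, mem_univ, true_and] at h1 ha'
  have := h.closed e a ha (Nat.pos_of_ne_zero ha') trivial
  omega

/-- A set that no hyperarc enters contains no vertex that is reached from outside. -/
theorem IsLevel.notMem_of_inDegree_eq_zero {p : V → Prop} {x : V} {lev : V → ℕ}
    (h : O.IsLevel p x lev) {X : Finset V} (hx : x ∉ X) (hX : O.inDegree X = 0) {v : V}
    (hv : 0 < lev v) : v ∉ X := by
  induction hl : lev v using Nat.strong_induction_on generalizing v with
  | _ l ih =>
    intro hvX
    rcases (Nat.succ_le_of_lt hv).eq_or_lt with h1 | h1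
    · exact hx (h.eq_source v h1.symm ▸ hvX)
    · obtain ⟨-, e, he, a, ha, ha0, hav⟩ := h.pred v h1
      have ha' := ih (lev a) (hl ▸ hav) ha0 rfl
      unfold inDegree at hX
      rw [card_eq_zero, filter_eq_empty_iff] at hX
      exact hX (mem_univ e) ⟨he.symm ▸ hvX, fun h => ha' (h ha)⟩

theorem inDegree_le_card (O : H.Orientation) (X : Finset V) : O.inDegree X ≤ Fintype.card E :=
  card_le_univ _

end Orientation
end MultiHypergraph

namespace RAM

open MultiHypergraph Orientation CutFunction SumExpr

variable {n m : ℕ} {H : MultiHypergraph (Fin n) (Fin m)} {k : ℕ}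

/-- A head is transferred from the vertex `15` to the vertex `7` in the orientation in row `8` of
array `2`, provided that the former can be reached from the latter. The number `8` of the current
row is increased by the length of the path. -/
def flowStep : Cmd :=
  .seq (search 2) (.ite (.get 3 (.lit 0) (.var 15)) (.seq (.assign 9 (.var 15)) (walk 2)) .skip)

/-- Row `20` of array `1` is copied into row `0` of array `2`. -/
def copyScratch : Cmd :=
  .forLoop 13 1 (.store 2 (.lit 0) (.var 13) (.get 1 (.var 20) (.var 13)))

/-- For the orientation in row `20` of array `1`, as many as `k` heads are transferred from the
vertex `15` to the vertex `14` on a copy. The pair is separated by an in-tight set around the vertex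
`15` if and only if this vertex can no longer be reached from the vertex `14`. -/
def flowPair : Cmd :=
  .seq (.assign 8 (.lit 0)) (.seq copyScratch (.seq (.assign 7 (.var 14))
    (.seq (.forLoop 16 1 (.ite (.lt (.var 16) (.var 2)) flowStep .skip))
    (.seq (search 2) (.store 4 (.var 14) (.var 15) (.not (.get 3 (.lit 0) (.var 15))))))))

/-- The command that finds for the orientation in row `20` of array `1` the pairs of vertices that
are separated by an in-tight set. -/
def tightTable : Cmd :=
  .seq (fillRow 5 (.lit 1)) (.forLoop 14 0 (.forLoop 15 0 flowPair))

theorem run_copyScratch {u : State} (hu : Encodes H k u) {O : H.Orientation}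
    (hO : IsRow u 1 (u.reg 20) O) : IsRow (copyScratch.run u) 2 0 O := by
  obtain ⟨t, h1, h2⟩ := Cmd.run_forLoop (x := 13) (b := 1)
    (P := .store 2 (.lit 0) (.var 13) (.get 1 (.var 20) (.var 13))) (u := u)
    (fun i t => ∀ e : Fin m, (e : ℕ) < i → t.arr 2 0 e = (O.head e : ℕ))
    (fun e he => absurd he (Nat.not_lt_zero _))
    (by
      intro i _ t ht hreg harr e he
      have h20 : t.reg 20 = u.reg 20 := hreg 20 (by omega) (by simp [Cmd.writes])
      have h1 : t.arr 1 = u.arr 1 := harr 1 (by simp [Cmd.arrays])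
      simp only [Cmd.run, State.setArr_arr, SumExpr.eval, State.setReg_reg, State.setReg_arr, h1]
      by_cases hei : (e : ℕ) = i
      · simp [h20, ← hei, hO e]
      · simp only [reduceIte, true_and, hei, if_false]
        exact ht e (by omega))
  intro e
  rw [copyScratch, h2, State.setReg_arr]
  exact h1 e (by rw [hu.reg_one]; exact e.2)

/-- Either a head is transferred, or some set around `b` but not `a` is entered by no hyperarc. -/
theorem run_flowStep {u : State} (hu : Encodes H k u) {O : H.Orientation}
    (hO : IsRow u 2 (u.reg 8) O) (hmask : ∀ v : Fin n, u.arr 5 0 v ≠ 0) {a b : Fin n}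
    (ha : u.reg 7 = a) (hb : u.reg 15 = b) :
    (∃ O' : H.Orientation, IsRow (flowStep.run u) 2 ((flowStep.run u).reg 8) O' ∧
      IsTransfer O.inDegree O'.inDegree b a) ∨
    ∃ X : Finset (Fin n), b ∈ X ∧ a ∉ X ∧ O.inDegree X = 0 := by
  obtain ⟨hlev, hle⟩ := run_search (A := 2) (by omega) hu hO (p := fun _ => True)
    (by simpa using hmask) ha
  have hreg : ∀ y, y ∉ (search 2).writes → ((search 2).run u).reg y = u.reg y := fun y hy =>
    Cmd.run_reg hy u
  have harr : ∀ a, a ∉ (search 2).arrays → ((search 2).run u).arr a = u.arr a := fun y hy =>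
    Cmd.run_arr hy u
  set u1 := (search 2).run u with hu1
  have hu1' : Encodes H k u1 := hu.run (by decide) (by decide)
  by_cases hb0 : u1.arr 3 0 b = 0
  · refine Or.inr ⟨_, ?_, ?_, hlev.inDegree_unreached⟩
    · simpa using hb0
    · simp [hlev.source]
  · left
    have hcond : (SumExpr.get 3 (.lit 0) (.var 15)).Holds u1 := by
      simpa [eval, hreg 15 (by decide), hb] using hb0
    have hrow : IsRow (u1.setReg 9 b) 2 ((u1.setReg 9 b).reg 8) O := by
      intro e
      rw [State.setReg_reg, if_neg (by omega), hreg 8 (by decide), State.setReg_arr,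
        harr 2 (by decide), hO e]
    obtain ⟨ℓ, -, seq, -, h2, -, h4, h5, -⟩ := run_walk (A := 2) (by omega) (by omega)
      (hu1'.setReg (x := 9) (by omega) b) hrow hlev (fun _ => rfl) hle
      (by simp) (Nat.pos_of_ne_zero hb0)
    refine ⟨seq ℓ, ?_, h4.transfer⟩
    have hrun : flowStep.run u = (walk 2).run (u1.setReg 9 b) := by
      rw [flowStep, Cmd.run, ← hu1, Cmd.run_ite_pos hcond]
      simp only [Cmd.run, eval, hreg 15 (by decide), hb]
    rw [hrun, h5]
    exact h2.row ℓ le_rfl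

/-- After `i ≤ k` transfers, the in-degrees of the sets around `b` but not `a` are smaller by `i`.
The tight ones among these sets have in-degree zero in the end, and such a set exists if and only if
`b` cannot be reached from `a`. -/
theorem run_flowPair {u : State} (hu : Encodes H k u) {O : H.Orientation}
    (hO : IsRow u 1 (u.reg 20) O) (hmask : ∀ v : Fin n, u.arr 5 0 v ≠ 0) {a b : Fin n}
    (ha : u.reg 14 = a) (hb : u.reg 15 = b) (hk : O.IsHyperarcConnected k) :
    ((flowPair.run u).arr 4 a b ≠ 0 ↔ ∃ X, InTight O.inDegree k X ∧ b ∈ X ∧ a ∉ X) ∧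
      ∀ c d : Fin n, (c ≠ a ∨ d ≠ b) → (flowPair.run u).arr 4 c d = u.arr 4 c d := by
  rw [isHyperarcConnected_iff] at hk
  have hk' : ∀ X : Finset (Fin n), b ∈ X → a ∉ X → k ≤ O.inDegree X := fun X h1 h2 =>
    hk X ⟨b, h1⟩ fun h => h2 (h ▸ mem_univ a)
  set u1 := u.setReg 8 0 with hu1
  have hu1' : Encodes H k u1 := hu.setReg (by omega) _
  have hrow2 : IsRow (copyScratch.run u1) 2 0 O := run_copyScratch hu1' (by simpa [hu1] using hO)
  have hreg2 : ∀ y, y ∉ [8, 13] → (copyScratch.run u1).reg y = u.reg y := fun y hy => by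
    simp only [List.mem_cons, List.not_mem_nil, or_false, not_or] at hy
    rw [Cmd.run_reg (by simp [copyScratch, Cmd.writes, hy]), hu1, State.setReg_reg, if_neg hy.1]
  have h28 : (copyScratch.run u1).reg 8 = 0 := by
    rw [Cmd.run_reg (by decide), hu1]
    simp
  have harr2 : ∀ a, a ≠ 2 → (copyScratch.run u1).arr a = u.arr a := fun a ha =>
    Cmd.run_arr (by simpa [copyScratch, Cmd.arrays] using ha) u1
  have hu2' : Encodes H k (copyScratch.run u1) := hu1'.run (by decide) (by decide)
  set u2 := copyScratch.run u1 with hu2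
  set u3 := u2.setReg 7 a with hu3
  have hu3' : Encodes H k u3 := hu2'.setReg (by omega) _
  obtain ⟨t, ⟨O', h1, h2⟩, ht⟩ := Cmd.run_forLoop (x := 16) (b := 1)
    (P := .ite (.lt (.var 16) (.var 2)) flowStep .skip) (u := u3)
    (fun i t => ∃ O' : H.Orientation, IsRow t 2 (t.reg 8) O' ∧ ∀ X : Finset (Fin n),
      O'.inDegree X + (if b ∈ X then min i k else 0) =
        O.inDegree X + if a ∈ X then min i k else 0)
    ⟨O, by simpa [hu3, h28] using hrow2, fun X => by simp⟩
    (by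
      rintro i hi t ⟨O', h1, h2⟩ hreg harr
      have ht : Encodes H k t := hu3'.congr (hreg 0 (by decide) (by decide))
        (hreg 1 (by decide) (by decide)) (hreg 2 (by decide) (by decide)) (harr 0 (by decide))
      have hcond : (SumExpr.lt (.var 16) (.var 2)).Holds (t.setReg 16 i) ↔ i < k := by
        simp [eval, ht.reg_two]
      by_cases hik : i < k
      · rw [Cmd.run_ite_pos (hcond.2 hik)]
        have h7 : (t.setReg 16 i).reg 7 = a := by
          rw [State.setReg_reg, if_neg (by omega), hreg 7 (by decide) (by decide)]
          simp [hu3]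
        have h15 : (t.setReg 16 i).reg 15 = b := by
          rw [State.setReg_reg, if_neg (by omega), hreg 15 (by decide) (by decide)]
          simp [hu3, hreg2, hb]
        have hm : ∀ v : Fin n, (t.setReg 16 i).arr 5 0 v ≠ 0 := fun v => by
          rw [State.setReg_arr, harr 5 (by decide), hu3, State.setReg_arr, harr2 5 (by decide)]
          exact hmask v
        rcases run_flowStep (ht.setReg (by omega) i) (O := O') (by simpa using h1) hm h7 h15 with
          ⟨O'', h3, h4⟩ | ⟨X, h3, h4, h5⟩
        · refine ⟨O'', h3, fun X => ?_⟩
          have h5 := h2 X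
          have h6 := h4 X
          rw [min_eq_left (by omega)] at h5 ⊢
          split_ifs at h5 h6 ⊢ <;> omega
        · have h6 := h2 X
          have h7 := hk' X h3 h4
          rw [if_pos h3, if_neg h4, h5, min_eq_left hik.le] at h6
          omega
      · rw [Cmd.run_ite_neg (fun h => hik (hcond.1 h))]
        refine ⟨O', by simpa [Cmd.run] using h1, fun X => ?_⟩
        have h3 := h2 X
        rwa [min_eq_right (by omega)] at h3 ⊢)
  rw [hu3'.reg_one] at h2 ht
  -- the number of rounds, `m`, is at least `k` if there is any such set `X`
  have h2 : ∀ X : Finset (Fin n), b ∈ X → a ∉ X → O'.inDegree X + k = O.inDegree X := by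
    intro X h3 h4
    have h5 := h2 X
    have h6 := hk' X h3 h4
    have h7 := O.inDegree_le_card X
    rw [Fintype.card_fin] at h7
    rwa [if_pos h3, if_neg h4, min_eq_right (by omega), add_zero] at h5
  set P4 := Cmd.forLoop 16 1 (.ite (.lt (.var 16) (.var 2)) flowStep .skip) with hP4
  have hreg4 : ∀ y, y ∉ P4.writes → (P4.run u3).reg y = u3.reg y := fun y hy =>
    Cmd.run_reg hy u3
  have harr4 : ∀ a, a ∉ P4.arrays → (P4.run u3).arr a = u3.arr a := fun y hy =>
    Cmd.run_arr hy u3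
  have hu4' : Encodes H k (P4.run u3) := hu3'.run (by decide) (by decide)
  have h48 : (P4.run u3).reg 8 = t.reg 8 := by rw [ht, State.setReg_reg, if_neg (by omega)]
  have hrow4 : IsRow (P4.run u3) 2 ((P4.run u3).reg 8) O' := by
    intro e
    rw [h48, ht]
    exact h1 e
  set u4 := P4.run u3 with hu4
  obtain ⟨hlev, -⟩ := run_search (A := 2) (by omega) hu4' hrow4 (p := fun _ => True) (x := a)
    (fun v => by
      rw [harr4 5 (by decide), hu3, State.setReg_arr, harr2 5 (by decide)]
      simpa using hmask v)
    (by rw [hreg4 7 (by decide), hu3]; simp)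
  have hreg5 : ∀ y, y ∉ (search 2).writes → ((search 2).run u4).reg y = u4.reg y := fun y hy =>
    Cmd.run_reg hy u4
  have harr5 : ∀ a, a ∉ (search 2).arrays → ((search 2).run u4).arr a = u4.arr a := fun y hy =>
    Cmd.run_arr hy u4
  set u5 := (search 2).run u4 with hu5
  have e14 : u5.reg 14 = a := by
    rw [hreg5 14 (by decide), hreg4 14 (by decide), hu3]
    simp [hreg2, ha]
  have e15 : u5.reg 15 = b := by
    rw [hreg5 15 (by decide), hreg4 15 (by decide), hu3]
    simp [hreg2, hb]
  have hrun : flowPair.run u =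
      u5.setArr 4 a b ((SumExpr.not (.get 3 (.lit 0) (.var 15))).eval u5) := by
    have h214 : u2.reg 14 = a := by rw [hreg2 14 (by decide), ha]
    simp only [flowPair, Cmd.run_seq, Cmd.run_assign, Cmd.run_store, eval, ← hu1, ← hu2, h214,
      ← hu3, ← hP4, ← hu4, ← hu5, e14, e15]
  constructor
  · have : (flowPair.run u).arr 4 a b ≠ 0 ↔ u5.arr 3 0 b = 0 := by
      have h3 : (SumExpr.not (.get 3 (.lit 0) (.var 15))).Holds u5 ↔ u5.arr 3 0 b = 0 := by
        simp [eval, e15]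
      rw [← h3, hrun, State.setArr_arr, if_pos ⟨rfl, rfl, rfl⟩]
      rfl
    rw [this]
    constructor
    · intro h
      have h3 : b ∈ univ.filter fun v : Fin n => u5.arr 3 0 v = 0 := by simpa using h
      have h4 : a ∉ univ.filter fun v : Fin n => u5.arr 3 0 v = 0 := by simp [hlev.source]
      have h5 := h2 _ h3 h4
      rw [hlev.inDegree_unreached, zero_add] at h5
      exact ⟨_, ⟨⟨b, h3⟩, fun h => h4 (by rw [h]; exact mem_univ a), h5.symm⟩, h3, h4⟩
    · rintro ⟨X, h3, h4, h5⟩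
      by_contra h
      have h6 := h2 X h4 h5
      rw [h3.2.2] at h6
      exact hlev.notMem_of_inDegree_eq_zero h5 (by omega) (Nat.pos_of_ne_zero h) h4
  · intro c d hcd
    rw [hrun, State.setArr_arr, if_neg, harr5 4 (by decide), harr4 4 (by decide), hu3,
      State.setReg_arr, harr2 4 (by decide)]
    rintro ⟨-, h3, h4⟩
    exact hcd.elim (fun h => h (Fin.ext h3)) fun h => h (Fin.ext h4)

/-- The table describes the relation of accompanying. -/
theorem run_tightTable {u : State} (hu : Encodes H k u) {O : H.Orientation}
    (hO : IsRow u 1 (u.reg 20) O) (hk : O.IsHyperarcConnected k) (v w : Fin n) :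
    (tightTable.run u).arr 4 v w = 0 ↔ Accompanies O.inDegree k w v := by
  suffices h : ∀ a b : Fin n, (tightTable.run u).arr 4 a b ≠ 0 ↔
      ∃ X, InTight O.inDegree k X ∧ b ∈ X ∧ a ∉ X by
    rw [← not_iff_not, ← ne_eq, h]
    unfold Accompanies
    push Not
    rfl
  have hu1' : Encodes H k ((fillRow 5 (.lit 1)).run u) := hu.run (by decide) (by decide)
  have hmask : ∀ v : Fin n, ((fillRow 5 (.lit 1)).run u).arr 5 0 v ≠ 0 := fun v => by
    rw [run_fillRow hu (fun _ _ _ _ _ => rfl)]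
    simp [eval]
  have hO1 : IsRow ((fillRow 5 (.lit 1)).run u) 1 (((fillRow 5 (.lit 1)).run u).reg 20) O := by
    intro e
    rw [Cmd.run_reg (by decide), Cmd.run_arr (by decide), hO e]
  set u1 := (fillRow 5 (.lit 1)).run u with hu1
  obtain ⟨t, h1, h2⟩ := Cmd.run_forLoop (x := 14) (b := 0) (P := .forLoop 15 0 flowPair) (u := u1)
    (fun i t => ∀ a b : Fin n, (a : ℕ) < i → (t.arr 4 a b ≠ 0 ↔
      ∃ X, InTight O.inDegree k X ∧ b ∈ X ∧ a ∉ X))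
    (fun a b ha => absurd ha (Nat.not_lt_zero _))
    (by
      intro i hi t ht hreg harr
      rw [hu1'.reg_zero] at hi
      obtain ⟨s, h3, h4⟩ := Cmd.run_forLoop (x := 15) (b := 0) (P := flowPair)
        (u := t.setReg 14 i)
        (fun j s => ∀ a b : Fin n, ((a : ℕ) < i ∨ (a : ℕ) = i ∧ (b : ℕ) < j) →
          (s.arr 4 a b ≠ 0 ↔ ∃ X, InTight O.inDegree k X ∧ b ∈ X ∧ a ∉ X))
        (fun a b hab => ht a b (by omega))
        (by
          intro j hj s hs hreg' harr' a b hab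
          have h0 : (t.setReg 14 i).reg 0 = n := by
            rw [State.setReg_reg, if_neg (by omega), hreg 0 (by decide) (by decide),
              hu1'.reg_zero]
          rw [h0] at hj
          have hr : ∀ y, y ≠ 14 → y ≠ 15 → y ∉ flowPair.writes → (s.setReg 15 j).reg y =
              u1.reg y := by
            intro y hy hy' hyw
            rw [State.setReg_reg, if_neg hy', hreg' y hy' hyw, State.setReg_reg, if_neg hy,
              hreg y hy (by simp only [Cmd.writes, List.mem_cons]; tauto)]
          have ha : ∀ a, a ∉ flowPair.arrays → (s.setReg 15 j).arr a = u1.arr a := by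
            intro a ha
            rw [State.setReg_arr, harr' a ha, State.setReg_arr, harr a ha]
          obtain ⟨h5, h6⟩ := run_flowPair (H := H) (k := k) (u := s.setReg 15 j) (O := O)
            (a := ⟨i, hi⟩) (b := ⟨j, hj⟩)
            (hu1'.congr (hr 0 (by decide) (by decide) (by decide))
              (hr 1 (by decide) (by decide) (by decide)) (hr 2 (by decide) (by decide) (by decide))
              (ha 0 (by decide)))
            (by
              intro e
              rw [hr 20 (by decide) (by decide) (by decide), ha 1 (by decide)]
              exact hO1 e)
            (fun v => by rw [ha 5 (by decide)]; exact hmask v)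
            (by rw [State.setReg_reg, if_neg (by omega), hreg' 14 (by decide) (by decide)]; simp)
            (by simp) hk
          by_cases hab' : a = ⟨i, hi⟩ ∧ b = ⟨j, hj⟩
          · rw [hab'.1, hab'.2]
            exact h5
          · rw [not_and_or] at hab'
            rw [h6 a b hab', State.setReg_arr]
            refine hs a b ?_
            simp only [Fin.ext_iff] at hab'
            omega)
      intro a b ha
      rw [h4, State.setReg_arr]
      refine h3 a b ?_
      rw [State.setReg_reg, if_neg (by omega), hreg 0 (by decide) (by decide), hu1'.reg_zero]
      omega)
  intro a b
  rw [tightTable, Cmd.run, ← hu1, h2, State.setReg_arr]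
  exact h1 a b (by rw [hu1'.reg_zero]; exact a.2)

end RAM

/-! ### Computing the potential -/

namespace CutFunction

variable {V : Type*} [Fintype V] [DecidableEq V] {f : Finset V → ℕ} {k : ℕ}

open Classical in
/-- The intersection of all in-tight sets that contain `i`. -/
noncomputable def hull (f : Finset V → ℕ) (k : ℕ) (i : V) : Finset V :=
  univ.filter (Accompanies f k i)

theorem mem_hull {i v : V} : v ∈ hull f k i ↔ Accompanies f k i v := by simp [hull]

theorem self_mem_hull (f : Finset V → ℕ) (k : ℕ) (i : V) : i ∈ hull f k i :=
  mem_hull.2 fun _ _ h => h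

theorem accompanies_dual {i v : V} : Accompanies (dual f) k i v ↔ Accompanies f k v i := by
  constructor
  · intro h T hT hv
    by_contra hi
    exact mem_compl.1 (h Tᶜ (by rwa [inTight_dual, outTight_compl]) (mem_compl.2 hi)) hv
  · intro h T hT hi
    rw [inTight_dual] at hT
    by_contra hv
    exact mem_compl.1 (h Tᶜ hT (mem_compl.2 hv)) hi

theorem IsAdmissible.hull_eq (hf : IsAdmissible f k) {M : Finset V}
    (hM : Minimal (Tight f k) M) (hin : InTight f k M) {i : V} (hi : i ∈ M) : hull f k i = M := by
  refine subset_antisymm (fun v hv => mem_hull.1 hv M hin hi) fun v hv => mem_hull.2 ?_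
  intro T hT hiT
  by_cases hu : M ∪ T = univ
  · have h1 : Tᶜ ⊆ M := fun a ha => by
      have : a ∈ M ∪ T := hu ▸ mem_univ a
      exact (mem_union.1 this).resolve_right (mem_compl.1 ha)
    have h2 := hM.le_of_le (Or.inr (outTight_compl.2 hT)) h1
    exact absurd hiT (mem_compl.1 (h2 hi))
  · have h1 := (hf.inTight_inter_union hin hT ⟨i, mem_inter.2 ⟨hi, hiT⟩⟩ hu).1
    have h2 := hM.le_of_le (Or.inl h1) inter_subset_left
    exact (mem_inter.1 (h2 hv)).2

/-- The function itself, or its dual. -/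
def side (f : Finset V → ℕ) (τ : Bool) : Finset V → ℕ := bif τ then f else dual f

theorem IsAdmissible.side (hf : IsAdmissible f k) (τ : Bool) : IsAdmissible (side f τ) k := by
  cases τ
  · exact hf.dual
  · exact hf

theorem tight_side (τ : Bool) : Tight (side f τ) k = Tight f k := by
  cases τ
  · exact funext fun _ => propext tight_dual
  · rfl

theorem tight_iff_exists_side {X : Finset V} :
    Tight f k X ↔ ∃ τ, InTight (side f τ) k X := by
  rw [Bool.exists_bool, or_comm]
  simp only [side, cond_true, cond_false, inTight_dual]
  rfl

/-- Minimality needs to be tested against hulls only. -/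
theorem IsAdmissible.minimal_iff (hf : IsAdmissible f k) {M : Finset V} :
    Minimal (Tight f k) M ↔ Tight f k M ∧ ∀ j ∈ M, ∀ σ,
      InTight (CutFunction.side f σ) k (hull (CutFunction.side f σ) k j) →
        hull (CutFunction.side f σ) k j ⊆ M → M ⊆ hull (CutFunction.side f σ) k j := by
  constructor
  · exact fun h => ⟨h.prop, fun j _ σ h1 h2 => h.le_of_le (tight_iff_exists_side.2 ⟨σ, h1⟩) h2⟩
  · rintro ⟨h1, h2⟩
    refine ⟨h1, fun S hS hSM => ?_⟩
    obtain ⟨M', hM'S, hM'⟩ := exists_minimal_subset hS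
    obtain ⟨σ, hσ⟩ := tight_iff_exists_side.1 hM'.prop
    obtain ⟨j, hj⟩ := hM'.prop.nonempty
    have h3 := (hf.side σ).hull_eq (by rwa [tight_side]) hσ hj
    have h4 := h2 j (hSM (hM'S hj)) σ (by rwa [h3]) (by rw [h3]; exact hM'S.trans hSM)
    rw [h3] at h4
    exact h4.trans hM'S

/-- The hull of `i` in the direction `τ` is a minimal tight set, and `i` is its least element. -/
def IsLeader [LinearOrder V] (f : Finset V → ℕ) (k : ℕ) (τ : Bool) (i : V) : Prop :=
  InTight (side f τ) k (hull (side f τ) k i) ∧ ∀ j ∈ hull (side f τ) k i, i ≤ j ∧ ∀ σ,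
    InTight (side f σ) k (hull (side f σ) k j) →
      hull (side f σ) k j ⊆ hull (side f τ) k i → hull (side f τ) k i ⊆ hull (side f σ) k j

open Classical in
/-- The potential counts the pairs of a leader and a vertex outside its hull. -/
theorem IsAdmissible.potential_eq_card {V : Type*} [Fintype V] [LinearOrder V]
    {f : Finset V → ℕ} (hf : IsAdmissible f k) : potential f k =
      (univ.filter fun q : V × V => ∃ τ, IsLeader f k τ q.1 ∧
        q.2 ∉ hull (CutFunction.side f τ) k q.1).card := by
  have hne : ∀ M ∈ minTight f k, M.Nonempty := fun M hM => (mem_minTight.1 hM).prop.nonempty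
  have hcard : potential f k = ((minTight f k).sigma fun M => Mᶜ).card := by
    rw [card_sigma]
    exact sum_congr rfl fun M _ => (card_compl M).symm
  rw [hcard]
  refine card_bij (fun q hq => (q.1.min' (hne _ (mem_sigma.1 hq).1), q.2)) ?_ ?_ ?_
  · rintro ⟨M, v⟩ hq
    obtain ⟨h1, h2⟩ := mem_sigma.1 hq
    dsimp only at h1 h2 ⊢
    rw [mem_minTight] at h1
    have hi := M.min'_mem h1.prop.nonempty
    obtain ⟨τ, hτ⟩ := tight_iff_exists_side.1 h1.prop
    have h3 := (hf.side τ).hull_eq (by rwa [tight_side]) hτ hi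
    refine mem_filter.2 ⟨mem_univ _, τ, ?_, ?_⟩
    · unfold IsLeader
      dsimp only
      rw [h3]
      exact ⟨hτ, fun j hj => ⟨M.min'_le j hj, (hf.minimal_iff.1 h1).2 j hj⟩⟩
    · dsimp only
      rw [h3]
      exact mem_compl.1 h2
  · rintro ⟨M, v⟩ hq ⟨N, w⟩ hq' h
    have h1 := (mem_sigma.1 hq).1
    have h2 := (mem_sigma.1 hq').1
    dsimp only at h1 h2 h
    rw [Prod.mk.injEq] at h
    obtain rfl := hf.eq_of_minimal_tight (mem_minTight.1 h1) (mem_minTight.1 h2)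
      ⟨_, mem_inter.2 ⟨M.min'_mem (hne M h1), h.1 ▸ N.min'_mem (hne N h2)⟩⟩
    rw [h.2]
  · rintro ⟨i, v⟩ hq
    obtain ⟨-, τ, ⟨h1, h2⟩, h3⟩ := mem_filter.1 hq
    dsimp only at h1 h2 h3
    have h4 : Minimal (Tight f k) (hull (CutFunction.side f τ) k i) :=
      hf.minimal_iff.2 ⟨tight_iff_exists_side.2 ⟨τ, h1⟩, fun j hj => (h2 j hj).2⟩
    refine ⟨⟨hull (CutFunction.side f τ) k i, v⟩, mem_sigma.2 ⟨mem_minTight.2 h4,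
      mem_compl.2 h3⟩, ?_⟩
    rw [Prod.mk.injEq]
    refine ⟨le_antisymm (min'_le _ _ (self_mem_hull _ k i)) ?_, rfl⟩
    exact (h2 _ (min'_mem _ _)).1

end CutFunction

namespace RAM

open MultiHypergraph Orientation CutFunction SumExpr

variable {n m : ℕ} {H : MultiHypergraph (Fin n) (Fin m)} {k : ℕ}

namespace SumExpr

/-- Disjunction, with value `0` or `1`. -/
def or (e f : SumExpr) : SumExpr := (and e.not f.not).not

@[simp] theorem holds_or {e f : SumExpr} {u : State} :
    (e.or f).Holds u ↔ e.Holds u ∨ f.Holds u := by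
  rw [SumExpr.or, holds_not, holds_and, holds_not, holds_not]
  tauto

theorem eval_or (e f : SumExpr) (u : State) [Decidable (e.Holds u ∨ f.Holds u)] :
    (e.or f).eval u = if e.Holds u ∨ f.Holds u then 1 else 0 := by
  split_ifs with h
  · have h1 : ¬ (and e.not f.not).Holds u := by
      rw [holds_and, holds_not, holds_not]
      tauto
    rw [SumExpr.or, SumExpr.not, eval, eval, if_pos (not_not.1 h1)]
  · by_contra h'
    exact h (holds_or.1 h')

end SumExpr

/-- The vertex `e` lies in the hull of the vertex `x`, in the direction `τ`. -/
def memExpr (τ : Bool) (x : ℕ) (e : SumExpr) : SumExpr :=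
  bif τ then .not (.get 4 e (.var x)) else .not (.get 4 (.var x) e)

/-- The hull of the vertex `x` is in-tight, or out-tight, depending on the direction `τ`. -/
def tightExpr (τ : Bool) (x : ℕ) : SumExpr :=
  and (ex 54 0 (.not (memExpr τ x (.var 54))))
    (.eq (.sum 53 1 (bif τ then
        and (memExpr τ x (.get 1 (.var 20) (.var 53)))
          (ex 54 0 (and (.get 0 (.var 53) (.var 54)) (.not (memExpr τ x (.var 54)))))
      else and (.not (memExpr τ x (.get 1 (.var 20) (.var 53))))
          (ex 54 0 (and (.get 0 (.var 53) (.var 54)) (memExpr τ x (.var 54)))))) (.var 2))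

/-- The hull of the vertex `x` in the direction `σ` is contained in the hull of the vertex `y` in
the direction `τ`. -/
def subsetExpr (σ : Bool) (x : ℕ) (τ : Bool) (y : ℕ) : SumExpr :=
  all 54 0 (imp (memExpr σ x (.var 54)) (memExpr τ y (.var 54)))

/-- If the hull of the vertex `51` in the direction `σ` is tight, then it is not a proper subset of
the hull of the vertex `50` in the direction `τ`. -/
def compareExpr (τ σ : Bool) : SumExpr :=
  imp (and (tightExpr σ 51) (subsetExpr σ 51 τ 50)) (subsetExpr τ 50 σ 51)

/-- The vertex `50` is a leader. -/
def leaderExpr (τ : Bool) : SumExpr :=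
  and (tightExpr τ 50) (all 51 0 (imp (memExpr τ 50 (.var 51))
    (and (.not (.lt (.var 51) (.var 50))) (and (compareExpr τ false) (compareExpr τ true)))))

/-- The potential of the orientation in row `20` of array `1`. -/
def potentialExpr : SumExpr :=
  .sum 50 0 (.sum 52 0 (or (and (leaderExpr false) (.not (memExpr false 50 (.var 52))))
    (and (leaderExpr true) (.not (memExpr true 50 (.var 52))))))

/-- Row `20` of array `1` holds the orientation `O`, and array `4` the pairs of vertices that are
separated by a set that is in-tight in `O`. -/
structure HasTable (k : ℕ) (O : H.Orientation) (u : State) : Prop where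
  encodes : Encodes H k u
  row : IsRow u 1 (u.reg 20) O
  table : ∀ v w : Fin n, u.arr 4 v w = 0 ↔ Accompanies O.inDegree k w v

variable {O : H.Orientation} {u : State}

theorem HasTable.setReg (h : HasTable k O u) {x : ℕ} (hx : 50 ≤ x) (v : ℕ) :
    HasTable k O (u.setReg x v) where
  encodes := h.encodes.setReg (by omega) v
  row := by
    rw [isRow_setReg, State.setReg_reg, if_neg (by omega)]
    exact h.row
  table := h.table

theorem HasTable.holds_memExpr (h : HasTable k O u) {τ : Bool} {x : ℕ} {e : SumExpr} {i v : Fin n}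
    (hi : u.reg x = i) (hv : e.eval u = v) :
    (memExpr τ x e).Holds u ↔ v ∈ hull (side O.inDegree τ) k i := by
  cases τ
  · rw [side, cond_false, mem_hull, accompanies_dual, ← h.table]
    simp [memExpr, eval, hi, hv]
  · rw [side, cond_true, mem_hull, ← h.table]
    simp [memExpr, eval, hi, hv]

theorem HasTable.holds_tightExpr (h : HasTable k O u) {τ : Bool} {x : ℕ} {i : Fin n}
    (hi : u.reg x = i) (hx : x ≤ 51) :
    (tightExpr τ x).Holds u ↔ InTight (side O.inDegree τ) k (hull (side O.inDegree τ) k i) := by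
  classical
  have hne : (hull (side O.inDegree τ) k i).Nonempty := ⟨i, self_mem_hull _ k i⟩
  have hmem : ∀ v : Fin n, (memExpr τ x (.var 54)).Holds (u.setReg 54 v) ↔
      v ∈ hull (side O.inDegree τ) k i := fun v =>
    (h.setReg (by omega) v).holds_memExpr (by
      rw [State.setReg_reg, if_neg (by omega), hi]) (by simp [eval])
  have hmem' : ∀ (e : Fin m) (v : Fin n), (memExpr τ x (.var 54)).Holds
      ((u.setReg 53 e).setReg 54 v) ↔ v ∈ hull (side O.inDegree τ) k i := fun e v =>
    ((h.setReg (by omega) _).setReg (by omega) v).holds_memExpr (by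
      rw [State.setReg_reg, if_neg (by omega), State.setReg_reg, if_neg (by omega), hi])
      (by simp [eval])
  have hhead : ∀ e : Fin m, (memExpr τ x (.get 1 (.var 20) (.var 53))).Holds (u.setReg 53 e) ↔
      O.head e ∈ hull (side O.inDegree τ) k i := fun e =>
    (h.setReg (by omega) _).holds_memExpr (by
      rw [State.setReg_reg, if_neg (by omega), hi])
      (by simpa [eval] using h.row e)
  have huniv : hull (side O.inDegree τ) k i ≠ univ ↔
      ∃ v : Fin n, v ∉ hull (side O.inDegree τ) k i := by
    rw [ne_eq, eq_univ_iff_forall, not_forall]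
  rw [InTight, tightExpr, holds_and, holds_eq, holds_ex, huniv]
  simp only [h.encodes.reg_zero, exists_lt_iff, holds_not, hmem, hne, true_and]
  refine and_congr_right fun _ => ?_
  rw [eval, eval, h.encodes.reg_one, h.encodes.reg_two, sum_range]
  have hedge : ∀ (e : Fin m) (v : Fin n), (SumExpr.get 0 (.var 53) (.var 54)).Holds
      ((u.setReg 53 e).setReg 54 v) ↔ v ∈ H.edge e := fun e v => by
    simp [eval, h.encodes.arr]
  have h0 : ∀ e : Fin m, (u.setReg 53 e).reg 0 = n := fun e => by simp [h.encodes.reg_zero]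
  cases τ
  · simp only [cond_false, eval_and, holds_not, holds_and, holds_ex, h0, exists_lt_iff, hedge,
      hmem', hhead]
    rw [← card_filter, side, cond_false, dual, inDegree]
    simp only [not_subset, mem_compl, not_not]
  · simp only [cond_true, eval_and, holds_not, holds_and, holds_ex, h0, exists_lt_iff, hedge,
      hmem', hhead]
    rw [← card_filter, side, cond_true, inDegree]
    simp only [not_subset]

theorem HasTable.holds_subsetExpr (h : HasTable k O u) {σ τ : Bool} {x y : ℕ} {i j : Fin n}
    (hi : u.reg x = i) (hj : u.reg y = j) (hx : x ≤ 51) (hy : y ≤ 51) :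
    (subsetExpr σ x τ y).Holds u ↔
      hull (side O.inDegree σ) k i ⊆ hull (side O.inDegree τ) k j := by
  rw [subsetExpr, holds_all, h.encodes.reg_zero]
  have h1 : ∀ v : Fin n, (memExpr σ x (.var 54)).Holds (u.setReg 54 v) ↔
      v ∈ hull (side O.inDegree σ) k i := fun v =>
    (h.setReg (by omega) v).holds_memExpr (by
      rw [State.setReg_reg, if_neg (by omega), hi]) (by simp [eval])
  have h2 : ∀ v : Fin n, (memExpr τ y (.var 54)).Holds (u.setReg 54 v) ↔
      v ∈ hull (side O.inDegree τ) k j := fun v =>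
    (h.setReg (by omega) v).holds_memExpr (by
      rw [State.setReg_reg, if_neg (by omega), hj]) (by simp [eval])
  constructor
  · intro h3 v hv
    exact (h2 v).1 (holds_imp.1 (h3 v v.2) ((h1 v).2 hv))
  · intro h3 v hv
    exact holds_imp.2 fun h4 => (h2 ⟨v, hv⟩).2 (h3 ((h1 ⟨v, hv⟩).1 h4))

theorem HasTable.holds_leaderExpr (h : HasTable k O u) {τ : Bool} {i : Fin n}
    (hi : u.reg 50 = i) : (leaderExpr τ).Holds u ↔ IsLeader O.inDegree k τ i := by
  rw [leaderExpr, holds_and, h.holds_tightExpr hi (by omega), IsLeader, holds_all,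
    h.encodes.reg_zero]
  refine and_congr_right fun _ => ?_
  have key : ∀ j : Fin n, (imp (memExpr τ 50 (.var 51)) (and (.not (.lt (.var 51) (.var 50)))
      (and (compareExpr τ false) (compareExpr τ true)))).Holds (u.setReg 51 j) ↔
      (j ∈ hull (side O.inDegree τ) k i → i ≤ j ∧ ∀ σ,
        InTight (side O.inDegree σ) k (hull (side O.inDegree σ) k j) →
          hull (side O.inDegree σ) k j ⊆ hull (side O.inDegree τ) k i →
            hull (side O.inDegree τ) k i ⊆ hull (side O.inDegree σ) k j) := by
    intro j
    have h' := h.setReg (x := 51) (by omega) j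
    have h50 : (u.setReg 51 j).reg 50 = i := by
      rw [State.setReg_reg, if_neg (by omega), hi]
    have h51 : (u.setReg 51 j).reg 51 = j := by simp
    have hc : ∀ σ, (compareExpr τ σ).Holds (u.setReg 51 j) ↔
        (InTight (side O.inDegree σ) k (hull (side O.inDegree σ) k j) →
          hull (side O.inDegree σ) k j ⊆ hull (side O.inDegree τ) k i →
            hull (side O.inDegree τ) k i ⊆ hull (side O.inDegree σ) k j) := by
      intro σ
      rw [compareExpr, holds_imp, holds_and, h'.holds_tightExpr h51 (by omega),
        h'.holds_subsetExpr h51 h50 (by omega) (by omega),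
        h'.holds_subsetExpr h50 h51 (by omega) (by omega), and_imp]
    rw [holds_imp, holds_and, holds_and, hc, hc, holds_not, holds_lt,
      h'.holds_memExpr h50 (v := j) (by simp [eval]), Bool.forall_bool]
    simp only [eval, h50, h51, not_lt, Fin.val_fin_le]
  constructor
  · exact fun h1 j => (key j).1 (h1 j j.2)
  · exact fun h1 j hj => (key ⟨j, hj⟩).2 (h1 ⟨j, hj⟩)

theorem HasTable.eval_potentialExpr (h : HasTable k O u) (hf : IsAdmissible O.inDegree k) :
    potentialExpr.eval u = potential O.inDegree k := by
  classical
  rw [hf.potential_eq_card, card_filter, ← univ_product_univ, sum_product, potentialExpr, eval,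
    h.encodes.reg_zero, sum_range]
  refine sum_congr rfl fun i _ => ?_
  have h50 : (u.setReg 50 i).reg 0 = n := by simp [h.encodes.reg_zero]
  rw [eval, h50, sum_range]
  refine sum_congr rfl fun v _ => ?_
  have h' := (h.setReg (x := 50) (by omega) i).setReg (x := 52) (by omega) v
  have hi : ((u.setReg 50 i).setReg 52 v).reg 50 = i := by simp
  rw [eval_or]
  refine if_congr ?_ rfl rfl
  rw [holds_and, holds_and, h'.holds_leaderExpr hi, h'.holds_leaderExpr hi, holds_not, holds_not,
    h'.holds_memExpr hi (v := v) (by simp [eval]), h'.holds_memExpr hi (v := v) (by simp [eval]),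
    Bool.exists_bool]

end RAM

/-! ### The algorithm -/

namespace RAM

open MultiHypergraph Orientation CutFunction SumExpr

variable {n m : ℕ} {H : MultiHypergraph (Fin n) (Fin m)} {k : ℕ} {O : H.Orientation}
  {u t : State} {x w : Fin n}

/-- The sequence of orientations, which ends in row `3` of array `1`, is extended by the transfer of
a head from the vertex `17` along a path that has been found. The extension is accepted, and the
variable `5` set, if the potential drops below the value of the variable `4`. -/
def transferCmd : Cmd :=
  .seq (.assign 9 (.var 17)) (.seq (walk 1) (.seq (.assign 18 (.var 8)) (.seq (.assign 20 (.var 8))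
    (.seq tightTable (.ite (.lt potentialExpr (.var 4))
      (.seq (.assign 3 (.var 18)) (.assign 5 (.lit 1))) .skip)))))

/-- A path from the vertex `6` to the vertex `17` is sought in the orientation in row `3`, along
vertices that accompany the latter. -/
def pathCmd : Cmd :=
  .seq (fillRow 5 (.not (.get 4 (.var 21) (.var 17)))) (.seq (.assign 7 (.var 6))
    (.seq (.assign 8 (.var 3)) (.seq (search 1)
      (.ite (.get 3 (.lit 0) (.var 17)) transferCmd .skip))))

/-- An attempt to transfer a head from the vertex `17` to the vertex `6`. -/
def attempt : Cmd :=
  .seq (.assign 20 (.var 3)) (.seq tightTable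
    (.ite (.get 4 (.var 6) (.var 17)) .skip pathCmd))

/-- All pairs of vertices are tried, until a transfer is accepted. -/
def improve : Cmd :=
  .seq (.assign 20 (.var 3)) (.seq tightTable (.seq (.assign 4 potentialExpr)
    (.seq (.assign 5 (.lit 0)) (.forLoop 6 0 (.forLoop 17 0 (.ite (.var 5) .skip attempt))))))

/-- The sequence of orientations is extended until the potential is zero. -/
def improveAll : Cmd := .forLoop 23 0 (.forLoop 24 0 improve)

/-- The row number `25` is increased if the potential of the orientation in this row is not
zero. -/
def advance : Cmd :=
  .seq (.assign 20 (.var 25)) (.seq tightTable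
    (.ite potentialExpr (.assign 25 (.add (.var 25) (.lit 1))) .skip))

/-- The first row whose orientation has potential zero is sought. -/
def findFirst : Cmd :=
  .seq (.assign 25 (.lit 0)) (.forLoop 26 0 (.forLoop 27 0 (.forLoop 28 0 advance)))

/-- The array `1` of the state `t` extends that of `u`, from row `u.reg 3` to row `t.reg 3`, by a
sequence of `k`-hyperarc-connected orientations that begins with `O`. -/
structure IsExtension (k : ℕ) (O : H.Orientation) (u t : State) (ℓ : ℕ)
    (seq : ℕ → H.Orientation) : Prop where
  start : seq 0 = O
  trace : IsTrace t 1 (u.reg 3) ℓ seq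
  connected : ∀ i ≤ ℓ, (seq i).IsHyperarcConnected k
  reg : t.reg 3 = u.reg 3 + ℓ
  rows : ∀ i ≤ u.reg 3, t.arr 1 i = u.arr 1 i

theorem IsExtension.refl (hO : O.IsHyperarcConnected k) (hrow : IsRow u 1 (u.reg 3) O)
    (h3 : t.reg 3 = u.reg 3) (h1 : ∀ i ≤ u.reg 3, t.arr 1 i = u.arr 1 i) :
    IsExtension k O u t 0 (fun _ => O) where
  start := rfl
  trace := ⟨fun i hi e => by
    obtain rfl := Nat.le_zero.1 hi
    rw [add_zero, h1 _ le_rfl, hrow e], fun i hi => absurd hi i.not_lt_zero⟩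
  connected _ _ := hO
  reg := h3
  rows := h1

theorem IsExtension.trans {s : State} {ℓ ℓ' : ℕ} {seq seq' : ℕ → H.Orientation}
    (h : IsExtension k O u t ℓ seq) (h' : IsExtension k (seq ℓ) t s ℓ' seq') :
    IsExtension k O u s (ℓ + ℓ') (fun i => if i ≤ ℓ then seq i else seq' (i - ℓ)) where
  start := by simpa using h.start
  trace := by
    have h1 := h'.trace
    rw [h.reg] at h1
    refine (h.trace.congr fun i hi => h'.rows i ?_).append h1 h'.start
    rw [h.reg]
    exact hi
  connected i hi := by
    split_ifs with hiℓ
    · exact h.connected i hiℓ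
    · exact h'.connected _ (by omega)
  reg := by
    rw [h'.reg, h.reg, add_assoc]
  rows i hi := by
    rw [h'.rows i (by rw [h.reg]; omega), h.rows i hi]

/-- The extension does not depend on the variables other than `3`, nor on the arrays other than
`1`. -/
theorem IsExtension.congr {s : State} {ℓ : ℕ} {seq : ℕ → H.Orientation}
    (h : IsExtension k O u t ℓ seq) (h3 : s.reg 3 = t.reg 3) (h1 : s.arr 1 = t.arr 1) :
    IsExtension k O u s ℓ seq where
  start := h.start
  trace := h.trace.congr fun i _ => by rw [h1]
  connected := h.connected
  reg := h3.trans h.reg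
  rows i hi := by rw [h1, h.rows i hi]

/-- A pair of vertices as provided by `IsHyperarcConnected.exists_transfer`. -/
def IsGoodPair (k : ℕ) (O : H.Orientation) (x w : Fin n) : Prop :=
  Accompanies O.inDegree k w x ∧ Reach O.Arc (Accompanies O.inDegree k w) x w ∧
    ∀ O' : H.Orientation, IsTransfer O.inDegree O'.inDegree w x →
      potential O'.inDegree k < potential O.inDegree k

/-- The outcome of an attempt: it succeeds if the pair is good. Success is recorded in the variable
`5`. -/
def IsAttempt (k : ℕ) (O : H.Orientation) (x w : Fin n) (u t : State) : Prop :=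
  (t.reg 5 = 0 ∧ IsExtension k O u t 0 (fun _ => O) ∧ ¬ IsGoodPair k O x w) ∨
  (t.reg 5 = 1 ∧ ∃ ℓ ≤ n, ∃ seq, IsExtension k O u t ℓ seq ∧
    potential (seq ℓ).inDegree k < potential O.inDegree k)

theorem run_tightTable_hasTable (hu : Encodes H k u) (hO : IsRow u 1 (u.reg 20) O)
    (hk : O.IsHyperarcConnected k) : HasTable k O (tightTable.run u) where
  encodes := hu.run (by decide) (by decide)
  row e := by
    rw [Cmd.run_reg (by decide), Cmd.run_arr (by decide), hO e]
  table := run_tightTable hu hO hk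

theorem run_transferCmd (hH : H.IsPartitionConnected (k + 1)) (hu : Encodes H k u)
    (hk : O.IsHyperarcConnected k) (hrow : IsRow u 1 (u.reg 3) O) (h8 : u.reg 8 = u.reg 3)
    (h4 : u.reg 4 = potential O.inDegree k) (h5 : u.reg 5 = 0) (h17 : u.reg 17 = w)
    (hx : Accompanies O.inDegree k w x)
    (hlev : O.IsLevel (Accompanies O.inDegree k w) x (fun v => u.arr 3 0 v))
    (hle : ∀ v : Fin n, u.arr 3 0 v ≤ n + 1) (hw : 0 < u.arr 3 0 w) :
    IsAttempt k O x w u (transferCmd.run u) := by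
  obtain ⟨ℓ, h1, seq, h2, h3, hinv, hlast, h7, hrows⟩ := run_walk (A := 1) (by omega) (by omega)
    (u := u.setReg 9 w) (hu.setReg (by omega) _) (O := O) (by simpa [h8] using hrow) hlev
    (fun _ => rfl) hle (by simp) hw
  set u1 := u.setReg 9 w with hu1
  have hu1' : Encodes H k u1 := hu.setReg (by omega) _
  have hr2 : ∀ y, y ∉ (walk 1).writes → y ≠ 9 → ((walk 1).run u1).reg y = u.reg y :=
    fun y hy hy' => by rw [Cmd.run_reg hy, hu1, State.setReg_reg, if_neg hy']
  have hu2' : Encodes H k ((walk 1).run u1) := hu1'.run (by decide) (by decide)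
  have h18 : u1.reg 8 = u.reg 3 := by simp [hu1, h8]
  rw [h18] at h3 h7 hrows
  set u2 := (walk 1).run u1 with hu2
  set u3 := (u2.setReg 18 (u.reg 3 + ℓ)).setReg 20 (u.reg 3 + ℓ) with hu3
  have hu3' : Encodes H k u3 := (hu2'.setReg (by omega) _).setReg (by omega) _
  have hconn : ∀ i ≤ ℓ, (seq i).IsHyperarcConnected k := fun i hi => by
    obtain ⟨c, hc⟩ := hinv i hi
    exact hc.isHyperarcConnected hk hx hlev
  have htab : HasTable k (seq ℓ) (tightTable.run u3) := by
    refine run_tightTable_hasTable hu3' ?_ (hconn ℓ le_rfl)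
    have : u3.reg 20 = u.reg 3 + ℓ := by simp [hu3]
    rw [this]
    exact h3.row ℓ le_rfl
  have hr4 : ∀ y, y ∉ tightTable.writes → (tightTable.run u3).reg y = u3.reg y := fun y hy =>
    Cmd.run_reg hy u3
  have ha4 : (tightTable.run u3).arr 1 = u2.arr 1 := Cmd.run_arr (by decide) u3
  have hpot := htab.eval_potentialExpr ((hconn ℓ le_rfl).isAdmissible hH)
  have hrun : transferCmd.run u = (Cmd.ite (.lt potentialExpr (.var 4))
      (.seq (.assign 3 (.var 18)) (.assign 5 (.lit 1))) .skip).run (tightTable.run u3) := by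
    simp only [transferCmd, Cmd.run_seq, Cmd.run_assign, eval, h17, ← hu1, ← hu2, h7,
      State.setReg_reg]
    simp [← hu3]
  set u4 := tightTable.run u3 with hu4
  have e4 : u4.reg 4 = potential O.inDegree k := by
    rw [hr4 4 (by decide), ← h4]
    simp [hu3, hr2 4 (by decide)]
  have e18 : u4.reg 18 = u.reg 3 + ℓ := by
    rw [hr4 18 (by decide)]
    simp [hu3]
  have e3 : u4.reg 3 = u.reg 3 := by
    rw [hr4 3 (by decide)]
    simp [hu3, hr2 3 (by decide)]
  have e5 : u4.reg 5 = 0 := by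
    rw [hr4 5 (by decide), ← h5]
    simp [hu3, hr2 5 (by decide)]
  have hcond : (SumExpr.lt potentialExpr (.var 4)).Holds u4 ↔
      potential (seq ℓ).inDegree k < potential O.inDegree k := by
    rw [holds_lt, hpot, eval, e4]
  rw [hrun]
  by_cases h : potential (seq ℓ).inDegree k < potential O.inDegree k
  · rw [Cmd.run_ite_pos (hcond.2 h)]
    refine Or.inr ⟨by simp [Cmd.run, eval], ℓ, h1, seq, ⟨h2, ?_, hconn, ?_, ?_⟩, h⟩
    · exact h3.congr fun i _ => by simp [Cmd.run, ha4]
    · simp [Cmd.run, eval, e18]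
    · exact fun i hi => (congrFun ha4 i).trans (hrows i hi)
  · rw [Cmd.run_ite_neg (fun h' => h (hcond.1 h'))]
    refine Or.inl ⟨e5, .refl hk hrow e3 fun i hi => ?_, fun hg => h (hg.2.2 _ hlast.transfer)⟩
    rw [Cmd.run, ha4]
    exact hrows i hi

theorem run_pathCmd (hH : H.IsPartitionConnected (k + 1)) (hu : Encodes H k u)
    (hk : O.IsHyperarcConnected k) (hrow : IsRow u 1 (u.reg 3) O)
    (htable : ∀ v w : Fin n, u.arr 4 v w = 0 ↔ Accompanies O.inDegree k w v)
    (h4 : u.reg 4 = potential O.inDegree k) (h5 : u.reg 5 = 0) (h6 : u.reg 6 = x)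
    (h17 : u.reg 17 = w) (hx : Accompanies O.inDegree k w x) :
    IsAttempt k O x w u (pathCmd.run u) := by
  set F := fillRow 5 (.not (.get 4 (.var 21) (.var 17))) with hF
  have hmask : ∀ v : Fin n, (F.run u).arr 5 0 v ≠ 0 ↔ Accompanies O.inDegree k w v := by
    intro v
    have h1 : (SumExpr.not (.get 4 (.var 21) (.var 17))).Holds (u.setReg 21 v) ↔
        Accompanies O.inDegree k w v := by
      rw [← htable]
      simp [eval, h17]
    rw [hF, run_fillRow hu, ← h1]
    · rfl
    · intro t i hreg harr h21
      simp [SumExpr.not, eval, h21, hreg 17 (by omega), harr 4 (by omega)]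
  have hr1 : ∀ y, y ∉ F.writes → (F.run u).reg y = u.reg y := fun y hy => Cmd.run_reg hy u
  have ha1 : (F.run u).arr 1 = u.arr 1 := Cmd.run_arr (by decide) u
  have hu1' : Encodes H k (F.run u) := hu.run (by decide) (by decide)
  set u1 := F.run u with hu1
  set u2 := (u1.setReg 7 x).setReg 8 (u.reg 3) with hu2
  have hu2' : Encodes H k u2 := (hu1'.setReg (by omega) _).setReg (by omega) _
  have hrow2 : IsRow u2 1 (u2.reg 8) O := by
    intro e
    have : u2.reg 8 = u.reg 3 := by simp [hu2]
    rw [this, ← hrow e, hu2, State.setReg_arr, State.setReg_arr, ha1]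
  obtain ⟨hlev, hle⟩ := run_search (A := 1) (by omega) hu2' hrow2 (p := Accompanies O.inDegree k w)
    hmask (x := x) (by simp [hu2])
  have hr3 : ∀ y, y ∉ (search 1).writes → ((search 1).run u2).reg y = u2.reg y := fun y hy =>
    Cmd.run_reg hy u2
  have ha3 : ((search 1).run u2).arr 1 = u.arr 1 := by
    rw [Cmd.run_arr (by decide), ← ha1]
    rfl
  have hu3' : Encodes H k ((search 1).run u2) := hu2'.run (by decide) (by decide)
  have hrun : pathCmd.run u = (Cmd.ite (.get 3 (.lit 0) (.var 17)) transferCmd .skip).run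
      ((search 1).run u2) := by
    have h16 : u1.reg 6 = x := by rw [hr1 6 (by decide), h6]
    have h13 : u1.reg 3 = u.reg 3 := hr1 3 (by decide)
    simp only [pathCmd, Cmd.run_seq, Cmd.run_assign, eval, ← hF, ← hu1, h16, State.setReg_reg]
    simp [h13, ← hu2]
  set u3 := (search 1).run u2 with hu3
  have hr : ∀ y, y ∉ F.writes → y ∉ (search 1).writes → y ≠ 7 → y ≠ 8 → u3.reg y = u.reg y := by
    intro y h1 h2 h3 h4
    rw [hr3 y h2, hu2, State.setReg_reg, if_neg h4, State.setReg_reg, if_neg h3, hr1 y h1]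
  have e3 : u3.reg 3 = u.reg 3 := hr 3 (by decide) (by decide) (by decide) (by decide)
  have e17 : u3.reg 17 = w := (hr 17 (by decide) (by decide) (by decide) (by decide)).trans h17
  have e5 : u3.reg 5 = 0 := (hr 5 (by decide) (by decide) (by decide) (by decide)).trans h5
  have hcond : (SumExpr.get 3 (.lit 0) (.var 17)).Holds u3 ↔ u3.arr 3 0 w ≠ 0 := by
    simp [eval, e17]
  rw [hrun]
  by_cases hw : u3.arr 3 0 w = 0
  · rw [Cmd.run_ite_neg (fun h => hcond.1 h hw), Cmd.run]
    refine Or.inl ⟨e5, .refl hk hrow e3 fun i _ => by rw [ha3], fun hg => ?_⟩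
    have := hlev.pos_of_reach hg.2.1
    omega
  · rw [Cmd.run_ite_pos (hcond.2 hw)]
    have h := run_transferCmd (u := u3) hH hu3' hk (by rw [e3]; intro e; rw [ha3]; exact hrow e)
      (by rw [e3, hr3 8 (by decide)]; simp [hu2])
      ((hr 4 (by decide) (by decide) (by decide) (by decide)).trans h4) e5 e17 hx hlev hle
      (Nat.pos_of_ne_zero hw)
    have hext : ∀ {t : State} {ℓ : ℕ} {seq : ℕ → H.Orientation}, IsExtension k O u3 t ℓ seq →
        IsExtension k O u t ℓ seq := fun {t ℓ seq} h =>
      ⟨h.start, e3 ▸ h.trace, h.connected, e3 ▸ h.reg, fun i hi => by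
        rw [h.rows i (by rw [e3]; exact hi), ha3]⟩
    rcases h with ⟨q1, q2, q3⟩ | ⟨q1, ℓ, q2, seq, q3, q4⟩
    · exact Or.inl ⟨q1, hext q2, q3⟩
    · exact Or.inr ⟨q1, ℓ, q2, seq, hext q3, q4⟩

theorem run_attempt (hH : H.IsPartitionConnected (k + 1)) (hu : Encodes H k u)
    (hk : O.IsHyperarcConnected k) (hrow : IsRow u 1 (u.reg 3) O)
    (h4 : u.reg 4 = potential O.inDegree k) (h5 : u.reg 5 = 0) (h6 : u.reg 6 = x)
    (h17 : u.reg 17 = w) : IsAttempt k O x w u (attempt.run u) := by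
  set u1 := u.setReg 20 (u.reg 3) with hu1
  have htab : HasTable k O (tightTable.run u1) :=
    run_tightTable_hasTable (hu.setReg (by omega) _) (by simpa [hu1] using hrow) hk
  have hr : ∀ y, y ∉ tightTable.writes → y ≠ 20 → (tightTable.run u1).reg y = u.reg y :=
    fun y hy hy' => by rw [Cmd.run_reg hy, hu1, State.setReg_reg, if_neg hy']
  have ha : (tightTable.run u1).arr 1 = u.arr 1 := Cmd.run_arr (by decide) u1
  have hrun : attempt.run u = (Cmd.ite (.get 4 (.var 6) (.var 17)) .skip pathCmd).run
      (tightTable.run u1) := rfl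
  set u2 := tightTable.run u1 with hu2
  have e3 : u2.reg 3 = u.reg 3 := hr 3 (by decide) (by decide)
  have e5 : u2.reg 5 = 0 := (hr 5 (by decide) (by decide)).trans h5
  have e6 : u2.reg 6 = x := (hr 6 (by decide) (by decide)).trans h6
  have e17 : u2.reg 17 = w := (hr 17 (by decide) (by decide)).trans h17
  have hcond : (SumExpr.get 4 (.var 6) (.var 17)).Holds u2 ↔ ¬ Accompanies O.inDegree k w x := by
    rw [← htab.table]
    simp [eval, e6, e17]
  rw [hrun]
  by_cases hx : Accompanies O.inDegree k w x
  · rw [Cmd.run_ite_neg (fun h => hcond.1 h hx)]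
    have h := run_pathCmd (u := u2) hH htab.encodes hk
      (by rw [e3]; intro e; rw [ha]; exact hrow e) htab.table
      ((hr 4 (by decide) (by decide)).trans h4) e5 e6 e17 hx
    have hext : ∀ {t : State} {ℓ : ℕ} {seq : ℕ → H.Orientation}, IsExtension k O u2 t ℓ seq →
        IsExtension k O u t ℓ seq := fun {t ℓ seq} h =>
      ⟨h.start, e3 ▸ h.trace, h.connected, e3 ▸ h.reg, fun i hi => by
        rw [h.rows i (by rw [e3]; exact hi), ha]⟩
    rcases h with ⟨q1, q2, q3⟩ | ⟨q1, ℓ, q2, seq, q3, q4⟩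
    · exact Or.inl ⟨q1, hext q2, q3⟩
    · exact Or.inr ⟨q1, ℓ, q2, seq, hext q3, q4⟩
  · rw [Cmd.run_ite_pos (hcond.2 hx), Cmd.run]
    exact Or.inl ⟨e5, .refl hk hrow e3 fun i _ => by rw [ha], fun hg => hx hg.1⟩

/-- The state of affairs after the pairs in `S` have been tried. -/
def IsSearch (k : ℕ) (O : H.Orientation) (u : State) (S : Fin n → Fin n → Prop) (t : State) :
    Prop :=
  Encodes H k t ∧ t.reg 4 = potential O.inDegree k ∧
  ((t.reg 5 = 0 ∧ IsExtension k O u t 0 (fun _ => O) ∧ ∀ x w, S x w → ¬ IsGoodPair k O x w) ∨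
  (t.reg 5 = 1 ∧ ∃ ℓ ≤ n, ∃ seq, IsExtension k O u t ℓ seq ∧
    potential (seq ℓ).inDegree k < potential O.inDegree k))

theorem IsSearch.setReg {S : Fin n → Fin n → Prop} (h : IsSearch k O u S t) {y : ℕ} (hy : 6 ≤ y)
    (v : ℕ) : IsSearch k O u S (t.setReg y v) := by
  have hr : ∀ z < 6, (t.setReg y v).reg z = t.reg z := fun z hz => by
    rw [State.setReg_reg, if_neg (by omega)]
  obtain ⟨h1, h2, h3⟩ := h
  refine ⟨h1.setReg (by omega) v, by rw [hr 4 (by omega), h2], ?_⟩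
  rw [hr 5 (by omega)]
  rcases h3 with ⟨q1, q2, q3⟩ | ⟨q1, ℓ, q2, seq, q3, q4⟩
  · exact Or.inl ⟨q1, q2.congr (hr 3 (by omega)) rfl, q3⟩
  · exact Or.inr ⟨q1, ℓ, q2, seq, q3.congr (hr 3 (by omega)) rfl, q4⟩

theorem IsSearch.mono {S S' : Fin n → Fin n → Prop} (h : IsSearch k O u S t)
    (hS : ∀ x w, S' x w → S x w) : IsSearch k O u S' t :=
  ⟨h.1, h.2.1, h.2.2.imp_left fun ⟨q1, q2, q3⟩ => ⟨q1, q2, fun x w h => q3 x w (hS x w h)⟩⟩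

theorem IsSearch.run_attempt (hH : H.IsPartitionConnected (k + 1)) (hk : O.IsHyperarcConnected k)
    {S : Fin n → Fin n → Prop} (h : IsSearch k O u S t) (h6 : t.reg 6 = x) (h17 : t.reg 17 = w) :
    IsSearch k O u (fun a b => S a b ∨ a = x ∧ b = w) ((Cmd.ite (.var 5) .skip attempt).run t) := by
  have hcond : (SumExpr.var 5).Holds t ↔ t.reg 5 ≠ 0 := Iff.rfl
  obtain ⟨h1, h2, ⟨q1, q2, q3⟩ | ⟨q1, q2⟩⟩ := h
  · rw [Cmd.run_ite_neg (fun h => hcond.1 h q1)]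
    have h3 : t.reg 3 = u.reg 3 := q2.reg
    have hrow := q2.trace.row 0 le_rfl
    rw [add_zero, ← h3] at hrow
    refine ⟨h1.run (by decide) (by decide), by rw [Cmd.run_reg (by decide), h2], ?_⟩
    rcases RAM.run_attempt hH h1 hk hrow h2 q1 h6 h17 with ⟨p1, p2, p3⟩ | ⟨p1, ℓ, p2, seq, p3, p4⟩
    · refine Or.inl ⟨p1, ?_, ?_⟩
      · simpa using q2.trans p2
      · rintro a b (hab | ⟨rfl, rfl⟩)
        · exact q3 a b hab
        · exact p3
    · refine Or.inr ⟨p1, ℓ, p2, seq, ?_, p4⟩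
      exact ⟨p3.start, h3 ▸ p3.trace, p3.connected, h3 ▸ p3.reg, fun i hi => by
        rw [p3.rows i (by omega), q2.rows i hi]⟩
  · rw [Cmd.run_ite_pos (hcond.2 (by omega)), Cmd.run]
    exact ⟨h1, h2, Or.inr ⟨q1, q2⟩⟩

/-- If no attempt succeeds, then there is no good pair, so the potential is zero already. -/
theorem run_improve (hH : H.IsPartitionConnected (k + 1)) (hu : Encodes H k u)
    (hk : O.IsHyperarcConnected k) (hrow : IsRow u 1 (u.reg 3) O) :
    ∃ ℓ ≤ n, ∃ seq, IsExtension k O u (improve.run u) ℓ seq ∧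
      (potential (seq ℓ).inDegree k = 0 ∨
        potential (seq ℓ).inDegree k < potential O.inDegree k) := by
  set u1 := u.setReg 20 (u.reg 3) with hu1
  have htab : HasTable k O (tightTable.run u1) :=
    run_tightTable_hasTable (hu.setReg (by omega) _) (by simpa [hu1] using hrow) hk
  have hr : ∀ y, y ∉ tightTable.writes → y ≠ 20 → (tightTable.run u1).reg y = u.reg y :=
    fun y hy hy' => by rw [Cmd.run_reg hy, hu1, State.setReg_reg, if_neg hy']
  have ha : (tightTable.run u1).arr 1 = u.arr 1 := Cmd.run_arr (by decide) u1
  have hpot := htab.eval_potentialExpr (hk.isAdmissible hH)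
  have hrun : improve.run u = (Cmd.forLoop 6 0 (.forLoop 17 0 (.ite (.var 5) .skip attempt))).run
      (((tightTable.run u1).setReg 4 (potential O.inDegree k)).setReg 5 0) := by
    rw [← hpot]
    rfl
  set u2 := tightTable.run u1 with hu2
  set u3 := (u2.setReg 4 (potential O.inDegree k)).setReg 5 0 with hu3
  have h0 : IsSearch k O u (fun _ _ => False) u3 := by
    refine ⟨(htab.encodes.setReg (by omega) _).setReg (by omega) _, by simp [hu3],
      Or.inl ⟨by simp [hu3], .refl hk hrow ?_ ?_, fun _ _ h => h.elim⟩⟩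
    · simp [hu3, hr 3 (by decide)]
    · exact fun i _ => by simp [hu3, ha]
  obtain ⟨t, h1, h2⟩ := Cmd.run_forLoop (x := 6) (b := 0)
    (P := .forLoop 17 0 (.ite (.var 5) .skip attempt)) (u := u3)
    (fun i t => IsSearch k O u (fun a _ => (a : ℕ) < i) t)
    (h0.mono fun a _ h => absurd h (Nat.not_lt_zero _))
    (by
      intro i hi t ht _ _
      rw [h0.1.reg_zero] at hi
      obtain ⟨s, h3, h4⟩ := Cmd.run_forLoop (x := 17) (b := 0)
        (P := .ite (.var 5) .skip attempt) (u := t.setReg 6 i)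
        (fun j s => IsSearch k O u (fun a b => (a : ℕ) < i ∨ (a : ℕ) = i ∧ (b : ℕ) < j) s)
        ((ht.setReg (by omega) i).mono (by omega))
        (by
          intro j hj s hs hreg _
          rw [(ht.setReg (by omega) i).1.reg_zero] at hj
          have h6 : (s.setReg 17 j).reg 6 = i := by
            rw [State.setReg_reg, if_neg (by omega), hreg 6 (by decide) (by decide)]
            simp
          refine ((hs.setReg (y := 17) (by omega) j).run_attempt hH hk (x := ⟨i, hi⟩)
            (w := ⟨j, hj⟩) h6 (by simp)).mono fun a b hab => ?_
          simp only [Fin.ext_iff]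
          omega)
      rw [h4]
      refine (h3.mono fun a b hab => ?_).setReg (by omega) _
      rw [(ht.setReg (by omega) i).1.reg_zero]
      omega)
  rw [hrun, h2]
  obtain ⟨-, -, h3⟩ := h1.setReg (y := 6) (by omega) (u3.reg 0)
  rcases h3 with ⟨-, q1, q2⟩ | ⟨-, ℓ, q1, seq, q2, q3⟩
  · refine ⟨0, Nat.zero_le _, _, q1, Or.inl ?_⟩
    by_contra hpot0
    obtain ⟨x, w, hxw⟩ := hk.exists_transfer hH hpot0
    exact q2 x w (by rw [h0.1.reg_zero]; exact x.2) hxw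
  · exact ⟨ℓ, q1, seq, q2, Or.inr q3⟩

/-- A rule for nested loops that merely count: each round of the loop adds `K` to the counter of the
invariant. -/
theorem run_forLoop_count {y K : ℕ} {P : Cmd} (I : ℕ → State → Prop)
    (hn : ∀ c t, I c t → t.reg 0 = n) (hset : ∀ c t v, I c t → I c (t.setReg y v))
    (hP : ∀ c t, I c t → I (c + K) (P.run t)) (c : ℕ) (t : State) (h : I c t) :
    I (c + n * K) ((Cmd.forLoop y 0 P).run t) := by
  obtain ⟨s, h1, h2⟩ := Cmd.run_forLoop (x := y) (b := 0) (P := P) (u := t)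
    (fun i s => I (c + i * K) s) (by simpa using h)
    (fun i _ s hs _ _ => by
      have := hP _ _ (hset _ _ i hs)
      rwa [show c + i * K + K = c + (i + 1) * K by ring] at this)
  rw [h2, ← hn c t h]
  exact hset _ _ _ h1

/-- The potential is at most `n * (n - 1)`, so it is zero after `n ^ 2` rounds. Each of them adds at
most `n` reorientations. -/
theorem run_improveAll (hH : H.IsPartitionConnected (k + 1)) (hu : Encodes H k u)
    (hk : O.IsHyperarcConnected k) (hrow : IsRow u 1 (u.reg 3) O) :
    ∃ ℓ ≤ n ^ 3, ∃ seq, IsExtension k O u (improveAll.run u) ℓ seq ∧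
      potential (seq ℓ).inDegree k = 0 := by
  let I : ℕ → State → Prop := fun c t => Encodes H k t ∧ ∃ ℓ ≤ n * c, ∃ seq,
    IsExtension k O u t ℓ seq ∧ (potential (seq ℓ).inDegree k = 0 ∨
      potential (seq ℓ).inDegree k + c ≤ n * (n - 1))
  have hset : ∀ y, 4 ≤ y → ∀ c t v, I c t → I c (t.setReg y v) := by
    rintro y hy c t v ⟨h1, ℓ, h2, seq, h3, h4⟩
    exact ⟨h1.setReg (by omega) v, ℓ, h2, seq,
      h3.congr (by rw [State.setReg_reg, if_neg (by omega)]) rfl, h4⟩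
  have hstep : ∀ c t, I c t → I (c + 1) (improve.run t) := by
    rintro c t ⟨h1, ℓ, h2, seq, h3, h4⟩
    refine ⟨h1.run (by decide) (by decide), ?_⟩
    obtain ⟨ℓ', q1, seq', q2, q3⟩ := run_improve hH h1 (h3.connected ℓ le_rfl)
      (by rw [h3.reg]; exact h3.trace.row ℓ le_rfl)
    refine ⟨ℓ + ℓ', by rw [mul_add]; omega, _, h3.trans q2, ?_⟩
    have hend : (if ℓ + ℓ' ≤ ℓ then seq (ℓ + ℓ') else seq' (ℓ + ℓ' - ℓ)) = seq' ℓ' := by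
      split_ifs with h
      · obtain rfl : ℓ' = 0 := by omega
        rw [add_zero, q2.start]
      · rw [Nat.add_sub_cancel_left]
    rw [hend]
    omega
  have h0 : I 0 u := by
    have hle := (hk.isAdmissible hH).potential_le
    rw [Fintype.card_fin] at hle
    exact ⟨hu, 0, Nat.zero_le _, fun _ => O, .refl hk hrow rfl fun _ _ => rfl, Or.inr hle⟩
  have hn : ∀ c t, I c t → t.reg 0 = n := fun c t h => h.1.reg_zero
  have h1 := run_forLoop_count I hn (hset 23 (by omega))
    (run_forLoop_count I hn (hset 24 (by omega)) hstep) 0 u h0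
  obtain ⟨-, ℓ, h2, seq, h3, h4⟩ := h1
  refine ⟨ℓ, h2.trans (le_of_eq (by ring)), seq, h3, h4.elim id fun h => ?_⟩
  have := Nat.mul_le_mul_left n (Nat.sub_le n 1)
  rw [mul_one, zero_add] at h
  omega

/-- The row number increases in each round until the potential is zero, which happens within `n ^ 3`
rounds. -/
theorem run_findFirst (hH : H.IsPartitionConnected (k + 1)) (hu : Encodes H k u) {ℓ : ℕ}
    {seq : ℕ → H.Orientation} (hℓ : ℓ ≤ n ^ 3) (htr : IsTrace u 1 0 ℓ seq)
    (hconn : ∀ i ≤ ℓ, (seq i).IsHyperarcConnected k) (hpot : potential (seq ℓ).inDegree k = 0) :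
    ∃ j ≤ ℓ, (findFirst.run u).reg 25 = j ∧ (findFirst.run u).arr 1 = u.arr 1 ∧
      (∀ i < j, potential (seq i).inDegree k ≠ 0) ∧ potential (seq j).inDegree k = 0 := by
  let I : ℕ → State → Prop := fun c t => Encodes H k t ∧ t.arr 1 = u.arr 1 ∧ t.reg 25 ≤ ℓ ∧
    (∀ i < t.reg 25, potential (seq i).inDegree k ≠ 0) ∧
      (potential (seq (t.reg 25)).inDegree k = 0 ∨ c ≤ t.reg 25)
  have hset : ∀ y, 26 ≤ y → ∀ c t v, I c t → I c (t.setReg y v) := by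
    rintro y hy c t v ⟨h1, h2, h3⟩
    refine ⟨h1.setReg (by omega) v, h2, ?_⟩
    rwa [State.setReg_reg, if_neg (by omega)]
  have hstep : ∀ c t, I c t → I (c + 1) (advance.run t) := by
    rintro c t ⟨h1, h2, h3, h4, h5⟩
    refine ⟨h1.run (by decide) (by decide), by rw [Cmd.run_arr (by decide), h2], ?_⟩
    have hk := hconn _ h3
    have htab : HasTable k (seq (t.reg 25)) (tightTable.run (t.setReg 20 (t.reg 25))) := by
      refine run_tightTable_hasTable (h1.setReg (by omega) _) ?_ hk
      intro e
      have := htr.row _ h3 e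
      rw [zero_add] at this
      simp [h2, this]
    have hev := htab.eval_potentialExpr (hk.isAdmissible hH)
    have hr : (tightTable.run (t.setReg 20 (t.reg 25))).reg 25 = t.reg 25 := by
      rw [Cmd.run_reg (by decide)]
      simp
    have hrun : advance.run t = (Cmd.ite potentialExpr (.assign 25 (.add (.var 25) (.lit 1)))
        .skip).run (tightTable.run (t.setReg 20 (t.reg 25))) := rfl
    by_cases h0 : potential (seq (t.reg 25)).inDegree k = 0
    · rw [hrun, Cmd.run_ite_neg (fun h => h (hev.trans h0)), Cmd.run, hr]
      exact ⟨h3, h4, Or.inl h0⟩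
    · have e25 : (advance.run t).reg 25 = t.reg 25 + 1 := by
        rw [hrun, Cmd.run_ite_pos (fun h => h0 (hev.symm.trans h)), Cmd.run]
        simp [eval, hr]
      rw [e25]
      refine ⟨?_, ?_, Or.inr (by have := h5.resolve_left h0; omega)⟩
      · rcases h3.eq_or_lt with h | h
        · rw [h] at h0
          exact absurd hpot h0
        · exact h
      · intro i hi
        rcases Nat.lt_succ_iff_lt_or_eq.1 hi with h | rfl
        · exact h4 i h
        · exact h0
  have h0 : I 0 (u.setReg 25 0) :=
    ⟨hu.setReg (by omega) _, rfl, by simp, by simp, Or.inr (Nat.zero_le _)⟩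
  have hn : ∀ c t, I c t → t.reg 0 = n := fun c t h => h.1.reg_zero
  have h1 := run_forLoop_count I hn (hset 26 (by omega))
    (run_forLoop_count I hn (hset 27 (by omega))
      (run_forLoop_count I hn (hset 28 (by omega)) hstep)) 0 _ h0
  obtain ⟨-, h2, h3, h4, h5⟩ := h1
  refine ⟨_, h3, rfl, h2, h4, ?_⟩
  rcases h5 with h5 | h5
  · exact h5
  · rw [show 0 + n * (n * (n * 1)) = n ^ 3 by ring] at h5
    rw [le_antisymm h3 (hℓ.trans h5)]
    exact hpot

theorem encodes_inputState (H : MultiHypergraph (Fin n) (Fin m)) (k : ℕ) (O : H.Orientation) :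
    Encodes H k (inputState H k O) :=
  ⟨rfl, rfl, rfl, fun e v => by simp [inputState]⟩

theorem isRow_inputState (H : MultiHypergraph (Fin n) (Fin m)) (k : ℕ) (O : H.Orientation) :
    IsRow (inputState H k O) 1 0 O := fun e => by simp [inputState]

/-- Every hyperedge contributes to the size, because it contains its head. -/
theorem le_size (O : H.Orientation) : n ≤ H.size ∧ m ≤ H.size := by
  have h : m ≤ ∑ e : Fin m, (H.edge e).card := by
    calc m = ∑ _e : Fin m, 1 := by simp
      _ ≤ _ := sum_le_sum fun e _ => card_pos.2 ⟨_, O.head_mem e⟩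
  rw [size, Fintype.card_fin]
  omega

/-- The algorithm: the sequence is built, and its first `(k+1)`-hyperarc-connected member is found.
-/
def augmentCmd : Cmd := .seq improveAll findFirst

/-- The program stores the length of the sequence in the variable `0`, which commands cannot write.
-/
theorem exists_exec_augmentCmd (hH : H.IsPartitionConnected (k + 1))
    (hO : O.IsHyperarcConnected k) : ∃ (t : ℕ) (s : State) (ℓ : ℕ) (seq : ℕ → H.Orientation),
      Exec (.seq augmentCmd.code (.assign 0 (.var 25))) (inputState H k O) t s ∧
      t ≤ (augmentCmd.time + .C 2).eval H.size ∧ ℓ ≤ n ^ 3 ∧ O.IsAugmentingSequence k ℓ seq ∧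
      HoldsSequence s ℓ seq := by
  have hu := encodes_inputState H k O
  obtain ⟨L, h1, seq, h2, h3⟩ := run_improveAll hH hu hO (isRow_inputState H k O)
  have hu1 : Encodes H k (improveAll.run (inputState H k O)) := hu.run (by decide) (by decide)
  obtain ⟨ℓ, h4, h5, h6, h7, h8⟩ := run_findFirst hH hu1 h1 h2.trace h2.connected h3
  obtain ⟨t, s, g1, g2, g3⟩ := Cmd.exec_code (c := augmentCmd) (by decide)
    (s := inputState H k O) (u := inputState H k O) ⟨rfl, fun _ _ => rfl⟩ (le_size O).1
    (le_size O).2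
  have h25 : s.reg 25 = ℓ := (g3.2 25 (by omega)).trans h5
  refine ⟨_, _, ℓ, seq, .seq g1 (.assign s 0 (.var 25)), ?_, h4.trans h1,
    isAugmentingSequence_of_first h2.start (fun i hi => h2.trace.step i (by omega))
      (fun i hi => h2.connected i (by omega)) (fun i hi => ?_) ?_, ?_, ?_⟩
  · simp only [Polynomial.eval_add, Polynomial.eval_C, Expr.cost]
    omega
  · rw [(h2.connected i (by omega)).succ_iff]
    exact h7 i hi
  · rw [(h2.connected ℓ h4).succ_iff]
    exact h8
  · simp [Expr.eval, h25]
  · intro i hi e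
    have := h2.trace.row i (by omega) e
    rw [State.setReg_arr, g3.1, augmentCmd, Cmd.run, h6, ← this]
    simp [inputState]

end RAM
theorem mainTheorem2 :
    (∀ (V E : Type*) [Fintype V] [DecidableEq V] [Fintype E] [DecidableEq E]
        (H : MultiHypergraph V E) (k : ℕ) (O : H.Orientation),
        H.IsPartitionConnected (k + 1) → O.IsHyperarcConnected k →
        ∃ (ℓ : ℕ) (seq : ℕ → H.Orientation),
          ℓ ≤ Fintype.card V ^ 3 ∧ O.IsAugmentingSequence k ℓ seq) ∧
    (∃ (P : RAM.Prog) (p : Polynomial ℕ),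
      ∀ (n m : ℕ) (H : MultiHypergraph (Fin n) (Fin m)) (k : ℕ) (O : H.Orientation),
        H.IsPartitionConnected (k + 1) → O.IsHyperarcConnected k →
        ∃ (t : ℕ) (s : RAM.State) (ℓ : ℕ) (seq : ℕ → H.Orientation),
          RAM.Exec P (RAM.inputState H k O) t s ∧ t ≤ p.eval H.size ∧
          ℓ ≤ n ^ 3 ∧ O.IsAugmentingSequence k ℓ seq ∧ RAM.HoldsSequence s ℓ seq) :=
  ⟨fun _ _ _ _ _ _ _ _ O hH hO => MultiHypergraph.Orientation.exists_isAugmentingSequence hH O hO,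
    _, _, fun _ _ _ _ _ hH hO => RAM.exists_exec_augmentCmd hH hO⟩
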